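/- Let $0<\alpha<1$ and let $V:\mathbb R^2\to\mathbb R$ be measurable, not almost everywhere zero. Put $v=|V|^{1/2}$, let $U(x)=1$ if $V(x)\ge 0$ and $U(x)=-1$ if $V(x)<0$, and assume $v(x)\le C(1+|x|^2)^{\frac12(-\frac32-\alpha-\varepsilon)}$ for almost every $x$, for some constants $C$ and $\varepsilon>0$. For $\lambda>0$ let $R_0^\pm(\lambda^2)$ be the integral operator on $\mathbb R^2$ with kernel $\pm\frac i4H_0^\pm(\lambda|x-y|)$, where $H_0^\pm=J_0\pm iY_0$, let $G_0$ be the integral operator with kernel $-\frac1{2\pi}\log|x-y|$, and put $$M^\pm(\lambda)=U+vR_0^\pm(\lambda^2)v,\qquad T=U+vG_0v,\qquad g^\pm(\lambda)=\|V\|_1\Big(\pm\frac i4-\frac1{2\pi}\log(\lambda/2)-\frac{\gamma}{2\pi}\Big),$$ where $\gamma$ is Euler's constant. Let $P=\|V\|_1^{-1}\langle\cdot,v\rangle v$ be the orthogonal projection of $L^2(\mathbb R^2)$ onto the span of $v$, and $Q=1-P$. Suppose that zero is a regular point of the spectrum of $H=-\Delta+V$, that is, $QTQ$ is invertible on $QL^2(\mathbb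 R^2)$; let $D_0=(QTQ)^{-1}$ on $QL^2(\mathbb R^2)$, and $$S=P-PTQD_0Q-QD_0QTP+QD_0QTPTQD_0Q .$$ Then $T$ is a bounded operator on $L^2(\mathbb R^2)$, and $S$ is a finite-rank operator, of rank at most two, with a real-valued kernel. There is a $c\in\mathbb R$ such that, with $h_\pm(\lambda)=g^\pm(\lambda)+c$, for all sufficiently small $\lambda_1>0$ and all $0<\lambda<\lambda_1$ the operators $M^\pm(\lambda)$ are bounded and boundedly invertible on $L^2(\mathbb R^2)$, $h_\pm(\lambda)\neq0$, and $$M^\pm(\lambda)^{-1}=h_\pm(\lambda)^{-1}S+QD_0Q+E^\pm(\lambda),$$ where $E^\pm(\lambda)$ is an integral operator whose kernel $E^\pm(\lambda)(x,y)$ can be chosen to be differentiable in $\lambda\in(0,\lambda_1)$ for almost every $(x,y)$, with $$\Big\|\sup_{0<\lambda<\lambda_1}\lambda^{-\frac12}|E^\pm(\lambda)|\Big\|_{HS}+\Big\|\sup_{0<\lambda<\lambda_1}\lambda^{\frac12}|\partial_\lambda E^\pm(\lambda)|\Big\|_{HS}+\Big\|\sup_{0<\lambda<b<\lambda_1}\lambda^{\frac12+\alpha}(b-\lambda)^{-\alpha}|\partial_\lambda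 E^\pm(b)-\partial_\lambda E^\pm(\lambda)|\Big\|_{HS}\le C'$$ for a finite constant $C'$ independent of $\lambda_1$. Here the suprema are taken pointwise on the kernels, and $\|\cdot\|_{HS}$ is the norm of the kernel in $L^2(\mathbb R^2\times\mathbb R^2)$. -/

import Mathlib

open MeasureTheory Set
open scoped ENNReal NNReal

noncomputable section

namespace Schr2D

/-- The Euclidean plane. -/
abbrev Plane : Type := EuclideanSpace ℝ (Fin 2)

/-- The complex Hilbert space `L²(ℝ²)`. -/
abbrev L2 : Type := Lp ℂ 2 (volume : Measure Plane)

/-! ### Operators given by a multiplier and an integral kernel -/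

/-- `A` is the bounded operator `(A f)(x) = u(x) f(x) + ∫ K(x,y) f(y) dy` on `L²(ℝ²)`
(with `u = 0` it is the integral operator with kernel `K`). -/
def IsMulAddKernel (u : Plane → ℂ) (K : Plane → Plane → ℂ) (A : L2 →L[ℂ] L2) : Prop :=
  AEStronglyMeasurable (fun p : Plane × Plane => K p.1 p.2) volume ∧
  ∀ f : L2, ∀ᵐ x : Plane,
    Integrable (fun y => K x y * f y) ∧ A f x = u x * f x + ∫ y, K x y * f y

/-- `A` is the integral operator with kernel `K`. -/
def HasKernel (A : L2 →L[ℂ] L2) (K : Plane → Plane → ℂ) : Prop :=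
  IsMulAddKernel (fun _ => 0) K A

/-- The multiplier and the kernel determine the operator. -/
theorem IsMulAddKernel.unique {u : Plane → ℂ} {K : Plane → Plane → ℂ} {A B : L2 →L[ℂ] L2}
    (hA : IsMulAddKernel u K A) (hB : IsMulAddKernel u K B) : A = B := by
  ext1 f
  refine Lp.ext ?_
  filter_upwards [hA.2 f, hB.2 f] with x h1 h2
  rw [h1.2, h2.2]

open Classical in
/-- The bounded operator `f ↦ u f + ∫ K(·,y) f(y) dy` on `L²(ℝ²)`; it is unique by
`IsMulAddKernel.unique`, and the value is `0` if there is no such bounded operator. -/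
def opOf (u : Plane → ℂ) (K : Plane → Plane → ℂ) : L2 →L[ℂ] L2 :=
  if h : ∃ A, IsMulAddKernel u K A then h.choose else 0

/-- Wherever there is an operator with the given multiplier and kernel, `opOf` is that operator. -/
theorem opOf_eq {u : Plane → ℂ} {K : Plane → Plane → ℂ} {A : L2 →L[ℂ] L2}
    (hA : IsMulAddKernel u K A) : opOf u K = A := by
  have h : ∃ A, IsMulAddKernel u K A := ⟨A, hA⟩
  rw [opOf, dif_pos h]
  exact h.choose_spec.unique hA

/-- The Hilbert–Schmidt norm of the integral operator with the nonnegative kernel `G`,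
i.e. the norm of `G` in `L²(ℝ² × ℝ²)`. -/
def hsNorm (G : Plane → Plane → ℝ≥0∞) : ℝ≥0∞ :=
  (∫⁻ p : Plane × Plane, G p.1 p.2 ^ 2) ^ (1 / 2 : ℝ)

/-! ### Bessel functions and the free resolvent -/

/-- The Bessel function `J₀`. -/
def besselJ0 (z : ℝ) : ℝ :=
  ∑' k : ℕ, (-1) ^ k * (z / 2) ^ (2 * k) / (k.factorial : ℝ) ^ 2

/-- The Bessel function of the second kind `Y₀`, for `z > 0`. -/
def besselY0 (z : ℝ) : ℝ :=
  2 / Real.pi * (Real.log (z / 2) + Real.eulerMascheroniConstant) * besselJ0 z +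
    2 / Real.pi *
      ∑' k : ℕ, (-1) ^ (k + 1) * (harmonic k : ℝ) * (z / 2) ^ (2 * k) / (k.factorial : ℝ) ^ 2

/-- The sign `±`, as a complex number. -/
def sgn (σ : ℤˣ) : ℂ := ((σ : ℤ) : ℂ)

/-- The Hankel functions `H₀^± = J₀ ± i Y₀`. -/
def hankel0 (σ : ℤˣ) (z : ℝ) : ℂ := besselJ0 z + sgn σ * Complex.I * besselY0 z

/-- The kernel of the free resolvent `R₀^±(λ²) = (-Δ - (λ² ± i0))⁻¹` on `ℝ²`. -/
def freeResolvent (σ : ℤˣ) (l : ℝ) (x y : Plane) : ℂ :=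
  sgn σ * (Complex.I / 4) * hankel0 σ (l * ‖x - y‖)

/-- The kernel `-(2π)⁻¹ log |x - y|` of `G₀`. -/
def G0 (x y : Plane) : ℂ := ((-(1 / (2 * Real.pi)) * Real.log ‖x - y‖ : ℝ) : ℂ)

/-! ### The potential and the operators attached to it -/

/-- `U(x) = 1` if `V(x) ≥ 0`, and `U(x) = -1` if `V(x) < 0`. -/
def U (V : Plane → ℝ) (x : Plane) : ℂ := if 0 ≤ V x then 1 else -1

/-- `v = |V|^{1/2}`. -/
def v (V : Plane → ℝ) (x : Plane) : ℝ := Real.sqrt |V x|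

open Classical in
/-- `v` as an element of `L²(ℝ²)` (zero if `v` is not square integrable). -/
def vL2 (V : Plane → ℝ) : L2 :=
  if h : MemLp (fun x => (v V x : ℂ)) 2 (volume : Measure Plane) then h.toLp _ else 0

/-- `‖V‖₁`. -/
def normV (V : Plane → ℝ) : ℝ := ∫ x, |V x|

/-- `M^±(λ) = U + v R₀^±(λ²) v`. -/
def M (V : Plane → ℝ) (σ : ℤˣ) (l : ℝ) : L2 →L[ℂ] L2 :=
  opOf (U V) (fun x y => v V x * freeResolvent σ l x y * v V y)

/-- `T = U + v G₀ v`. -/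
def T (V : Plane → ℝ) : L2 →L[ℂ] L2 :=
  opOf (U V) (fun x y => v V x * G0 x y * v V y)

/-- The orthogonal projection `P = ‖V‖₁⁻¹ ⟨·, v⟩ v` onto the line spanned by `v`. -/
def P (V : Plane → ℝ) : L2 →L[ℂ] L2 := (Submodule.span ℂ {vL2 V}).starProjection

/-- The subspace `Q L²(ℝ²)`, `Q = 1 - P`: the orthogonal complement of `v`. -/
abbrev QL2 (V : Plane → ℝ) : Submodule ℂ L2 := (Submodule.span ℂ {vL2 V})ᗮ

/-- `Q T Q` as a bounded operator on `Q L²(ℝ²)`. -/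
def QTQ (V : Plane → ℝ) : QL2 V →L[ℂ] QL2 V :=
  (QL2 V).orthogonalProjectionOnto ∘L T V ∘L (QL2 V).subtypeL

/-- Zero is a regular point of the spectrum of `-Δ + V`: `Q T Q` is invertible on `Q L²`. -/
def ZeroIsRegular (V : Plane → ℝ) : Prop := IsUnit (QTQ V)

/-- `D₀ = (Q T Q)⁻¹` on `Q L²(ℝ²)`. -/
def D0 (V : Plane → ℝ) : QL2 V →L[ℂ] QL2 V := Ring.inverse (QTQ V)

/-- `Q D₀ Q` as a bounded operator on `L²(ℝ²)`. -/
def QDQ (V : Plane → ℝ) : L2 →L[ℂ] L2 :=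
  (QL2 V).subtypeL ∘L D0 V ∘L (QL2 V).orthogonalProjectionOnto

/-- The operator with the block matrix
`[[P, -P T Q D₀ Q], [-Q D₀ Q T P, Q D₀ Q T P T Q D₀ Q]]` with respect to `P L² ⊕ Q L²`. -/
def S (V : Plane → ℝ) : L2 →L[ℂ] L2 :=
  P V - P V * T V * QDQ V - QDQ V * T V * P V + QDQ V * T V * P V * T V * QDQ V

/-- `g^±(λ) = ‖V‖₁ (± i/4 - (2π)⁻¹ log(λ/2) - γ/(2π))`. -/
def g (V : Plane → ℝ) (σ : ℤˣ) (l : ℝ) : ℂ :=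
  normV V * (sgn σ * (Complex.I / 4) -
    ((1 / (2 * Real.pi) * Real.log (l / 2) + Real.eulerMascheroniConstant / (2 * Real.pi) : ℝ) : ℂ))

/-! ### The quantities in the error bounds, for a kernel `k λ x y` and `0 < λ < l₁` -/

/-- `sup_{0<λ<l₁} λ^{-1/2} |k(λ)|`. -/
def sup0 (k : ℝ → Plane → Plane → ℂ) (l₁ : ℝ) (x y : Plane) : ℝ≥0∞ :=
  ⨆ l ∈ Ioo 0 l₁, ENNReal.ofReal (l ^ (-(1 / 2) : ℝ) * ‖k l x y‖)

/-- `sup_{0<λ<l₁} λ^{1/2} |∂_λ k(λ)|`. -/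
def sup1 (k : ℝ → Plane → Plane → ℂ) (l₁ : ℝ) (x y : Plane) : ℝ≥0∞ :=
  ⨆ l ∈ Ioo 0 l₁, ENNReal.ofReal (l ^ (1 / 2 : ℝ) * ‖deriv (fun t => k t x y) l‖)

/-- `sup_{0<λ<b<l₁} λ^{1/2+α} (b-λ)^{-α} |∂_λ k(b) - ∂_λ k(λ)|`. -/
def supHolder (α : ℝ) (k : ℝ → Plane → Plane → ℂ) (l₁ : ℝ) (x y : Plane) : ℝ≥0∞ :=
  ⨆ b ∈ Ioo 0 l₁, ⨆ l ∈ Ioo 0 b,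
    ENNReal.ofReal (l ^ (1 / 2 + α) * (b - l) ^ (-α) *
      ‖deriv (fun t => k t x y) b - deriv (fun t => k t x y) l‖)

end Schr2D

end

noncomputable section

namespace Schr2D

/-! ### Functions of the spectral parameter with power-type bounds -/

/-! The series of J₀ and Y₀ split the free resolvent kernel into three pieces: a term independent of
x and y that grows like log λ, the kernel of G₀, and a remainder depending on λ|x-y|
(`freeResolvent_eq`). Between two factors v the first piece becomes g P. Hence M = A + r, where A =
g P + T and r is the remainder between two factors v.

The operator A is inverted exactly. Since P has rank one and QTQ is invertible, the Feshbach (Schur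
complement) formula gives A⁻¹ = (g + c)⁻¹ S + Q D₀ Q, where c is the real number with P T P - P T Q
D₀ Q T P = c P (`exists_inverse`). The imaginary part of g + c is ±‖V‖₁/4, so g + c never vanishes
and A⁻¹ is bounded uniformly in λ. As r tends to zero in operator norm, a Neumann series inverts M
for small λ, and E = M⁻¹ - A⁻¹.

The suprema over λ stand inside the Hilbert–Schmidt norm, so norm bounds on E are not enough: a
kernel must be estimated pointwise. Because U² = 1, each of A⁻¹ and M⁻¹ is U plus a product
containing a Hilbert–Schmidt factor. Inserting this in E = -A⁻¹ r M⁻¹ gives r itself and products K₁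
B K₂ with K₁, K₂ Hilbert–Schmidt and B bounded, all between two factors U (`inverse_sub_inverse`).
The kernel of K₁ B K₂ at (x,y) is an inner product of a section of K₁ at x with B applied to a
section of K₂ at y (`compK`). For almost every fixed (x,y) its dependence on λ is then controlled by
C N(x) N(y), where N(x) is the L² norm of W(x,·) for one dominating kernel W, and N is square
integrable.

Sizes, derivatives and Hölder quotients in λ are tracked together by `HolderSymbol`. Exponents add
under products, and inversion with a bounded inverse doubles a nonpositive exponent. The logarithm
has exponent -d for every d > 0, so the singular and full kernels have exponent -d, the two inverses
-2d, and r has 1/2 + 6d. The worst term has exponent -d - 2d + (1/2 + 6d) - 2d - d = 1/2, which is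
the claim.

The analytic input is the bound on the remainder as a function of z = λ|x-y|: power series for z ≤
1, and for z ≥ 1 a monotone energy for Bessel's equation (`bessel_decay`). The resulting weight
(1+|x-y|)^(1/2+6d+α) + |x-y|^(-1/2) between two factors v is square integrable thanks to the decay
of v, with 6d < ε (`Decays.memLp_weightK`). -/

/-- `F` is differentiable on `(0, l₀)`, with `|F| ≤ a λ^p`, `|F'| ≤ a λ^(p-1)`, and `F'` is locally
Hölder continuous of order `α` with the constant `a λ^(p-1-α)`. -/
structure HolderSymbol {E : Type*} [NormedAddCommGroup E] [NormedSpace ℝ E]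
    (α p l₀ : ℝ) (F : ℝ → E) (a : ℝ) : Prop where
  diff : ∀ l ∈ Ioo 0 l₀, DifferentiableAt ℝ F l
  bound : ∀ l ∈ Ioo 0 l₀, ‖F l‖ ≤ a * l ^ p
  deriv_bound : ∀ l ∈ Ioo 0 l₀, ‖deriv F l‖ ≤ a * l ^ (p - 1)
  holder : ∀ l ∈ Ioo 0 l₀, ∀ b ∈ Ioo 0 l₀, l < b → b ≤ 2 * l →
    ‖deriv F b - deriv F l‖ ≤ a * l ^ (p - 1 - α) * (b - l) ^ α

/-- In the dyadic range b ≤ 2l the increment is at most l, so a Lipschitz bound can be exchanged for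
a Hölder bound at the price of a power of l. -/
theorem sub_le_rpow_mul_rpow {α l b : ℝ} (hα1 : α ≤ 1) (hb : l < b)
    (hb2 : b ≤ 2 * l) : b - l ≤ l ^ (1 - α) * (b - l) ^ α := by
  have h0 : 0 < b - l := by linarith
  calc b - l = (b - l) ^ (1 - α) * (b - l) ^ α := by
        rw [← Real.rpow_add h0]; simp
    _ ≤ l ^ (1 - α) * (b - l) ^ α := by
        have := Real.rpow_le_rpow h0.le (by linarith : b - l ≤ l) (by linarith : 0 ≤ 1 - α)
        gcongr

/-- Powers at comparable points are comparable. The factor 2 suffices because q ≤ 1. -/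
theorem rpow_le_two_mul_rpow {q l b : ℝ} (hq : q ≤ 1) (hl : 0 < l) (hb : l < b)
    (hb2 : b ≤ 2 * l) : b ^ q ≤ 2 * l ^ q := by
  have hlq := Real.rpow_pos_of_pos hl q
  rcases le_total 0 q with h | h
  · calc b ^ q ≤ (2 * l) ^ q := Real.rpow_le_rpow (by linarith) hb2 h
      _ = 2 ^ q * l ^ q := Real.mul_rpow (by norm_num) hl.le
      _ ≤ 2 * l ^ q := by
        have : (2 : ℝ) ^ q ≤ 2 ^ (1 : ℝ) := Real.rpow_le_rpow_of_exponent_le (by norm_num) hq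
        rw [Real.rpow_one] at this
        gcongr
  · have := Real.rpow_le_rpow_of_nonpos hl hb.le h
    linarith

namespace HolderSymbol

section basic

variable {E F G : Type*} [NormedAddCommGroup E] [NormedSpace ℝ E]
  [NormedAddCommGroup F] [NormedSpace ℝ F] [NormedAddCommGroup G] [NormedSpace ℝ G]
  {α p q l₀ a b : ℝ} {f f₁ f₂ : ℝ → E} {g : ℝ → F}

theorem hasDerivAt (h : HolderSymbol α p l₀ f a) {l : ℝ} (hl : l ∈ Ioo 0 l₀) :
    HasDerivAt f (deriv f l) l := (h.diff l hl).hasDerivAt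

/-- It is enough to know the bounds for some derivative. -/
theorem of_hasDerivAt {f' : ℝ → E} (hd : ∀ l ∈ Ioo 0 l₀, HasDerivAt f (f' l) l)
    (h0 : ∀ l ∈ Ioo 0 l₀, ‖f l‖ ≤ a * l ^ p) (h1 : ∀ l ∈ Ioo 0 l₀, ‖f' l‖ ≤ a * l ^ (p - 1))
    (h2 : ∀ l ∈ Ioo 0 l₀, ∀ b ∈ Ioo 0 l₀, l < b → b ≤ 2 * l →
      ‖f' b - f' l‖ ≤ a * l ^ (p - 1 - α) * (b - l) ^ α) : HolderSymbol α p l₀ f a where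
  diff l hl := (hd l hl).differentiableAt
  bound := h0
  deriv_bound l hl := by rw [(hd l hl).deriv]; exact h1 l hl
  holder l hl b hb h h' := by
    rw [(hd l hl).deriv, (hd b hb).deriv]; exact h2 l hl b hb h h'

theorem congr (h : HolderSymbol α p l₀ f₁ a) (he : ∀ l ∈ Ioo 0 l₀, f₂ l = f₁ l) :
    HolderSymbol α p l₀ f₂ a := by
  refine of_hasDerivAt (f' := deriv f₁) (fun l hl => ?_) (fun l hl => ?_) h.deriv_bound h.holder
  · refine (h.hasDerivAt hl).congr_of_eventuallyEq ?_
    filter_upwards [isOpen_Ioo.mem_nhds hl] with t ht using he t ht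
  · rw [he l hl]; exact h.bound l hl

theorem mono_const (h : HolderSymbol α p l₀ f a) (hab : a ≤ b) : HolderSymbol α p l₀ f b where
  diff := h.diff
  bound l hl := (h.bound l hl).trans
    (mul_le_mul_of_nonneg_right hab (Real.rpow_nonneg hl.1.le _))
  deriv_bound l hl := (h.deriv_bound l hl).trans
    (mul_le_mul_of_nonneg_right hab (Real.rpow_nonneg hl.1.le _))
  holder l hl c hc h1 h2 := (h.holder l hl c hc h1 h2).trans (by
    have := Real.rpow_nonneg hl.1.le (p - 1 - α)
    have := Real.rpow_nonneg (sub_pos.2 h1).le α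
    gcongr)

theorem mono_exponent (h : HolderSymbol α p l₀ f a) (hl₀ : l₀ ≤ 1) (ha : 0 ≤ a) (hqp : q ≤ p) :
    HolderSymbol α q l₀ f a where
  diff := h.diff
  bound l hl := (h.bound l hl).trans (mul_le_mul_of_nonneg_left
    (Real.rpow_le_rpow_of_exponent_ge hl.1 (hl.2.le.trans hl₀) hqp) ha)
  deriv_bound l hl := (h.deriv_bound l hl).trans (mul_le_mul_of_nonneg_left
    (Real.rpow_le_rpow_of_exponent_ge hl.1 (hl.2.le.trans hl₀) (by linarith)) ha)
  holder l hl c hc h1 h2 := (h.holder l hl c hc h1 h2).trans (by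
    have := Real.rpow_nonneg (sub_pos.2 h1).le α
    have := Real.rpow_le_rpow_of_exponent_ge hl.1 (hl.2.le.trans hl₀)
      (by linarith : q - 1 - α ≤ p - 1 - α)
    gcongr)

theorem mono_right {l₁ : ℝ} (h : HolderSymbol α p l₀ f a) (hl : l₁ ≤ l₀) :
    HolderSymbol α p l₁ f a where
  diff l h1 := h.diff l ⟨h1.1, h1.2.trans_le hl⟩
  bound l h1 := h.bound l ⟨h1.1, h1.2.trans_le hl⟩
  deriv_bound l h1 := h.deriv_bound l ⟨h1.1, h1.2.trans_le hl⟩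
  holder l h1 c h2 := h.holder l ⟨h1.1, h1.2.trans_le hl⟩ c ⟨h2.1, h2.2.trans_le hl⟩

theorem add (h₁ : HolderSymbol α p l₀ f₁ a) (h₂ : HolderSymbol α p l₀ f₂ b) :
    HolderSymbol α p l₀ (fun l => f₁ l + f₂ l) (a + b) := by
  refine of_hasDerivAt (fun l hl => (h₁.hasDerivAt hl).add (h₂.hasDerivAt hl))
    (fun l hl => ?_) (fun l hl => ?_) (fun l hl c hc h h' => ?_)
  · exact (norm_add_le _ _).trans (by linarith [h₁.bound l hl, h₂.bound l hl])
  · exact (norm_add_le _ _).trans (by linarith [h₁.deriv_bound l hl, h₂.deriv_bound l hl])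
  · rw [add_sub_add_comm]
    exact (norm_add_le _ _).trans (by linarith [h₁.holder l hl c hc h h', h₂.holder l hl c hc h h'])

/-- The image under an additive map that preserves derivatives and does not increase norms by
more than the factor `K`. -/
theorem map_of (h : HolderSymbol α p l₀ f a) {K : ℝ} (hK : 0 ≤ K) (A : E → F)
    (hsub : ∀ x y, A (x - y) = A x - A y) (hA : ∀ x, ‖A x‖ ≤ K * ‖x‖)
    (hd : ∀ l, ∀ f' : E, HasDerivAt f f' l → HasDerivAt (fun t => A (f t)) (A f') l) :
    HolderSymbol α p l₀ (fun l => A (f l)) (K * a) := by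
  refine of_hasDerivAt (fun l hl => hd l _ (h.hasDerivAt hl))
    (fun l hl => ?_) (fun l hl => ?_) (fun l hl c hc h1 h2 => ?_)
  · exact (hA _).trans (by rw [mul_assoc]; gcongr; exact h.bound l hl)
  · exact (hA _).trans (by rw [mul_assoc]; gcongr; exact h.deriv_bound l hl)
  · rw [← hsub]
    refine (hA _).trans ?_
    rw [mul_assoc, mul_assoc, ← mul_assoc a]
    gcongr; exact h.holder l hl c hc h1 h2

theorem clm (h : HolderSymbol α p l₀ f a) {K : ℝ} (A : E →L[ℝ] F) (hA : ‖A‖ ≤ K) :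
    HolderSymbol α p l₀ (fun l => A (f l)) (K * a) :=
  h.map_of ((norm_nonneg A).trans hA) A (map_sub A)
    (fun x => (A.le_opNorm x).trans (by gcongr)) fun _ _ hf => A.hasFDerivAt.comp_hasDerivAt _ hf

theorem neg (h : HolderSymbol α p l₀ f a) : HolderSymbol α p l₀ (fun l => -f l) a := by
  have := h.map_of (K := 1) zero_le_one (fun x => -x) (fun x y => by abel) (by simp)
    (fun l f' hf => hf.neg)
  rwa [one_mul] at this

/-- Mean value inequality. As p ≤ 1, the bound on the derivative is nonincreasing, so its value at
the left endpoint controls the whole interval. -/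
theorem norm_sub_le (h : HolderSymbol α p l₀ f a) (hp : p ≤ 1) (ha : 0 ≤ a) {l b : ℝ}
    (hl : l ∈ Ioo 0 l₀) (hb : b ∈ Ioo 0 l₀) (hlb : l < b) :
    ‖f b - f l‖ ≤ a * l ^ (p - 1) * (b - l) := by
  have hsub : Icc l b ⊆ Ioo 0 l₀ := fun t ht => ⟨hl.1.trans_le ht.1, ht.2.trans_lt hb.2⟩
  have := Convex.norm_image_sub_le_of_norm_hasDerivWithin_le (f := f) (f' := deriv f)
    (C := a * l ^ (p - 1)) (s := Icc l b)
    (fun x hx => (h.hasDerivAt (hsub hx)).hasDerivWithinAt)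
    (fun x hx => (h.deriv_bound x (hsub hx)).trans (mul_le_mul_of_nonneg_left
      (Real.rpow_le_rpow_of_nonpos hl.1 hx.1 (by linarith)) ha)) (convex_Icc l b)
    (left_mem_Icc.2 hlb.le) (right_mem_Icc.2 hlb.le)
  rwa [Real.norm_of_nonneg (by linarith)] at this

theorem norm_sub_le_holder (h : HolderSymbol α p l₀ f a) (hα1 : α ≤ 1) (hp : p ≤ 1) (ha : 0 ≤ a)
    {l b : ℝ} (hl : l ∈ Ioo 0 l₀) (hb : b ∈ Ioo 0 l₀) (hlb : l < b) (hb2 : b ≤ 2 * l) :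
    ‖f b - f l‖ ≤ a * l ^ (p - α) * (b - l) ^ α := by
  refine (h.norm_sub_le hp ha hl hb hlb).trans ?_
  have h1 := sub_le_rpow_mul_rpow hα1 hlb hb2
  have h2 : l ^ (p - α) = l ^ (p - 1) * l ^ (1 - α) := by
    rw [← Real.rpow_add hl.1]; congr 1; ring
  have := Real.rpow_nonneg hl.1.le (p - 1)
  rw [h2]
  calc a * l ^ (p - 1) * (b - l) ≤ a * l ^ (p - 1) * (l ^ (1 - α) * (b - l) ^ α) := by gcongr
    _ = _ := by ring

/-- This removes the restriction b ≤ 2l: beyond it b - l exceeds l, and the triangle inequality with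
the two derivative bounds is already of Hölder form. That costs the factor 2. -/
theorem deriv_sub_le (h : HolderSymbol α p l₀ f a) (hα0 : 0 ≤ α) (hp : p ≤ 1) (ha : 0 ≤ a)
    {l b : ℝ} (hl : l ∈ Ioo 0 l₀) (hb : b ∈ Ioo 0 l₀) (hlb : l < b) :
    ‖deriv f b - deriv f l‖ ≤ 2 * a * l ^ (p - 1 - α) * (b - l) ^ α := by
  have hbl : 0 < b - l := by linarith
  have hr := Real.rpow_nonneg hl.1.le (p - 1 - α)
  have hs := Real.rpow_nonneg hbl.le α
  rcases le_or_gt b (2 * l) with hb2 | hb2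
  · refine (h.holder l hl b hb hlb hb2).trans ?_
    have : 0 ≤ a * l ^ (p - 1 - α) * (b - l) ^ α := by positivity
    linarith
  · have h1 := h.deriv_bound l hl
    have h2 := h.deriv_bound b hb
    have h3 : b ^ (p - 1) ≤ l ^ (p - 1) :=
      Real.rpow_le_rpow_of_nonpos hl.1 hlb.le (by linarith)
    have h4 : l ^ α ≤ (b - l) ^ α := Real.rpow_le_rpow hl.1.le (by linarith) hα0
    have h5 : l ^ (p - 1) = l ^ (p - 1 - α) * l ^ α := by
      rw [← Real.rpow_add hl.1]; congr 1; ring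
    calc ‖deriv f b - deriv f l‖ ≤ ‖deriv f b‖ + ‖deriv f l‖ := _root_.norm_sub_le _ _
      _ ≤ a * l ^ (p - 1) + a * l ^ (p - 1) := by
        refine add_le_add (h2.trans ?_) h1; gcongr
      _ = 2 * a * l ^ (p - 1 - α) * l ^ α := by rw [h5]; ring
      _ ≤ _ := by gcongr

theorem const_nonneg (h : HolderSymbol α p l₀ f a) (hl₀ : 0 < l₀) : 0 ≤ a := by
  have := (norm_nonneg _).trans (h.bound (l₀ / 2) ⟨by linarith, by linarith⟩)
  exact nonneg_of_mul_nonneg_left this (Real.rpow_pos_of_pos (by linarith) _)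

/-- Leibniz rule. The Hölder difference of the derivative telescopes into four terms. In the two
where one undifferentiated factor is evaluated at the right endpoint, moving its power to the left
endpoint costs a factor 2; hence 6 = 2 + 1 + 2 + 1. -/
theorem bilin {B : E × F → G} (hB : IsBoundedBilinearMap ℝ B)
    (hB1 : ∀ x y, ‖B (x, y)‖ ≤ ‖x‖ * ‖y‖) (hf : HolderSymbol α p l₀ f a)
    (hg : HolderSymbol α q l₀ g b) (hα1 : α ≤ 1) (hp : p ≤ 1) (hq : q ≤ 1)
    (hl₀ : 0 < l₀) : HolderSymbol α (p + q) l₀ (fun l => B (f l, g l)) (6 * (a * b)) := by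
  have ha := hf.const_nonneg hl₀
  have hb := hg.const_nonneg hl₀
  have hab := mul_nonneg ha hb
  refine of_hasDerivAt (f' := fun l => B (f l, deriv g l) + B (deriv f l, g l))
    (fun l hl => ?_) (fun l hl => ?_) (fun l hl => ?_) (fun l hl c hc h1 h2 => ?_)
  · have := (hB.hasFDerivAt (f l, g l)).comp_hasDerivAt l
      ((hf.hasDerivAt hl).prodMk (hg.hasDerivAt hl))
    simpa [Function.comp_def] using this
  · have hr := Real.rpow_pos_of_pos hl.1 (p + q)
    calc ‖B (f l, g l)‖ ≤ (a * l ^ p) * (b * l ^ q) := (hB1 _ _).trans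
          (mul_le_mul (hf.bound l hl) (hg.bound l hl) (norm_nonneg _)
            ((norm_nonneg _).trans (hf.bound l hl)))
      _ = a * b * l ^ (p + q) := by rw [Real.rpow_add hl.1]; ring
      _ ≤ 6 * (a * b) * l ^ (p + q) := mul_le_mul_of_nonneg_right (by linarith) hr.le
  · have hr := Real.rpow_pos_of_pos hl.1 (p + q - 1)
    have e1 : l ^ p * l ^ (q - 1) = l ^ (p + q - 1) := by
      rw [← Real.rpow_add hl.1]; congr 1; ring
    have e2 : l ^ (p - 1) * l ^ q = l ^ (p + q - 1) := by
      rw [← Real.rpow_add hl.1]; congr 1; ring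
    calc ‖B (f l, deriv g l) + B (deriv f l, g l)‖
        ≤ (a * l ^ p) * (b * l ^ (q - 1)) + (a * l ^ (p - 1)) * (b * l ^ q) :=
          (norm_add_le _ _).trans (add_le_add
          ((hB1 _ _).trans (mul_le_mul (hf.bound l hl) (hg.deriv_bound l hl) (norm_nonneg _)
            ((norm_nonneg _).trans (hf.bound l hl))))
          ((hB1 _ _).trans (mul_le_mul (hf.deriv_bound l hl) (hg.bound l hl) (norm_nonneg _)
            ((norm_nonneg _).trans (hf.deriv_bound l hl)))))
      _ = 2 * (a * b) * l ^ (p + q - 1) := by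
          linear_combination (a * b) * e1 + (a * b) * e2
      _ ≤ 6 * (a * b) * l ^ (p + q - 1) := by gcongr; norm_num
  · have hcl : 0 < c - l := by linarith
    have hs := Real.rpow_nonneg hcl.le α
    have hr := Real.rpow_pos_of_pos hl.1 (p + q - 1 - α)
    have hlp := Real.rpow_pos_of_pos hl.1
    have e : B (f c, deriv g c) + B (deriv f c, g c) - (B (f l, deriv g l) + B (deriv f l, g l))
        = (B (f c, deriv g c - deriv g l) + B (f c - f l, deriv g l))
          + (B (deriv f c - deriv f l, g c) + B (deriv f l, g c - g l)) := by
      rw [hB.map_sub_right, hB.map_sub_left, hB.map_sub_left, hB.map_sub_right]; abel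
    have b1 : ‖f c‖ ≤ a * (2 * l ^ p) := (hf.bound c hc).trans (by
      gcongr; exact rpow_le_two_mul_rpow hp hl.1 h1 h2)
    have b2 : ‖g c‖ ≤ b * (2 * l ^ q) := (hg.bound c hc).trans (by
      gcongr; exact rpow_le_two_mul_rpow hq hl.1 h1 h2)
    have b3 := hf.norm_sub_le_holder hα1 hp ha hl hc h1 h2
    have b4 := hg.norm_sub_le_holder hα1 hq hb hl hc h1 h2
    have b5 := hf.holder l hl c hc h1 h2
    have b6 := hg.holder l hl c hc h1 h2
    have b7 := hf.deriv_bound l hl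
    have b8 := hg.deriv_bound l hl
    have e1 : l ^ p * l ^ (q - 1 - α) = l ^ (p + q - 1 - α) := by
      rw [← Real.rpow_add hl.1]; congr 1; ring
    have e2 : l ^ (p - α) * l ^ (q - 1) = l ^ (p + q - 1 - α) := by
      rw [← Real.rpow_add hl.1]; congr 1; ring
    have e3 : l ^ (p - 1 - α) * l ^ q = l ^ (p + q - 1 - α) := by
      rw [← Real.rpow_add hl.1]; congr 1; ring
    have e4 : l ^ (p - 1) * l ^ (q - α) = l ^ (p + q - 1 - α) := by
      rw [← Real.rpow_add hl.1]; congr 1; ring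
    have key : ∀ (x : E) (y : F) (s t : ℝ), ‖x‖ ≤ s → ‖y‖ ≤ t → ‖B (x, y)‖ ≤ s * t :=
      fun x y s t hx hy => (hB1 _ _).trans
        (mul_le_mul hx hy (norm_nonneg _) ((norm_nonneg _).trans hx))
    rw [e]
    refine ((norm_add_le _ _).trans (add_le_add ((norm_add_le _ _).trans
      (add_le_add (key _ _ _ _ b1 b6) (key _ _ _ _ b3 b8))) ((norm_add_le _ _).trans
      (add_le_add (key _ _ _ _ b5 b2) (key _ _ _ _ b7 b4))))).trans (le_of_eq ?_)
    linear_combination (2 * a * b * (c - l) ^ α) * e1 + (a * b * (c - l) ^ α) * e2 +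
      (2 * a * b * (c - l) ^ α) * e3 + (a * b * (c - l) ^ α) * e4

end basic

section ring

variable {R : Type*} [NormedRing R] [NormedAlgebra ℝ R]
  {α p q l₀ a b : ℝ} {f g : ℝ → R}

theorem mul (hf : HolderSymbol α p l₀ f a)
    (hg : HolderSymbol α q l₀ g b) (hα1 : α ≤ 1) (hp : p ≤ 1) (hq : q ≤ 1)
    (hl₀ : 0 < l₀) : HolderSymbol α (p + q) l₀ (fun l => f l * g l) (6 * (a * b)) := by
  have hB : IsBoundedBilinearMap ℝ (fun x : R × R => x.1 * x.2) :=
    (ContinuousLinearMap.mul ℝ R).isBoundedBilinearMap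
  exact hf.bilin hB (fun x y => norm_mul_le x y) hg hα1 hp hq hl₀

/-- The derivative of the inverse G is -G f' G, and the difference of two values of G is -G(b)(f(b)
- f(l))G(l). Varying an outer factor therefore pairs an increment of f with f', which gives the
exponent 2p. The terms linear in f only need p, and l^p ≤ l^(2p) because p ≤ 0 and l ≤ 1. -/
theorem ring_inverse [HasSummableGeomSeries R] {c : ℝ} (hf : HolderSymbol α p l₀ f a) (hα1 : α ≤ 1) (hp : p ≤ 0)
    (hl₀ : 0 < l₀) (hl₀1 : l₀ ≤ 1) (hu : ∀ l ∈ Ioo 0 l₀, IsUnit (f l))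
    (hc : ∀ l ∈ Ioo 0 l₀, ‖Ring.inverse (f l)‖ ≤ c) :
    HolderSymbol α (2 * p) l₀ (fun l => Ring.inverse (f l)) (c + c ^ 2 * a + 2 * c ^ 3 * a ^ 2) := by
  have ha := hf.const_nonneg hl₀
  have hc0 : 0 ≤ c := (norm_nonneg _).trans (hc (l₀ / 2) ⟨by linarith, by linarith⟩)
  set G := fun l => Ring.inverse (f l) with hG
  have key3 : ∀ (x y z : R) (s t u : ℝ), ‖x‖ ≤ s → ‖y‖ ≤ t → ‖z‖ ≤ u →
      ‖x * y * z‖ ≤ s * t * u := fun x y z s t u hx hy hz =>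
    (norm_mul_le _ _).trans (mul_le_mul ((norm_mul_le _ _).trans
      (mul_le_mul hx hy (norm_nonneg _) ((norm_nonneg _).trans hx))) hz (norm_nonneg _)
      (mul_nonneg ((norm_nonneg _).trans hx) ((norm_nonneg _).trans hy)))
  have hsq : ∀ l ∈ Ioo 0 l₀, ∀ s : ℝ, l ^ (p + s) ≤ l ^ (2 * p + s) := fun l hl s =>
    Real.rpow_le_rpow_of_exponent_ge hl.1 (hl.2.le.trans hl₀1) (by linarith)
  refine of_hasDerivAt (f' := fun l => -(G l * deriv f l * G l))
    (fun l hl => ?_) (fun l hl => ?_) (fun l hl => ?_) (fun l hl b hb h1 h2 => ?_)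
  · obtain ⟨u, hu'⟩ := hu l hl
    have h1 := (hasFDerivAt_ringInverse (𝕜 := ℝ) u)
    rw [hu'] at h1
    have h2 := h1.comp_hasDerivAt l (hf.hasDerivAt hl)
    have : (↑u⁻¹ : R) = G l := by rw [hG]; simp only; rw [← hu', Ring.inverse_unit]
    simpa [Function.comp_def, this] using h2
  · have h3 : (1 : ℝ) ≤ l ^ (2 * p) :=
      Real.one_le_rpow_of_pos_of_le_one_of_nonpos hl.1 (hl.2.le.trans hl₀1) (by linarith)
    calc ‖G l‖ ≤ c := hc l hl
      _ ≤ (c + c ^ 2 * a + 2 * c ^ 3 * a ^ 2) * 1 := by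
        have : 0 ≤ c ^ 2 * a + 2 * c ^ 3 * a ^ 2 := by positivity
        linarith
      _ ≤ _ := by gcongr
  · have h3 : l ^ (p - 1) ≤ l ^ (2 * p - 1) := hsq l hl (-1)
    rw [norm_neg]
    calc ‖G l * deriv f l * G l‖ ≤ c * (a * l ^ (p - 1)) * c :=
          key3 _ _ _ _ _ _ (hc l hl) (hf.deriv_bound l hl) (hc l hl)
      _ ≤ c * (a * l ^ (2 * p - 1)) * c := mul_le_mul_of_nonneg_right
        (mul_le_mul_of_nonneg_left (mul_le_mul_of_nonneg_left h3 ha) hc0) hc0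
      _ = (c ^ 2 * a) * l ^ (2 * p - 1) := by ring
      _ ≤ _ := by
        have := Real.rpow_nonneg hl.1.le (2 * p - 1)
        gcongr
        have : 0 ≤ 2 * c ^ 3 * a ^ 2 := by positivity
        linarith
  · have hcl : 0 < b - l := by linarith
    have hs := Real.rpow_nonneg hcl.le α
    have hG1 : ∀ t ∈ Ioo 0 l₀, f t * G t = 1 := fun t ht => Ring.mul_inverse_cancel _ (hu t ht)
    have hG2 : ∀ t ∈ Ioo 0 l₀, G t * f t = 1 := fun t ht => Ring.inverse_mul_cancel _ (hu t ht)
    have hdG : G b - G l = -(G b * (f b - f l) * G l) := by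
      rw [mul_sub, sub_mul, hG2 b hb, mul_assoc (G b), hG1 l hl]; simp
    have hp1 := Real.rpow_nonneg hl.1.le (p - 1)
    have b0 := hf.norm_sub_le_holder hα1 (by linarith) ha hl hb h1 h2
    have b1 : ‖G b - G l‖ ≤ c * (a * l ^ (p - α) * (b - l) ^ α) * c := by
      rw [hdG, norm_neg]
      exact key3 _ _ _ _ _ _ (hc b hb) b0 (hc l hl)
    have b2 : ‖deriv f b‖ ≤ a * l ^ (p - 1) := (hf.deriv_bound b hb).trans (by
      gcongr 1; exact Real.rpow_le_rpow_of_nonpos hl.1 h1.le (by linarith))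
    have b3 := hf.deriv_bound l hl
    have b4 := hf.holder l hl b hb h1 h2
    have e : -(G b * deriv f b * G b) - -(G l * deriv f l * G l) =
        -(((G b - G l) * deriv f b * G b + G l * (deriv f b - deriv f l) * G b) +
          G l * deriv f l * (G b - G l)) := by noncomm_ring
    have e1 : l ^ (p - α) * l ^ (p - 1) = l ^ (2 * p - 1 - α) := by
      rw [← Real.rpow_add hl.1]; congr 1; ring
    have h3 : l ^ (p - 1 - α) ≤ l ^ (2 * p - 1 - α) := by
      have := hsq l hl (-1 - α)
      rwa [show p + (-1 - α) = p - 1 - α by ring, show 2 * p + (-1 - α) = 2 * p - 1 - α by ring]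
        at this
    have hr := Real.rpow_nonneg hl.1.le (2 * p - 1 - α)
    rw [e, norm_neg]
    calc _ ≤ c * (a * l ^ (p - α) * (b - l) ^ α) * c * (a * l ^ (p - 1)) * c
          + c * (a * l ^ (p - 1 - α) * (b - l) ^ α) * c
          + c * (a * l ^ (p - 1)) * (c * (a * l ^ (p - α) * (b - l) ^ α) * c) :=
          (norm_add_le _ _).trans (add_le_add ((norm_add_le _ _).trans (add_le_add
            (key3 _ _ _ _ _ _ b1 b2 (hc b hb)) (key3 _ _ _ _ _ _ (hc l hl) b4 (hc b hb))))
            (key3 _ _ _ _ _ _ (hc l hl) b3 b1))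
      _ = 2 * c ^ 3 * a ^ 2 * l ^ (2 * p - 1 - α) * (b - l) ^ α
          + c ^ 2 * a * l ^ (p - 1 - α) * (b - l) ^ α := by
          linear_combination (2 * c ^ 3 * a ^ 2 * (b - l) ^ α) * e1
      _ ≤ 2 * c ^ 3 * a ^ 2 * l ^ (2 * p - 1 - α) * (b - l) ^ α
          + c ^ 2 * a * l ^ (2 * p - 1 - α) * (b - l) ^ α := by gcongr
      _ ≤ _ := by
        have : 0 ≤ c * l ^ (2 * p - 1 - α) * (b - l) ^ α := by positivity
        linarith

end ring

end HolderSymbol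

/-! ### Square integrable functions depending on the spectral parameter -/

section lpOf

variable {Y : Type*} [MeasurableSpace Y] {μ : Measure Y}

open Classical in
/-- The class of `f` in `L²`, and `0` if `f` is not square integrable. -/
def lpOf (μ : Measure Y) (f : Y → ℂ) : Lp ℂ 2 μ := if h : MemLp f 2 μ then h.toLp f else 0

theorem lpOf_eq {f : Y → ℂ} (h : MemLp f 2 μ) : lpOf μ f = h.toLp f := dif_pos h

theorem coeFn_lpOf {f : Y → ℂ} (h : MemLp f 2 μ) : lpOf μ f =ᵐ[μ] f := by
  rw [lpOf_eq h]; exact h.coeFn_toLp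

theorem lpOf_sub {f g : Y → ℂ} (hf : MemLp f 2 μ) (hg : MemLp g 2 μ) :
    lpOf μ (fun y => f y - g y) = lpOf μ f - lpOf μ g := by
  rw [lpOf_eq hf, lpOf_eq hg, ← MemLp.toLp_sub]; exact lpOf_eq (hf.sub hg)

theorem lpOf_const_mul {f : Y → ℂ} (hf : MemLp f 2 μ) (c : ℂ) :
    lpOf μ (fun y => c * f y) = c • lpOf μ f := by
  rw [lpOf_eq hf, ← MemLp.toLp_const_smul]; exact lpOf_eq (hf.const_smul c)

theorem lpOf_congr {f g : Y → ℂ} (h : f =ᵐ[μ] g) : lpOf μ f = lpOf μ g := by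
  by_cases hf : MemLp f 2 μ
  · rw [lpOf_eq hf, lpOf_eq (hf.ae_eq h)]; exact MemLp.toLp_congr _ _ h
  · rw [lpOf, lpOf, dif_neg hf, dif_neg fun hg => hf (hg.ae_eq h.symm)]

/-- No measurability of `f` is needed: outside L² the default value 0 satisfies the bound. -/
theorem norm_lpOf_le {f : Y → ℂ} {W : Y → ℝ} {c : ℝ} (hW : MemLp W 2 μ) (hc : 0 ≤ c)
    (h : ∀ᵐ y ∂μ, ‖f y‖ ≤ c * W y) : ‖lpOf μ f‖ ≤ c * (eLpNorm W 2 μ).toReal := by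
  by_cases hf : MemLp f 2 μ
  · rw [lpOf_eq hf, Lp.norm_toLp]
    have h1 : eLpNorm f 2 μ ≤ ENNReal.ofReal c * eLpNorm W 2 μ := by
      refine eLpNorm_le_mul_eLpNorm_of_ae_le_mul ?_ 2
      filter_upwards [h] with y hy using hy.trans (by gcongr; exact le_abs_self _)
    have := ENNReal.toReal_mono (ENNReal.mul_ne_top ENNReal.ofReal_ne_top hW.eLpNorm_ne_top) h1
    rwa [ENNReal.toReal_mul, ENNReal.toReal_ofReal hc] at this
  · rw [lpOf, dif_neg hf, norm_zero]; positivity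

end lpOf

/-! ### From pointwise symbol bounds to symbol bounds in L² -/

namespace HolderSymbol

/-- Mean value inequality for s ↦ f s - s f'(l), whose derivative is small by Hölder continuity.
With l/2 ≤ t ≤ 2l the dyadic condition holds on either side of l, and evaluating the power at l/2
covers both. -/
theorem norm_remainder_le {E : Type*} [NormedAddCommGroup E] [NormedSpace ℝ E]
    {α p l₀ a : ℝ} {f : ℝ → E} (h : HolderSymbol α p l₀ f a) (hα0 : 0 ≤ α) (hp : p ≤ 1)
    (ha : 0 ≤ a) {l t : ℝ} (hl : l ∈ Ioo 0 l₀) (ht : t ∈ Ioo 0 l₀) (h1 : l / 2 ≤ t)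
    (h2 : t ≤ 2 * l) : ‖f t - f l - (t - l) • deriv f l‖ ≤
      (l / 2) ^ (p - 1 - α) * (|t - l| ^ α * |t - l|) * a := by
  have hl2 : 0 < l / 2 := by linarith [hl.1]
  have hsub : uIcc l t ⊆ Ioo 0 l₀ := fun s hs => by
    rcases le_total l t with hlt | hlt
    · rw [uIcc_of_le hlt] at hs; exact ⟨hl.1.trans_le hs.1, hs.2.trans_lt ht.2⟩
    · rw [uIcc_of_ge hlt] at hs; exact ⟨ht.1.trans_le hs.1, hs.2.trans_lt hl.2⟩
  have hbd : ∀ s ∈ uIcc l t, ‖deriv f s - deriv f l‖ ≤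
      a * (l / 2) ^ (p - 1 - α) * |t - l| ^ α := by
    intro s hs
    have hst : |s - l| ≤ |t - l| := abs_sub_left_of_mem_uIcc hs
    have hm : ∀ u, l / 2 ≤ u → u ^ (p - 1 - α) ≤ (l / 2) ^ (p - 1 - α) := fun u hu =>
      Real.rpow_le_rpow_of_nonpos hl2 hu (by linarith)
    have hr := Real.rpow_nonneg hl2.le (p - 1 - α)
    rcases lt_trichotomy s l with hsl | hsl | hsl
    · have hs2 : l / 2 ≤ s := by
        rcases le_total l t with hlt | hlt
        · rw [uIcc_of_le hlt] at hs; linarith [hs.1]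
        · rw [uIcc_of_ge hlt] at hs; linarith [hs.1]
      rw [norm_sub_rev]
      refine (h.holder s (hsub hs) l hl hsl (by linarith)).trans ?_
      rw [abs_sub_comm, abs_of_pos (sub_pos.2 hsl)] at hst
      exact mul_le_mul (mul_le_mul_of_nonneg_left (hm s hs2) ha)
        (Real.rpow_le_rpow (sub_pos.2 hsl).le hst hα0) (Real.rpow_nonneg (sub_pos.2 hsl).le α)
        (by positivity)
    · subst hsl; simp; positivity
    · have hs2 : s ≤ 2 * l := by
        rcases le_total l t with hlt | hlt
        · rw [uIcc_of_le hlt] at hs; linarith [hs.2]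
        · rw [uIcc_of_ge hlt] at hs; linarith [hs.2]
      refine (h.holder l hl s (hsub hs) hsl hs2).trans ?_
      rw [abs_of_pos (sub_pos.2 hsl)] at hst
      exact mul_le_mul (mul_le_mul_of_nonneg_left (hm l (by linarith)) ha)
        (Real.rpow_le_rpow (sub_pos.2 hsl).le hst hα0) (Real.rpow_nonneg (sub_pos.2 hsl).le α)
        (by positivity)
  have := Convex.norm_image_sub_le_of_norm_hasDerivWithin_le
    (f := fun s => f s - s • deriv f l) (f' := fun s => deriv f s - deriv f l)
    (s := uIcc l t) (fun s hs => by
      have := ((h.hasDerivAt (hsub hs)).sub ((hasDerivAt_id s).smul_const (deriv f l)))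
      rw [one_smul] at this
      exact this.hasDerivWithinAt) hbd (convex_uIcc l t) left_mem_uIcc right_mem_uIcc
  rw [Real.norm_eq_abs] at this
  calc _ = ‖f t - t • deriv f l - (f l - l • deriv f l)‖ := by congr 1; rw [sub_smul]; abel
    _ ≤ _ := this
    _ = _ := by ring

variable {Y : Type*} [MeasurableSpace Y] {μ : Measure Y} {α p l₀ : ℝ} {F : ℝ → Y → ℂ} {W : Y → ℝ}

/-- The derivative is the almost everywhere limit of difference quotients along one sequence tending
to l inside the interval. -/
theorem aestronglyMeasurable_deriv (hm : ∀ l ∈ Ioo 0 l₀, AEStronglyMeasurable (F l) μ)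
    (hF : ∀ᵐ y ∂μ, HolderSymbol α p l₀ (fun l => F l y) (W y)) {l : ℝ} (hl : l ∈ Ioo 0 l₀) :
    AEStronglyMeasurable (fun y => deriv (fun l => F l y) l) μ := by
  set t : ℕ → ℝ := fun n => l + (l₀ - l) / 2 * (1 / ((n : ℝ) + 1)) with ht
  have hl2 : 0 < (l₀ - l) / 2 := by linarith [hl.2]
  have hn : ∀ n : ℕ, 0 < 1 / ((n : ℝ) + 1) ∧ 1 / ((n : ℝ) + 1) ≤ 1 := fun n =>
    ⟨by positivity, by rw [div_le_one (by positivity)]; linarith [(Nat.cast_nonneg n : (0:ℝ) ≤ n)]⟩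
  have htm : ∀ n, l < t n ∧ t n ∈ Ioo 0 l₀ := fun n => by
    have h1 := mul_pos hl2 (hn n).1
    have h2 := mul_le_mul_of_nonneg_left (hn n).2 hl2.le
    exact ⟨by simp only [ht]; linarith, by simp only [ht]; linarith [hl.1],
      by simp only [ht]; linarith [hl.2]⟩
  have htl : Filter.Tendsto t Filter.atTop (nhdsWithin l {l}ᶜ) := by
    refine tendsto_nhdsWithin_iff.2 ⟨?_, Filter.Eventually.of_forall fun n => (htm n).1.ne'⟩
    have := (tendsto_one_div_add_atTop_nhds_zero_nat (𝕜 := ℝ)).const_mul ((l₀ - l) / 2)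
    simpa only [mul_zero, add_zero] using this.const_add l
  refine aestronglyMeasurable_of_tendsto_ae Filter.atTop
    (f := fun n y => slope (fun s => F s y) l (t n)) (fun n => ?_) ?_
  · simp only [slope_def_module]
    exact ((hm _ (htm n).2).sub (hm l hl)).const_smul _
  · filter_upwards [hF] with y hy
    exact (hasDerivAt_iff_tendsto_slope.1 (hy.hasDerivAt hl)).comp htl

theorem memLp_of_le (hW : MemLp W 2 μ) {f : Y → ℂ} (hf : AEStronglyMeasurable f μ) {c : ℝ}
    (h : ∀ᵐ y ∂μ, ‖f y‖ ≤ W y * c) : MemLp f 2 μ :=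
  (hW.mul_const c).mono' hf h

/-- Pointwise symbol bounds, with square integrable constants, give symbol bounds in `L²`. -/
theorem toLp (hα0 : 0 < α) (hp : p ≤ 1) (hW : MemLp W 2 μ)
    (hm : ∀ l ∈ Ioo 0 l₀, AEStronglyMeasurable (F l) μ)
    (hF : ∀ᵐ y ∂μ, HolderSymbol α p l₀ (fun l => F l y) (W y)) :
    HolderSymbol α p l₀ (fun l => lpOf μ (F l)) (eLpNorm W 2 μ).toReal := by
  have hmem : ∀ l ∈ Ioo 0 l₀, MemLp (F l) 2 μ := fun l hl =>
    memLp_of_le hW (hm l hl) (by filter_upwards [hF] with y hy using hy.bound l hl)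
  have hmem' : ∀ l ∈ Ioo 0 l₀, MemLp (fun y => deriv (fun l => F l y) l) 2 μ := fun l hl =>
    memLp_of_le hW (aestronglyMeasurable_deriv hm hF hl)
      (by filter_upwards [hF] with y hy using hy.deriv_bound l hl)
  refine of_hasDerivAt (f' := fun l => lpOf μ (fun y => deriv (fun l => F l y) l))
    (fun l hl => ?_) (fun l hl => ?_) (fun l hl => ?_) (fun l hl b hb h1 h2 => ?_)
  · rw [hasDerivAt_iff_isLittleO]
    -- The pointwise Taylor remainder is at most a constant times |t - l|^(1+α) W(y), with the
    -- constant independent of y, so it can be integrated: this is differentiability in L².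
    have h1 : (fun t => lpOf μ (F t) - lpOf μ (F l) -
        (t - l) • lpOf μ (fun y => deriv (fun l => F l y) l)) =O[nhds l]
        fun t => |t - l| ^ α * (t - l) := by
      refine Asymptotics.IsBigO.of_bound ((l / 2) ^ (p - 1 - α) * (eLpNorm W 2 μ).toReal) ?_
      filter_upwards [isOpen_Ioo.mem_nhds hl, Ioo_mem_nhds
        (by linarith [hl.1] : l / 2 < l) (by linarith [hl.1] : l < 2 * l)] with t ht ht2
      have e : lpOf μ (F t) - lpOf μ (F l) - (t - l) • lpOf μ (fun y => deriv (fun l => F l y) l)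
          = lpOf μ (fun y => F t y - F l y - ((t - l : ℝ) : ℂ) * deriv (fun l => F l y) l) := by
        rw [lpOf_sub (f := fun y => F t y - F l y) ((hmem t ht).sub (hmem l hl)) ((hmem' l hl).const_mul _),
          lpOf_sub (hmem t ht) (hmem l hl), lpOf_const_mul (hmem' l hl), Complex.coe_smul]
        rfl
      have hr := Real.rpow_nonneg (by linarith [hl.1] : 0 ≤ l / 2) (p - 1 - α)
      rw [e]
      refine (norm_lpOf_le hW (c := (l / 2) ^ (p - 1 - α) * (|t - l| ^ α * |t - l|))
        (by positivity) ?_).trans (le_of_eq ?_)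
      · filter_upwards [hF] with y hy
        have := hy.norm_remainder_le hα0.le hp (hy.const_nonneg (hl.1.trans hl.2)) hl ht
          ht2.1.le ht2.2.le
        rwa [Complex.real_smul] at this
      · rw [norm_mul, Real.norm_of_nonneg (by positivity : 0 ≤ |t - l| ^ α), Real.norm_eq_abs]
        ring
    refine h1.trans_isLittleO ?_
    have h2 : (fun t => |t - l| ^ α) =o[nhds l] (fun _ => (1 : ℝ)) := by
      rw [Asymptotics.isLittleO_one_iff]
      have : ContinuousAt (fun t => |t - l| ^ α) l :=
        ((continuous_abs.comp (continuous_id.sub continuous_const)).continuousAt).rpow_const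
          (Or.inr hα0.le)
      have h3 := this.tendsto
      simpa [Real.zero_rpow hα0.ne'] using h3
    simpa using h2.mul_isBigO (Asymptotics.isBigO_refl (fun t => t - l) (nhds l))
  · rw [mul_comm]
    refine norm_lpOf_le hW (Real.rpow_nonneg hl.1.le _) ?_
    filter_upwards [hF] with y hy
    rw [mul_comm]; exact hy.bound l hl
  · rw [mul_comm]
    refine norm_lpOf_le hW (Real.rpow_nonneg hl.1.le _) ?_
    filter_upwards [hF] with y hy
    rw [mul_comm]; exact hy.deriv_bound l hl
  · rw [← lpOf_sub (hmem' b hb) (hmem' l hl), mul_assoc, mul_comm]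
    refine norm_lpOf_le hW (mul_nonneg (Real.rpow_nonneg hl.1.le _)
      (Real.rpow_nonneg (sub_pos.2 h1).le _)) ?_
    filter_upwards [hF] with y hy
    rw [mul_comm, ← mul_assoc]; exact hy.holder l hl b hb h1 h2

end HolderSymbol

/-! ### Hilbert–Schmidt operators -/

local notation "⟪" x ", " y "⟫" => inner ℂ x y

/-- The bilinear pairing `∫ f g` on `L²`. -/
def pair (f g : L2) : ℂ := ⟪star f, g⟫

theorem L2_integrable_mul (f g : L2) : Integrable (fun y => f y * g y) :=
  (Lp.memLp f).integrable_mul (Lp.memLp g)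

theorem norm_star_L2 (f : L2) : ‖star f‖ = ‖f‖ := by
  rw [Lp.norm_def, Lp.norm_def]
  congr 1
  refine eLpNorm_congr_norm_ae ?_
  filter_upwards [Lp.coeFn_star f] with x hx
  rw [hx]; simp

theorem pair_eq (f g : L2) : pair f g = ∫ y, f y * g y := by
  rw [pair, L2.inner_def]
  refine integral_congr_ae ?_
  filter_upwards [Lp.coeFn_star f] with x hx
  simp [hx, mul_comm]

theorem norm_pair_le (f g : L2) : ‖pair f g‖ ≤ ‖f‖ * ‖g‖ :=
  (norm_inner_le_norm _ _).trans (by rw [norm_star_L2])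

/-- Square integrable kernels. -/
abbrev HSKernel (k : Plane → Plane → ℂ) : Prop :=
  MemLp (fun p : Plane × Plane => k p.1 p.2) 2 volume

/-- The section `k(x,·)` of a kernel, as an element of `L²`. -/
def sec (k : Plane → Plane → ℂ) (x : Plane) : L2 := lpOf volume (k x)

namespace HSKernel

variable {k : Plane → Plane → ℂ}

theorem integrable_sq (hk : HSKernel k) :
    Integrable (fun p : Plane × Plane => ‖k p.1 p.2‖ ^ 2) (volume.prod volume) :=
  (memLp_two_iff_integrable_sq_norm hk.1).1 hk

theorem aestronglyMeasurable (hk : HSKernel k) :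
    AEStronglyMeasurable (fun p : Plane × Plane => k p.1 p.2) (volume.prod volume) := hk.1

theorem sec_memLp (hk : HSKernel k) : ∀ᵐ x : Plane, MemLp (k x) 2 volume := by
  filter_upwards [hk.integrable_sq.prod_right_ae, hk.aestronglyMeasurable.prodMk_left] with x h1 h2
  exact (memLp_two_iff_integrable_sq_norm h2).2 h1

theorem swap (hk : HSKernel k) : HSKernel fun x y => k y x :=
  MemLp.comp_measurePreserving hk (Measure.measurePreserving_swap (μ := volume) (ν := volume))

theorem norm_sec_sq (x : Plane) (hx : MemLp (k x) 2 volume) :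
    ‖sec k x‖ ^ 2 = ∫ y, ‖k x y‖ ^ 2 := by
  have h := L2.integral_inner_eq_sq_eLpNorm (𝕜 := ℂ) (sec k x)
  rw [← inner_self_eq_norm_sq (𝕜 := ℂ), L2.inner_def, ← integral_re (L2.integrable_inner _ _)]
  refine integral_congr_ae ?_
  filter_upwards [coeFn_lpOf hx] with y hy
  rw [sec, hy, inner_self_eq_norm_sq]

theorem integrable_norm_sec_sq (hk : HSKernel k) : Integrable (fun x => ‖sec k x‖ ^ 2) :=
  hk.integrable_sq.integral_prod_left.congr (by
    filter_upwards [hk.sec_memLp] with x hx using (norm_sec_sq x hx).symm)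

theorem integral_norm_sec_sq (hk : HSKernel k) :
    ∫ x, ‖sec k x‖ ^ 2 = ∫ p : Plane × Plane, ‖k p.1 p.2‖ ^ 2 := by
  rw [Measure.volume_eq_prod, integral_prod _ hk.integrable_sq]
  exact integral_congr_ae (by
    filter_upwards [hk.sec_memLp] with x hx using norm_sec_sq x hx)

/-- Fubini gives measurability of the squared norm only, so a square root is taken; the
measurability of the L²-valued section itself comes later. -/
theorem memLp_norm_sec (hk : HSKernel k) : MemLp (fun x => ‖sec k x‖) 2 volume := by
  have h := hk.integrable_norm_sec_sq
  have hm : AEStronglyMeasurable (fun x => ‖sec k x‖) volume := by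
    have := (Real.continuous_sqrt.comp_aestronglyMeasurable h.1)
    simpa [Function.comp_def, Real.sqrt_sq] using this
  exact (memLp_two_iff_integrable_sq hm).2 h

theorem integrable_mul (x : Plane) (hx : MemLp (k x) 2 volume) (f : L2) :
    Integrable (fun y => k x y * f y) :=
  hx.integrable_mul (Lp.memLp f)

theorem integral_mul_eq_pair (x : Plane) (hx : MemLp (k x) 2 volume) (f : L2) :
    ∫ y, k x y * f y = pair (sec k x) f := by
  rw [pair_eq]
  refine integral_congr_ae ?_
  filter_upwards [coeFn_lpOf hx] with y hy
  rw [sec, hy]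

theorem aestronglyMeasurable_integral (hk : HSKernel k) (f : L2) :
    AEStronglyMeasurable (fun x => ∫ y, k x y * f y) volume := by
  have h2 : AEStronglyMeasurable (fun p : Plane × Plane => f p.2) (volume.prod volume) :=
    (Lp.aestronglyMeasurable f).comp_snd
  exact (hk.aestronglyMeasurable.mul h2).integral_prod_right'

theorem norm_integral_le (hk : HSKernel k) (f : L2) :
    ∀ᵐ x, ‖∫ y, k x y * f y‖ ≤ ‖f‖ * ‖sec k x‖ := by
  filter_upwards [hk.sec_memLp] with x hx
  rw [integral_mul_eq_pair x hx, mul_comm]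
  exact norm_pair_le _ _

theorem memLp_integral (hk : HSKernel k) (f : L2) : MemLp (fun x => ∫ y, k x y * f y) 2 volume :=
  (hk.memLp_norm_sec.const_mul ‖f‖).mono' (hk.aestronglyMeasurable_integral f)
    (hk.norm_integral_le f)

end HSKernel

/-- The square integrable functions on `ℝ² × ℝ²`. -/
abbrev K2 : Type := Lp ℂ 2 (volume : Measure (Plane × Plane))

theorem K2.hsKernel (k : K2) : HSKernel fun x y => k (x, y) := Lp.memLp k

/-- Tonelli. This identity is what bounds the operator norm by the Hilbert–Schmidt norm in `opHS`.
-/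
theorem eLpNorm_norm_sec (k : K2) :
    (eLpNorm (fun x => ‖sec (fun x y => k (x, y)) x‖) 2 volume).toReal = ‖k‖ := by
  have hk := k.hsKernel
  have h1 := hk.memLp_norm_sec.eLpNorm_eq_integral_rpow_norm (by norm_num) (by norm_num)
  have h2 := hk.eLpNorm_eq_integral_rpow_norm (by norm_num) (by norm_num)
  rw [Lp.norm_def]
  change _ = (eLpNorm (fun p : Plane × Plane => k (p.1, p.2)) 2 volume).toReal
  rw [h1, h2]
  have := hk.integral_norm_sec_sq
  simp only [ENNReal.toReal_ofNat, Real.rpow_ofNat, norm_norm]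
  rw [this]

/-- The Hilbert–Schmidt operator with the kernel `k`, as a continuous linear function of `k`. -/
def opHS : K2 →L[ℂ] L2 →L[ℂ] L2 :=
  LinearMap.mkContinuous₂
    (LinearMap.mk₂ ℂ (fun (k : K2) (f : L2) => lpOf volume fun x => ∫ y, k (x, y) * f y)
      (fun k₁ k₂ f => by
        rw [lpOf_eq (k₁.hsKernel.memLp_integral f), lpOf_eq (k₂.hsKernel.memLp_integral f),
          ← MemLp.toLp_add, ← lpOf_eq]
        refine lpOf_congr ?_
        filter_upwards [Measure.ae_ae_of_ae_prod (Lp.coeFn_add k₁ k₂), k₁.hsKernel.sec_memLp,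
          k₂.hsKernel.sec_memLp] with x hx h1 h2
        rw [Pi.add_apply, ← integral_add (HSKernel.integrable_mul (k := fun x y => k₁ (x, y)) x h1 f)
          (HSKernel.integrable_mul (k := fun x y => k₂ (x, y)) x h2 f)]
        refine integral_congr_ae ?_
        filter_upwards [hx] with y hy
        rw [hy, Pi.add_apply, add_mul])
      (fun c k f => by
        rw [← lpOf_const_mul (k.hsKernel.memLp_integral f)]
        refine lpOf_congr ?_
        filter_upwards [Measure.ae_ae_of_ae_prod (Lp.coeFn_smul c k)] with x hx
        rw [← integral_const_mul]
        refine integral_congr_ae ?_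
        filter_upwards [hx] with y hy
        rw [hy, Pi.smul_apply, smul_eq_mul, mul_assoc])
      (fun k f₁ f₂ => by
        rw [lpOf_eq (k.hsKernel.memLp_integral f₁), lpOf_eq (k.hsKernel.memLp_integral f₂),
          ← MemLp.toLp_add, ← lpOf_eq]
        refine lpOf_congr ?_
        filter_upwards [k.hsKernel.sec_memLp] with x h1
        rw [Pi.add_apply, ← integral_add (HSKernel.integrable_mul (k := fun x y => k (x, y)) x h1 _)
          (HSKernel.integrable_mul (k := fun x y => k (x, y)) x h1 _)]
        refine integral_congr_ae ?_
        filter_upwards [Lp.coeFn_add f₁ f₂] with y hy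
        rw [hy, Pi.add_apply, mul_add])
      (fun c k f => by
        rw [← lpOf_const_mul (k.hsKernel.memLp_integral f)]
        refine lpOf_congr ?_
        filter_upwards with x
        rw [← integral_const_mul]
        refine integral_congr_ae ?_
        filter_upwards [Lp.coeFn_smul c f] with y hy
        rw [hy, Pi.smul_apply, smul_eq_mul, mul_left_comm]))
    1 (fun k f => by
      rw [LinearMap.mk₂_apply, one_mul, mul_comm]
      refine (norm_lpOf_le k.hsKernel.memLp_norm_sec (norm_nonneg f)
        (k.hsKernel.norm_integral_le f)).trans (le_of_eq ?_)
      rw [eLpNorm_norm_sec])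

theorem norm_opHS_le : ‖opHS‖ ≤ 1 := LinearMap.mkContinuous₂_norm_le _ zero_le_one _

theorem opHS_apply (k : K2) (f : L2) :
    opHS k f = lpOf volume fun x => ∫ y, k (x, y) * f y := rfl

/-- The operator with the square integrable kernel `k`. -/
def opK (k : Plane → Plane → ℂ) : L2 →L[ℂ] L2 := opHS (lpOf volume fun p => k p.1 p.2)

theorem HSKernel.hasKernel {k : Plane → Plane → ℂ} (hk : HSKernel k) : HasKernel (opK k) k := by
  refine ⟨hk.1, fun f => ?_⟩
  filter_upwards [hk.sec_memLp, coeFn_lpOf (K2.hsKernel (lpOf volume fun p => k p.1 p.2)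
    |>.memLp_integral f), Measure.ae_ae_of_ae_prod (coeFn_lpOf hk)] with x h1 h2 h3
  refine ⟨HSKernel.integrable_mul x h1 f, ?_⟩
  rw [opK, opHS_apply, h2, zero_mul, zero_add]
  refine integral_congr_ae ?_
  filter_upwards [h3] with y hy using congrArg (· * f y) hy

theorem opK_apply {k : Plane → Plane → ℂ} (hk : HSKernel k) (f : L2) :
    ∀ᵐ x, opK k f x = pair (sec k x) f := by
  filter_upwards [hk.hasKernel.2 f, hk.sec_memLp] with x h1 h2
  rw [h1.2, zero_mul, zero_add, HSKernel.integral_mul_eq_pair x h2]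

theorem opK_add {k₁ k₂ : Plane → Plane → ℂ} (h₁ : HSKernel k₁) (h₂ : HSKernel k₂) :
    opK (fun x y => k₁ x y + k₂ x y) = opK k₁ + opK k₂ := by
  rw [opK, opK, opK, ← map_add, lpOf_eq h₁, lpOf_eq h₂, ← MemLp.toLp_add]
  congr 1
  exact lpOf_eq (h₁.add h₂)

theorem opK_congr {k₁ k₂ : Plane → Plane → ℂ}
    (h : ∀ᵐ p : Plane × Plane, k₁ p.1 p.2 = k₂ p.1 p.2) : opK k₁ = opK k₂ := by
  rw [opK, opK, lpOf_congr h]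

/-- A weakly measurable function with values in a separable Hilbert space is measurable. -/
theorem aestronglyMeasurable_of_inner {X E : Type*} [MeasurableSpace X] {μ : Measure X}
    [NormedAddCommGroup E] [InnerProductSpace ℂ E] [TopologicalSpace.SeparableSpace E] {s : X → E}
    (h : ∀ g : E, AEStronglyMeasurable (fun x => ⟪g, s x⟫) μ) : AEStronglyMeasurable s μ := by
  -- Spans of the first n members of a dense sequence. The projections onto them converge strongly
  -- to the identity, and each projection of s(x) is a finite sum of scalar products, which are
  -- measurable by hypothesis.
  set W : ℕ → Submodule ℂ E := fun n =>
    Submodule.span ℂ (TopologicalSpace.denseSeq E '' Iio n) with hW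
  have hfin : ∀ n, FiniteDimensional ℂ (W n) := fun n =>
    FiniteDimensional.span_of_finite ℂ ((finite_Iio n).image _)
  have hmono : Monotone W := fun m n hmn => Submodule.span_mono
    (image_mono (Iio_subset_Iio hmn))
  have htop : (⊤ : Submodule ℂ E) ≤ (⨆ n, W n).topologicalClosure := by
    intro x _
    refine closure_mono ?_ (TopologicalSpace.denseRange_denseSeq E x)
    rintro _ ⟨n, rfl⟩
    exact Submodule.mem_iSup_of_mem (n + 1) (Submodule.subset_span ⟨n, Nat.lt_succ_self n, rfl⟩)
  refine aestronglyMeasurable_of_tendsto_ae Filter.atTop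
    (f := fun n x => (W n).starProjection (s x)) (fun n => ?_)
    (Filter.Eventually.of_forall fun x => Submodule.starProjection_tendsto_self W hmono (s x) htop)
  have hb := (stdOrthonormalBasis ℂ (W n)).starProjection_eq_sum_rankOne
  simp only [hb, sum_apply, InnerProductSpace.rankOne_apply]
  exact Finset.aestronglyMeasurable_fun_sum _ fun i _ => (h _).smul_const _

instance : TopologicalSpace.SeparableSpace L2 := by
  have : Fact ((2 : ℝ≥0∞) ≠ ∞) := ⟨by norm_num⟩
  infer_instance

theorem star_pair (f g : L2) : star (pair f g) = ⟪g, star f⟫ := by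
  rw [pair]; exact inner_conj_symm _ _

theorem pair_comm (f g : L2) : pair f g = pair g f := by
  rw [pair_eq, pair_eq]; simp only [mul_comm]

theorem inner_eq_pair (f g : L2) : ⟪f, g⟫ = pair (star f) g := by rw [pair, star_star]

theorem star_sec {k : Plane → Plane → ℂ} (x : Plane) (hx : MemLp (k x) 2 volume) :
    star (sec k x) = sec (fun x y => star (k x y)) x := by
  have hx' : MemLp (fun y => star (k x y)) 2 volume := hx.star
  refine Lp.ext ?_
  filter_upwards [Lp.coeFn_star (sec k x), coeFn_lpOf hx, coeFn_lpOf hx'] with y h1 h2 h3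
  rw [h1, Pi.star_apply, sec, h2, sec, h3]

/-! ### Sections as L²-valued functions, and adjoints -/

namespace HSKernel

variable {k k₁ k₂ : Plane → Plane → ℂ}

protected theorem star (hk : HSKernel k) : HSKernel fun x y => star (k x y) := MemLp.star hk

/-- Scalar products with a fixed vector are parameter integrals, measurable by Fubini; separability
of L² turns this weak measurability into strong measurability. -/
theorem aestronglyMeasurable_sec (hk : HSKernel k) : AEStronglyMeasurable (sec k) volume := by
  refine aestronglyMeasurable_of_inner fun g => ?_
  refine (hk.aestronglyMeasurable_integral (star g)).congr ?_
  filter_upwards [hk.sec_memLp] with x hx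
  rw [integral_mul_eq_pair x hx, pair_comm, ← inner_eq_pair]

/-- The pairing of an operator with a square integrable kernel. -/
theorem inner_opK (hk : HSKernel k) (w f : L2) :
    ⟪w, opK k f⟫ = ∫ y, ⟪w, sec (fun y x => k x y) y⟫ * f y := by
  have hwf : MemLp (fun p : Plane × Plane => star (w p.1) * f p.2) 2 (volume.prod volume) := by
    have h1 : AEStronglyMeasurable (fun p : Plane × Plane => star (w p.1) * f p.2)
        (volume.prod volume) :=
      ((Lp.aestronglyMeasurable w).comp_fst.star).mul (Lp.aestronglyMeasurable f).comp_snd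
    refine (memLp_two_iff_integrable_sq_norm h1).2 ?_
    have := ((memLp_two_iff_integrable_sq_norm (Lp.aestronglyMeasurable w)).1 (Lp.memLp w)).mul_prod
      ((memLp_two_iff_integrable_sq_norm (Lp.aestronglyMeasurable f)).1 (Lp.memLp f))
    simpa [mul_pow] using this
  -- The tensor product of w and f is square integrable, so its product with k is integrable on the
  -- product space and Fubini applies.
  have hint : Integrable (fun p : Plane × Plane => k p.1 p.2 * (star (w p.1) * f p.2))
      (volume.prod volume) := MemLp.integrable_mul hk hwf
  calc ⟪w, opK k f⟫ = ∫ z, ∫ y, k z y * (star (w z) * f y) := by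
        rw [L2.inner_def]
        refine integral_congr_ae ?_
        filter_upwards [hk.hasKernel.2 f] with z hz
        rw [hz.2, zero_mul, zero_add, RCLike.inner_apply, ← integral_mul_const]
        congr 1; ext y
        simp only [RCLike.star_def]; ring
    _ = ∫ y, ∫ z, k z y * (star (w z) * f y) := integral_integral_swap hint
    _ = _ := by
        refine integral_congr_ae ?_
        filter_upwards [hk.swap.sec_memLp] with y hy
        rw [L2.inner_def, ← integral_mul_const]
        refine integral_congr_ae ?_
        filter_upwards [coeFn_lpOf hy] with z hz
        rw [sec, hz, RCLike.inner_apply]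
        simp only [RCLike.star_def]; ring

theorem adjoint_opK (hk : HSKernel k) :
    ContinuousLinearMap.adjoint (opK k) = opK fun x y => star (k y x) := by
  symm
  rw [ContinuousLinearMap.eq_adjoint_iff]
  intro w f
  rw [hk.inner_opK, L2.inner_def]
  refine integral_congr_ae ?_
  filter_upwards [opK_apply hk.swap.star w, hk.swap.sec_memLp] with y h1 h2
  rw [RCLike.inner_apply, h1, ← star_sec (k := fun y x => k x y) y h2, mul_comm, pair, star_star]
  congr 1
  exact inner_conj_symm _ _

end HSKernel

/-- The kernel of the product of two Hilbert–Schmidt operators with a bounded operator between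
them. -/
def compK (k₁ : Plane → Plane → ℂ) (B : L2 →L[ℂ] L2) (k₂ : Plane → Plane → ℂ) (x y : Plane) : ℂ :=
  ⟪sec (fun x y => star (k₁ x y)) x, B (sec (fun y x => k₂ x y) y)⟫

theorem memLp_mul_prod {f g : Plane → ℝ} (hf : MemLp f 2 volume) (hg : MemLp g 2 volume) :
    MemLp (fun p : Plane × Plane => f p.1 * g p.2) 2 volume := by
  have h1 : AEStronglyMeasurable (fun p : Plane × Plane => f p.1 * g p.2) (volume.prod volume) :=
    hf.1.comp_fst.mul hg.1.comp_snd
  refine (memLp_two_iff_integrable_sq_norm h1).2 ?_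
  have := ((memLp_two_iff_integrable_sq_norm hf.1).1 hf).mul_prod
    ((memLp_two_iff_integrable_sq_norm hg.1).1 hg)
  simpa [mul_pow] using this

namespace HSKernel

variable {k₁ k₂ : Plane → Plane → ℂ}

/-- By Cauchy–Schwarz the kernel is at most ‖B‖ times a product of section norms, one in x and one
in y, each square integrable. -/
theorem compK (h₁ : HSKernel k₁) (B : L2 →L[ℂ] L2) (h₂ : HSKernel k₂) :
    HSKernel (compK k₁ B k₂) := by
  refine MemLp.mono' ((memLp_mul_prod h₁.star.memLp_norm_sec
    h₂.swap.memLp_norm_sec).const_mul ‖B‖) ?_ (Filter.Eventually.of_forall fun p => ?_)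
  · exact AEStronglyMeasurable.inner h₁.star.aestronglyMeasurable_sec.comp_fst
      (B.continuous.comp_aestronglyMeasurable h₂.swap.aestronglyMeasurable_sec.comp_snd)
  · refine (norm_inner_le_norm _ _).trans ?_
    calc _ ≤ ‖sec (fun x y => star (k₁ x y)) p.1‖ *
          (‖B‖ * ‖sec (fun y x => k₂ x y) p.2‖) := by gcongr; exact B.le_opNorm _
      _ = _ := by ring

/-- The value at x is a scalar product of a section of k₁ with B K₂ f. Moving B to the other side by
its adjoint leaves a pairing with K₂ f, which `inner_opK` writes as an integral against f. -/
theorem hasKernel_compK (h₁ : HSKernel k₁) (B : L2 →L[ℂ] L2) (h₂ : HSKernel k₂) :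
    HasKernel (opK k₁ * B * opK k₂) (Schr2D.compK k₁ B k₂) := by
  have hc := h₁.compK B h₂
  refine ⟨hc.1, fun f => ?_⟩
  filter_upwards [hc.sec_memLp, opK_apply h₁ (B (opK k₂ f)), h₁.sec_memLp] with x hx h3 h4
  refine ⟨HSKernel.integrable_mul x hx f, ?_⟩
  have : (opK k₁ * B * opK k₂) f = opK k₁ (B (opK k₂ f)) := rfl
  rw [this, h3, zero_mul, zero_add, pair, star_sec x h4, ← ContinuousLinearMap.adjoint_inner_left,
    h₂.inner_opK]
  simp only [Schr2D.compK, ContinuousLinearMap.adjoint_inner_left]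

end HSKernel

/-! ### Multiplication operators -/

/-- Multiplication by a bounded function. -/
def mulOp {u : Plane → ℂ} (hu : MemLp u ∞ volume) : L2 →L[ℂ] L2 :=
  (ContinuousLinearMap.mul ℂ ℂ).holderL volume ∞ 2 2 (hu.toLp u)

theorem mulOp_apply {u : Plane → ℂ} (hu : MemLp u ∞ volume) (f : L2) :
    mulOp hu f =ᵐ[volume] fun x => u x * f x := by
  filter_upwards [ContinuousLinearMap.coeFn_holder (r := 2) (ContinuousLinearMap.mul ℂ ℂ)
    (hu.toLp u) f, hu.coeFn_toLp] with x h1 h2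
  rw [mulOp, ContinuousLinearMap.holderL_apply_apply, h1, h2, ContinuousLinearMap.mul_apply']

theorem HSKernel.isMulAddKernel {u : Plane → ℂ} (hu : MemLp u ∞ volume) {k : Plane → Plane → ℂ}
    (hk : HSKernel k) : IsMulAddKernel u k (mulOp hu + opK k) := by
  refine ⟨hk.1, fun f => ?_⟩
  filter_upwards [mulOp_apply hu f, hk.hasKernel.2 f, Lp.coeFn_add (mulOp hu f) (opK k f)]
    with x h1 h2 h3
  refine ⟨h2.1, ?_⟩
  rw [add_apply, h3, Pi.add_apply, h1, h2.2, zero_mul, zero_add]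

/-! ### Algebra of integral operators -/

namespace HasKernel

variable {A B : L2 →L[ℂ] L2} {k k₁ k₂ : Plane → Plane → ℂ}

theorem add (h₁ : HasKernel A k₁) (h₂ : HasKernel B k₂) :
    HasKernel (A + B) fun x y => k₁ x y + k₂ x y := by
  refine ⟨h₁.1.add h₂.1, fun f => ?_⟩
  filter_upwards [h₁.2 f, h₂.2 f, Lp.coeFn_add (A f) (B f)] with x h1 h2 h3
  simp only [add_mul]
  refine ⟨h1.1.add h2.1, ?_⟩
  rw [add_apply, h3, Pi.add_apply, h1.2, h2.2, integral_add h1.1 h2.1]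
  ring

theorem neg (h : HasKernel A k) : HasKernel (-A) fun x y => -k x y := by
  refine ⟨h.1.neg, fun f => ?_⟩
  filter_upwards [h.2 f, Lp.coeFn_neg (A f)] with x h1 h3
  simp only [neg_mul]
  refine ⟨h1.1.neg, ?_⟩
  rw [neg_apply, h3, Pi.neg_apply, h1.2, integral_neg]
  ring

theorem mulOp_mul_mulOp {u : Plane → ℂ} (hu : MemLp u ∞ volume) (h : HasKernel A k) :
    HasKernel (mulOp hu * A * mulOp hu) fun x y => u x * k x y * u y := by
  refine ⟨?_, fun f => ?_⟩
  · exact (hu.1.comp_fst.mul h.1).mul hu.1.comp_snd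
  · filter_upwards [h.2 (mulOp hu f), mulOp_apply hu (A (mulOp hu f))] with x h1 h2
    have e : (fun y => u x * k x y * u y * f y) =ᵐ[volume]
        fun y => u x * (k x y * mulOp hu f y) := by
      filter_upwards [mulOp_apply hu f] with y hy
      rw [hy]; ring
    refine ⟨(h1.1.const_mul (u x)).congr e.symm, ?_⟩
    have : (mulOp hu * A * mulOp hu) f = mulOp hu (A (mulOp hu f)) := rfl
    rw [this, h2, h1.2, integral_congr_ae e, integral_const_mul]
    ring

end HasKernel

section

/-! ### The Feshbach formula -/

section feshbach

variable {R : Type*} [Ring R] [Algebra ℂ R] {p t d : R} {τ κ z : ℂ}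

/-- The Feshbach formula for the inverse of `z p + t`, with a projection `p` of rank one. -/
theorem feshbach_mul (hpd : p * d = 0) (hp : p * p = p) (htd : (1 - p) * t * d = 1 - p)
    (hτ : p * t * p = τ • p) (hκ : p * t * d * t * p = κ • p) (hz : z + (τ - κ) ≠ 0) :
    (z • p + t) * ((z + (τ - κ))⁻¹ •
      (p - p * t * d - d * t * p + d * t * p * t * d) + d) = 1 := by
  have h1 : t * d = 1 - p + p * t * d := by
    have : t * d = (1 - p) * t * d + p * t * d := by noncomm_ring
    rw [this, htd]
  have h2 : p * (p - p * t * d - d * t * p + d * t * p * t * d) = p - p * t * d := by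
    simp only [mul_add, mul_sub, ← mul_assoc, hp, hpd, zero_mul, sub_zero, add_zero]
  -- The bracket equals (1 - d t) p (1 - t d). Since 1 - t d = p - p t d, the product (1 - t d) t p
  -- is (τ - κ) p: this scalar is the Schur complement on the line.
  have h3 : t * (p - p * t * d - d * t * p + d * t * p * t * d) = (τ - κ) • (p - p * t * d) := by
    have h4 : t * p - t * d * t * p = (τ - κ) • p := by
      rw [h1, sub_smul, ← hτ, ← hκ]; noncomm_ring
    have h5 : t * (p - p * t * d - d * t * p + d * t * p * t * d) =
        (t * p - t * d * t * p) * (1 - t * d) := by noncomm_ring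
    rw [h5, h4]
    simp only [smul_mul_assoc, mul_sub, mul_one, mul_assoc, smul_sub]
  rw [add_mul, mul_add, mul_add, mul_smul_comm, mul_smul_comm, smul_mul_assoc, smul_mul_assoc,
    h2, h3, hpd, smul_zero, add_zero, ← add_assoc, ← smul_add, ← add_smul, smul_smul,
    inv_mul_cancel₀ hz, one_smul, h1]
  abel

/-- In infinite dimensions a right inverse need not be a left inverse, so the mirror computation is
carried out as well. -/
theorem feshbach_mul' (hdp : d * p = 0) (hp : p * p = p) (hdt : d * t * (1 - p) = 1 - p)
    (hτ : p * t * p = τ • p) (hκ : p * t * d * t * p = κ • p) (hz : z + (τ - κ) ≠ 0) :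
    ((z + (τ - κ))⁻¹ • (p - p * t * d - d * t * p + d * t * p * t * d) + d) * (z • p + t) = 1 := by
  have h1 : d * t = 1 - p + d * t * p := by
    have : d * t = d * t * (1 - p) + d * t * p := by noncomm_ring
    rwa [hdt] at this
  have h2 : (p - p * t * d - d * t * p + d * t * p * t * d) * p = p - d * t * p := by
    simp only [add_mul, sub_mul, mul_assoc, hp, hdp, mul_zero, sub_zero, add_zero]
  have h3 : (p - p * t * d - d * t * p + d * t * p * t * d) * t = (τ - κ) • (p - d * t * p) := by
    have h4 : p * t - p * t * (d * t) = (τ - κ) • p := by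
      rw [h1, sub_smul, ← hτ, ← hκ]; noncomm_ring
    have h5 : (p - p * t * d - d * t * p + d * t * p * t * d) * t =
        (1 - d * t) * (p * t - p * t * (d * t)) := by noncomm_ring
    rw [h5, h4]
    simp only [mul_smul_comm, sub_mul, one_mul, smul_sub]
  rw [mul_add, add_mul, add_mul, mul_smul_comm, mul_smul_comm, smul_mul_assoc, smul_mul_assoc,
    h2, h3, hdp, smul_zero, add_zero, ← add_assoc, smul_comm z, ← smul_add, ← add_smul, smul_smul,
    inv_mul_cancel₀ hz, one_smul]
  have h6 : p - d * t * p + d * t = 1 + (d * t - (1 - p + d * t * p)) := by abel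
  rw [h6, sub_eq_zero.2 h1, add_zero]

end feshbach

/-! ### Complex conjugation -/

theorem star_add_L2 (f g : L2) : star (f + g) = star f + star g := by
  refine Lp.ext ?_
  filter_upwards [Lp.coeFn_star f, Lp.coeFn_star g, Lp.coeFn_star (f + g), Lp.coeFn_add f g,
    Lp.coeFn_add (star f) (star g)] with x h1 h2 h3 h4 h5
  rw [h3, Pi.star_apply, h4, h5, Pi.add_apply, Pi.add_apply, h1, h2, star_add]
  rfl

theorem star_smul_L2 (c : ℂ) (f : L2) : star (c • f) = star c • star f := by
  refine Lp.ext ?_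
  filter_upwards [Lp.coeFn_star f, Lp.coeFn_star (c • f), Lp.coeFn_smul c f,
    Lp.coeFn_smul (star c) (star f)] with x h1 h2 h3 h4
  rw [h2, Pi.star_apply, h3, h4, Pi.smul_apply, Pi.smul_apply, h1, star_smul]
  rfl

theorem star_sub_L2 (f g : L2) : star (f - g) = star f - star g := by
  have : f - g = f + (-1 : ℂ) • g := by rw [neg_one_smul, sub_eq_add_neg]
  rw [this, star_add_L2, star_smul_L2]
  simp [sub_eq_add_neg]

theorem star_zero_L2 : star (0 : L2) = 0 := by
  have := star_smul_L2 0 0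
  simpa using this

theorem inner_star_right (f g : L2) : ⟪f, star g⟫ = star ⟪star f, g⟫ := by
  rw [← pair, pair_comm, star_pair]

/-- An operator with a real multiplier and a real kernel commutes with complex conjugation. -/
theorem IsMulAddKernel.star_comm {u : Plane → ℂ} {K : Plane → Plane → ℂ} {A : L2 →L[ℂ] L2}
    (hA : IsMulAddKernel u K A) (hu : ∀ x, star (u x) = u x) (hK : ∀ x y, star (K x y) = K x y)
    (f : L2) : A (star f) = star (A f) := by
  refine Lp.ext ?_
  filter_upwards [hA.2 f, hA.2 (star f), Lp.coeFn_star f, Lp.coeFn_star (A f)] with x h1 h2 h3 h4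
  rw [h2.2, h4, Pi.star_apply, h1.2, h3, star_add, star_mul', hu, Pi.star_apply]
  congr 1
  rw [RCLike.star_def, ← integral_conj]
  refine integral_congr_ae ?_
  filter_upwards [Lp.coeFn_star f] with y hy
  rw [hy, map_mul, Pi.star_apply]
  congr 1
  exact (hK x y).symm

theorem adjoint_mulOp {u : Plane → ℂ} (hu : MemLp u ∞ volume) (hr : ∀ x, star (u x) = u x) :
    ContinuousLinearMap.adjoint (mulOp hu) = mulOp hu := by
  symm
  rw [ContinuousLinearMap.eq_adjoint_iff]
  intro f g
  rw [L2.inner_def, L2.inner_def]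
  refine integral_congr_ae ?_
  filter_upwards [mulOp_apply hu f, mulOp_apply hu g] with x h1 h2
  have := hr x
  rw [RCLike.star_def] at this
  rw [h1, h2, RCLike.inner_apply, RCLike.inner_apply, map_mul, this]
  ring

/-! ### The operators `P`, `Q D₀ Q` and `S` -/

variable (V : Plane → ℝ)

theorem P_mul_P : P V * P V = P V := (Submodule.isIdempotentElem_starProjection _)

theorem adjoint_P : ContinuousLinearMap.adjoint (P V) = P V :=
  (ContinuousLinearMap.isSelfAdjoint_iff'.1 (isSelfAdjoint_starProjection _))

theorem one_sub_P : (1 : L2 →L[ℂ] L2) - P V = (QL2 V).starProjection :=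
  (Submodule.starProjection_orthogonal _).symm

theorem P_mul_QDQ : P V * QDQ V = 0 := by
  ext1 f
  have : QDQ V f ∈ QL2 V := ((D0 V) ((QL2 V).orthogonalProjectionOnto f)).2
  exact (Submodule.starProjection_apply_eq_zero_iff _).2 this

theorem QDQ_mul_P : QDQ V * P V = 0 := by
  ext1 f
  have h1 : P V f ∈ Submodule.span ℂ {vL2 V} := Submodule.starProjection_apply_mem _ _
  have h2 : (QL2 V).orthogonalProjectionOnto (P V f) = 0 :=
    Submodule.orthogonalProjectionOnto_orthogonal_apply_eq_zero h1
  change ((D0 V) ((QL2 V).orthogonalProjectionOnto (P V f)) : L2) = 0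
  rw [h2]; simp

variable {V}

theorem QTQDQ (h : ZeroIsRegular V) : (1 - P V) * T V * QDQ V = 1 - P V := by
  rw [one_sub_P]
  ext1 f
  have h1 := congrArg (fun A => A ((QL2 V).orthogonalProjectionOnto f))
    (Ring.mul_inverse_cancel _ h)
  exact congrArg (Subtype.val) h1

theorem QDQTQ (h : ZeroIsRegular V) : QDQ V * T V * (1 - P V) = 1 - P V := by
  rw [one_sub_P]
  ext1 f
  have h1 := congrArg (fun A => A ((QL2 V).orthogonalProjectionOnto f))
    (Ring.inverse_mul_cancel _ h)
  exact congrArg (Subtype.val) h1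

/-- With D = Q D₀ Q one has D = D* T D, because D* T (1 - P) = 1 - P and D takes values in Q L²; the
right side is self-adjoint together with T. -/
theorem adjoint_QDQ (h : ZeroIsRegular V) (hT : ContinuousLinearMap.adjoint (T V) = T V) :
    ContinuousLinearMap.adjoint (QDQ V) = QDQ V := by
  simp only [← ContinuousLinearMap.star_eq_adjoint] at *
  have hP : star (P V) = P V := adjoint_P V
  have h1 : star (QDQ V) * T V * (1 - P V) = 1 - P V := by
    have := congrArg star (QTQDQ h)
    simpa [hT, hP, mul_assoc] using this
  have h2 : QDQ V = star (QDQ V) * T V * QDQ V := by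
    calc QDQ V = (1 - P V) * QDQ V := by rw [sub_mul, P_mul_QDQ]; simp
      _ = star (QDQ V) * T V * ((1 - P V) * QDQ V) := by rw [← mul_assoc, h1]
      _ = _ := by rw [sub_mul, P_mul_QDQ]; simp
  calc star (QDQ V) = star (star (QDQ V) * T V * QDQ V) := by rw [← h2]
    _ = star (QDQ V) * T V * QDQ V := by simp [hT, mul_assoc]
    _ = QDQ V := h2.symm

theorem P_apply (f : L2) : P V f = (⟪vL2 V, f⟫ / (‖vL2 V‖ ^ 2 : ℝ)) • vL2 V := by
  rw [P, Submodule.starProjection_singleton]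
  rfl

theorem star_P (hv : star (vL2 V) = vL2 V) (f : L2) : P V (star f) = star (P V f) := by
  rw [P_apply, P_apply, star_smul_L2, hv, inner_star_right, hv, star_div₀]
  simp

/-- With D = Q D₀ Q, the conjugate of D f lies in Q L², hence is fixed by D T. As T is real, it
equals D applied to the conjugate of T D f, and T D f differs from f only by vectors in the range of
P, which D annihilates. -/
theorem star_QDQ (h : ZeroIsRegular V) (hv : star (vL2 V) = vL2 V)
    (hT : ∀ f, T V (star f) = star (T V f)) (f : L2) : QDQ V (star f) = star (QDQ V f) := by
  have app : ∀ (A B : L2 →L[ℂ] L2) (x : L2), (A * B) x = A (B x) := fun _ _ _ => rfl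
  have h1 : P V (star (QDQ V f)) = 0 := by
    rw [star_P hv, ← app, P_mul_QDQ]; simpa using star_zero_L2
  have h2 : QDQ V (T V (star (QDQ V f))) = star (QDQ V f) := by
    have := congrArg (fun A => A (star (QDQ V f))) (QDQTQ h)
    simpa [app, h1] using this
  have h3 : T V (QDQ V f) = f - P V f + P V (T V (QDQ V f)) := by
    have := congrArg (fun A => A f) (QTQDQ h)
    simp only [app, sub_apply, one_apply_eq_self] at this
    rw [← this]; abel
  have h4 : ∀ x, QDQ V (P V x) = 0 := fun x => by rw [← app, QDQ_mul_P]; rfl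
  rw [← h2, hT, h3, star_add_L2, star_sub_L2, ← star_P hv, ← star_P hv, map_add, map_sub, h4, h4]
  simp

/-- `S` is a multiple of the projection onto the line spanned by `v - Q D₀ Q T v`. -/
theorem S_apply (h : ZeroIsRegular V) (hT : ContinuousLinearMap.adjoint (T V) = T V) (f : L2) :
    S V f = (⟪vL2 V - QDQ V (T V (vL2 V)), f⟫ / (‖vL2 V‖ ^ 2 : ℝ)) •
      (vL2 V - QDQ V (T V (vL2 V))) := by
  have hD := adjoint_QDQ h hT
  -- The factorization exhibits S as P between an operator and its adjoint, so S is built from the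
  -- single vector w = (1 - Q D₀ Q T) v.
  have h1 : S V = (1 - QDQ V * T V) * P V * (1 - T V * QDQ V) := by
    have : S V = P V - P V * T V * QDQ V - QDQ V * T V * P V +
      QDQ V * T V * P V * T V * QDQ V := rfl
    rw [this]; noncomm_ring
  have h2 : ⟪vL2 V, f - T V (QDQ V f)⟫ = ⟪vL2 V - QDQ V (T V (vL2 V)), f⟫ := by
    rw [inner_sub_right, inner_sub_left, ← ContinuousLinearMap.adjoint_inner_left, hT,
      ← ContinuousLinearMap.adjoint_inner_left, hD]
  rw [← h2, h1]
  have h3 : ((1 - QDQ V * T V) * P V * (1 - T V * QDQ V)) f =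
    P V (f - T V (QDQ V f)) - QDQ V (T V (P V (f - T V (QDQ V f)))) := rfl
  rw [h3, P_apply, map_smul, map_smul, smul_sub]

theorem rank_S_le (h : ZeroIsRegular V) (hT : ContinuousLinearMap.adjoint (T V) = T V) :
    LinearMap.rank (S V : L2 →ₗ[ℂ] L2) ≤ 1 := by
  set w := vL2 V - QDQ V (T V (vL2 V))
  have : LinearMap.range (S V : L2 →ₗ[ℂ] L2) ≤ Submodule.span ℂ {w} := by
    rintro _ ⟨f, rfl⟩
    exact Submodule.mem_span_singleton.2 ⟨_, (S_apply h hT f).symm⟩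
  refine (Submodule.rank_mono this).trans ((rank_span_le _).trans ?_)
  simp

/-- The vector w spanning the range is real, since v is real and T and Q D₀ Q commute with complex
conjugation. The kernel is w(x) w(y) / ‖v‖². -/
theorem hasKernel_S (h : ZeroIsRegular V) (hT : ContinuousLinearMap.adjoint (T V) = T V)
    (hv : star (vL2 V) = vL2 V) (hTs : ∀ f, T V (star f) = star (T V f)) :
    ∃ s : Plane → Plane → ℝ, HasKernel (S V) fun x y => (s x y : ℂ) := by
  set w := vL2 V - QDQ V (T V (vL2 V)) with hw
  have hws : star w = w := by
    rw [hw, star_sub_L2, hv, ← star_QDQ h hv hTs, ← hTs, hv]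
  have hre : ∀ᵐ x, star (w x) = w x := by
    filter_upwards [Lp.coeFn_star w] with x hx
    rw [hws] at hx; exact hx.symm
  refine ⟨fun x y => (w x).re * (w y).re / ‖vL2 V‖ ^ 2, ?_, fun f => ?_⟩
  · have hm : AEStronglyMeasurable (fun x => (w x).re) volume :=
      Complex.continuous_re.comp_aestronglyMeasurable (Lp.aestronglyMeasurable w)
    have hm2 : AEStronglyMeasurable (fun p : Plane × Plane => (w p.1).re * (w p.2).re)
        (volume.prod volume) := hm.comp_fst.mul hm.comp_snd
    simp only [div_eq_mul_inv]
    exact Complex.continuous_ofReal.comp_aestronglyMeasurable (hm2.mul_const _)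
  · filter_upwards [hre, Lp.coeFn_smul (⟪w, f⟫ / (‖vL2 V‖ ^ 2 : ℝ)) w] with x hx h2
    have e : (fun y => (((w x).re * (w y).re / ‖vL2 V‖ ^ 2 : ℝ) : ℂ) * f y) =ᵐ[volume]
        fun y => (w x / (‖vL2 V‖ ^ 2 : ℝ)) * (w y * f y) := by
      filter_upwards [hre] with y hy
      push_cast
      rw [Complex.conj_eq_iff_re.1 hx, Complex.conj_eq_iff_re.1 hy]
      ring
    refine ⟨((L2_integrable_mul w f).const_mul _).congr e.symm, ?_⟩
    rw [integral_congr_ae e, integral_const_mul, ← pair_eq, pair, hws, S_apply h hT, h2,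
      Pi.smul_apply, smul_eq_mul]
    ring

/-- The compression of an operator to the line spanned by `v`. -/
theorem P_mul_mul_P (A : L2 →L[ℂ] L2) :
    P V * A * P V = (⟪vL2 V, A (vL2 V)⟫ / (‖vL2 V‖ ^ 2 : ℝ)) • P V := by
  ext1 f
  have : (P V * A * P V) f = P V (A (P V f)) := rfl
  rw [this, smul_apply, P_apply (A _), P_apply f, map_smul, inner_smul_right]
  simp only [smul_smul]
  congr 1; ring

theorem inner_self_real {A : L2 →L[ℂ] L2} (hA : ContinuousLinearMap.adjoint A = A) (f : L2) :
    ((⟪f, A f⟫).re : ℂ) = ⟪f, A f⟫ := by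
  refine Complex.conj_eq_iff_re.1 ?_
  have := inner_conj_symm (𝕜 := ℂ) f (A f)
  have e : ⟪A f, f⟫ = ⟪f, A f⟫ := by rw [← ContinuousLinearMap.adjoint_inner_right, hA]
  rwa [e] at this

/-- `g P + T` is invertible, with the stated inverse, for some real constant `c`. -/
theorem exists_inverse (h : ZeroIsRegular V) (hT : ContinuousLinearMap.adjoint (T V) = T V) :
    ∃ c : ℝ, ∀ z : ℂ, z + c ≠ 0 →
      (z • P V + T V) * ((z + c)⁻¹ • S V + QDQ V) = 1 ∧
      ((z + c)⁻¹ • S V + QDQ V) * (z • P V + T V) = 1 := by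
  have hD := adjoint_QDQ h hT
  have hTDT : ContinuousLinearMap.adjoint (T V * QDQ V * T V) = T V * QDQ V * T V := by
    simp only [← ContinuousLinearMap.star_eq_adjoint] at *
    simp [hT, hD, mul_assoc]
  have h1 := P_mul_mul_P (V := V) (T V)
  have h2 := P_mul_mul_P (V := V) (T V * QDQ V * T V)
  rw [← inner_self_real hT] at h1
  rw [← inner_self_real hTDT] at h2
  -- This is c = τ - κ, the coefficient of P in P T P - P T Q D₀ Q T P. It is real because T and T Q
  -- D₀ Q T are self-adjoint.
  refine ⟨(⟪vL2 V, T V (vL2 V)⟫).re / ‖vL2 V‖ ^ 2 -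
    (⟪vL2 V, (T V * QDQ V * T V) (vL2 V)⟫).re / ‖vL2 V‖ ^ 2, fun z hz => ?_⟩
  push_cast at hz h1 h2 ⊢
  have h2' : P V * T V * QDQ V * T V * P V = P V * (T V * QDQ V * T V) * P V := by
    simp only [mul_assoc]
  exact ⟨feshbach_mul (P_mul_QDQ V) (P_mul_P V) (QTQDQ h) h1 (h2'.trans h2) hz,
    feshbach_mul' (QDQ_mul_P V) (P_mul_P V) (QDQTQ h) h1 (h2'.trans h2) hz⟩

end

/-! ### Entire functions given by power series -/

/-- The function with the power series coefficients `a`. -/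
def powerSum (a : ℕ → ℝ) (w : ℝ) : ℝ := ∑' k, a k * w ^ k

/-- The coefficients of the derivative. -/
def derivCoeff (a : ℕ → ℝ) (k : ℕ) : ℝ := (k + 1) * a (k + 1)

variable {a : ℕ → ℝ}

/-- The bound 1/k! is stable under differentiation of the series, so one lemma on termwise
differentiation serves for all derivatives. -/
theorem abs_derivCoeff_le (ha : ∀ k, |a k| ≤ 1 / k.factorial) (k : ℕ) :
    |derivCoeff a k| ≤ 1 / k.factorial := by
  have h := ha (k + 1)
  rw [derivCoeff, abs_mul, abs_of_nonneg (by positivity)]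
  calc ((k : ℝ) + 1) * |a (k + 1)| ≤ (k + 1) * (1 / (k + 1).factorial) := by gcongr
    _ = 1 / k.factorial := by rw [Nat.factorial_succ]; push_cast; field_simp

theorem summable_powerSum (ha : ∀ k, |a k| ≤ 1 / k.factorial) (w : ℝ) :
    Summable fun k => a k * w ^ k := by
  refine Summable.of_norm_bounded (Real.summable_pow_div_factorial |w|) fun k => ?_
  rw [norm_mul, norm_pow, Real.norm_eq_abs, Real.norm_eq_abs, div_eq_mul_one_div, mul_comm]
  gcongr
  exact ha k

theorem hasDerivAt_powerSum (ha : ∀ k, |a k| ≤ 1 / k.factorial) (w : ℝ) :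
    HasDerivAt (powerSum a) (powerSum (derivCoeff a) w) w := by
  set R := |w| + 1 with hR
  have hR0 : 0 < R := by positivity
  have hw : w ∈ Ioo (-R) R := abs_lt.1 (by rw [hR]; linarith)
  have hu : Summable fun k : ℕ => (k : ℝ) * |a k| * R ^ (k - 1) := by
    refine (summable_nat_add_iff 1).1 (Summable.of_nonneg_of_le (fun k => by positivity)
      (fun k => ?_) (Real.summable_pow_div_factorial R))
    have := abs_derivCoeff_le ha k
    rw [derivCoeff, abs_mul, abs_of_nonneg (by positivity)] at this
    rw [div_eq_mul_one_div, mul_comm (R ^ k), Nat.add_sub_cancel]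
    push_cast
    gcongr
  have h := hasDerivAt_tsum_of_isPreconnected (g := fun k z => a k * z ^ k)
    (g' := fun k z => a k * (k * z ^ (k - 1))) hu isOpen_Ioo isPreconnected_Ioo
    (fun k y _ => (hasDerivAt_pow k y).const_mul (a k)) (fun k y hy => by
      rw [norm_mul, norm_mul, norm_pow, Real.norm_eq_abs, Real.norm_eq_abs, Real.norm_eq_abs,
        Nat.abs_cast]
      have : |y| ≤ R := (abs_lt.2 hy).le
      calc |a k| * (k * |y| ^ (k - 1)) = k * |a k| * |y| ^ (k - 1) := by ring
        _ ≤ _ := by gcongr) hw (summable_powerSum ha w) hw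
  have e : ∑' k, a k * (k * w ^ (k - 1)) = powerSum (derivCoeff a) w := by
    rw [tsum_eq_zero_add' ((summable_powerSum (abs_derivCoeff_le ha) w).congr fun k => ?_)]
    · simp only [Nat.cast_zero, zero_mul, mul_zero, zero_add, powerSum, derivCoeff]
      refine tsum_congr fun k => ?_
      simp only [Nat.add_sub_cancel, Nat.cast_add, Nat.cast_one]; ring
    · simp only [derivCoeff, Nat.add_sub_cancel, Nat.cast_add, Nat.cast_one]; ring
  rw [e] at h
  exact h

theorem powerSum_zero (a : ℕ → ℝ) : powerSum a 0 = a 0 := by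
  rw [powerSum, tsum_eq_single 0 fun k hk => by simp [hk]]; simp

/-- The Euler operator w d/dw multiplies the k-th coefficient by k; in this form the differential
equations can be checked coefficientwise. -/
theorem mul_powerSum_derivCoeff (ha : ∀ k, |a k| ≤ 1 / k.factorial) (w : ℝ) :
    HasSum (fun k => k * a k * w ^ k) (w * powerSum (derivCoeff a) w) := by
  have h := (summable_powerSum (abs_derivCoeff_le ha) w).hasSum.mul_left w
  refine (hasSum_nat_add_iff' 1).1 ?_
  simp only [Finset.range_one, Finset.sum_singleton, Nat.cast_zero, zero_mul, sub_zero]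
  refine h.congr_fun fun k => ?_
  rw [derivCoeff]; push_cast; ring

/-! ### Bessel's equation -/

/-- The Taylor coefficients of `J₀(z)` in `(z/2)²`. -/
def coeffJ (k : ℕ) : ℝ := (-1) ^ k / (k.factorial : ℝ) ^ 2

/-- The Taylor coefficients of the entire part of `Y₀(z)` in `(z/2)²`. -/
def coeffL (k : ℕ) : ℝ := (-1) ^ (k + 1) * (harmonic k : ℝ) / (k.factorial : ℝ) ^ 2

theorem abs_coeffJ_le (k : ℕ) : |coeffJ k| ≤ 1 / k.factorial := by
  have h1 : (1 : ℝ) ≤ k.factorial := by exact_mod_cast Nat.one_le_iff_ne_zero.2 k.factorial_ne_zero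
  rw [coeffJ, abs_div, abs_pow, abs_neg, abs_one, one_pow, abs_of_nonneg (by positivity)]
  gcongr
  nlinarith

/-- A crude bound: one of the two factorials in the denominator of `coeffL` absorbs the harmonic
number. -/
theorem harmonic_le_factorial (k : ℕ) : harmonic k ≤ k.factorial := by
  induction k with
  | zero => simp
  | succ k ih =>
    rcases Nat.eq_zero_or_pos k with rfl | hk
    · simp [harmonic]
    rw [harmonic_succ, Nat.factorial_succ]
    have h1 : (1 : ℚ) ≤ k.factorial := by
      exact_mod_cast Nat.one_le_iff_ne_zero.2 k.factorial_ne_zero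
    have h2 : (1 : ℚ) ≤ k := by exact_mod_cast hk
    have h3 : ((↑(k + 1) : ℚ))⁻¹ ≤ 1 := inv_le_one_of_one_le₀ (by push_cast; linarith)
    push_cast at h3 ⊢
    nlinarith

theorem abs_coeffL_le (k : ℕ) : |coeffL k| ≤ 1 / k.factorial := by
  have h0 : (0 : ℝ) < k.factorial := by exact_mod_cast k.factorial_pos
  have h1 : (harmonic k : ℝ) ≤ k.factorial := by exact_mod_cast harmonic_le_factorial k
  have h2 : (0 : ℝ) ≤ harmonic k := by
    have : 0 ≤ harmonic k := Finset.sum_nonneg fun i _ => by positivity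
    exact_mod_cast this
  rw [coeffL, abs_div, abs_mul, abs_pow, abs_neg, abs_one, one_pow, one_mul, abs_of_nonneg h2,
    abs_of_nonneg (by positivity), div_le_div_iff₀ (by positivity) h0]
  nlinarith

theorem coeffJ_rec (k : ℕ) : (k + 1 : ℝ) ^ 2 * coeffJ (k + 1) + coeffJ k = 0 := by
  have h0 : (k.factorial : ℝ) ≠ 0 := by exact_mod_cast k.factorial_ne_zero
  rw [coeffJ, coeffJ, Nat.factorial_succ]
  push_cast
  field_simp
  ring

/-- The first term is the contribution of the logarithm: in Bessel's equation for log(z/2) J₀ + L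
the cross term is (2/z) J₀', that is, the derivative of the J-series in w = (z/2)². The recursion
rests on the increment 1/(k+1) of the harmonic numbers. -/
theorem coeffL_rec (k : ℕ) :
    (k + 1 : ℝ) * coeffJ (k + 1) + ((k + 1 : ℝ) ^ 2 * coeffL (k + 1) + coeffL k) = 0 := by
  have h0 : (k.factorial : ℝ) ≠ 0 := by exact_mod_cast k.factorial_ne_zero
  rw [coeffJ, coeffL, coeffL, Nat.factorial_succ, harmonic_succ]
  push_cast
  field_simp
  ring

theorem powerSum_J_ode (w : ℝ) :
    w * powerSum (derivCoeff (derivCoeff coeffJ)) w + powerSum (derivCoeff coeffJ) w +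
      powerSum coeffJ w = 0 := by
  have h := ((mul_powerSum_derivCoeff (abs_derivCoeff_le abs_coeffJ_le) w).add
    (summable_powerSum (abs_derivCoeff_le abs_coeffJ_le) w).hasSum).add
    (summable_powerSum abs_coeffJ_le w).hasSum
  refine h.unique ((hasSum_zero).congr_fun fun k => ?_)
  rw [derivCoeff]
  linear_combination w ^ k * coeffJ_rec k

theorem powerSum_L_ode (w : ℝ) :
    powerSum (derivCoeff coeffJ) w + (w * powerSum (derivCoeff (derivCoeff coeffL)) w +
      powerSum (derivCoeff coeffL) w + powerSum coeffL w) = 0 := by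
  have h := (summable_powerSum (abs_derivCoeff_le abs_coeffJ_le) w).hasSum.add
    (((mul_powerSum_derivCoeff (abs_derivCoeff_le abs_coeffL_le) w).add
    (summable_powerSum (abs_derivCoeff_le abs_coeffL_le) w).hasSum).add
    (summable_powerSum abs_coeffL_le w).hasSum)
  refine h.unique ((hasSum_zero).congr_fun fun k => ?_)
  rw [derivCoeff, derivCoeff]
  linear_combination w ^ k * coeffL_rec k

/-- Solutions of Bessel's equation decay like `z^(-1/2)`. -/
theorem bessel_decay {y y' y'' : ℝ → ℝ} (h1 : ∀ z, 0 < z → HasDerivAt y (y' z) z)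
    (h2 : ∀ z, 0 < z → HasDerivAt y' (y'' z) z)
    (ode : ∀ z, 0 < z → y'' z + y' z / z + y z = 0) :
    ∃ C, 0 ≤ C ∧ ∀ z, 1 ≤ z → |y z| ≤ C * z ^ (-(1 / 2) : ℝ) ∧ |y' z| ≤ C * z ^ (-(1 / 2) : ℝ) ∧
      |y'' z| ≤ C * z ^ (-(1 / 2) : ℝ) := by
  -- The lower-order corrections to the energy z(y'² + y²) are chosen so that, by the equation, its
  -- derivative is exactly -y²/(2z²) ≤ 0.
  set e : ℝ → ℝ := fun z => z * (y' z ^ 2 + y z ^ 2) + y z * y' z + y z ^ 2 / (2 * z) with he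
  have hd : ∀ z, 0 < z → HasDerivAt e (-(y z ^ 2 / (2 * z ^ 2))) z := by
    intro z hz
    have hy := h1 z hz
    have hy' := h2 z hz
    have hid := hasDerivAt_id z
    have := ((hid.mul ((hy'.pow 2).add (hy.pow 2))).add (hy.mul hy')).add
      ((hy.pow 2).div (hid.const_mul 2) (by simpa using hz.ne'))
    refine this.congr_deriv ?_
    have ho : y'' z = -(y' z / z) - y z := by linear_combination ode z hz
    simp only [id, Pi.add_apply, Pi.pow_apply]
    rw [ho]
    field_simp
    ring
  have hanti : AntitoneOn e (Ici 1) := by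
    refine antitoneOn_of_deriv_nonpos (convex_Ici 1)
      (fun z hz => (hd z (zero_lt_one.trans_le hz)).continuousAt.continuousWithinAt) ?_ ?_
    · rw [interior_Ici]
      exact fun z hz => (hd z (zero_lt_one.trans hz)).differentiableAt.differentiableWithinAt
    · rw [interior_Ici]
      intro z hz
      rw [(hd z (zero_lt_one.trans hz)).deriv, neg_nonpos]
      positivity
  have key : ∀ z, 1 ≤ z → y' z ^ 2 + y z ^ 2 ≤ 2 * |e 1| / z := by
    intro z hz
    have hz0 : 0 < z := by linarith
    have h3 := hanti (mem_Ici.2 le_rfl) hz hz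
    have h4 : e 1 ≤ |e 1| := le_abs_self _
    have h5 : 0 ≤ y z ^ 2 / (2 * z) := by positivity
    have h6 : e z = z * (y' z ^ 2 + y z ^ 2) + y z * y' z + y z ^ 2 / (2 * z) := rfl
    rw [le_div_iff₀ hz0]
    -- Since y y' ≥ -(y² + y'²)/2 and z ≥ 1, the energy controls half of its leading term.
    nlinarith [sq_nonneg (y z + y' z), sq_nonneg (y z), sq_nonneg (y' z)]
  set K := Real.sqrt (2 * |e 1|) with hK
  have hKz : ∀ z x : ℝ, 1 ≤ z → x ^ 2 ≤ 2 * |e 1| / z → |x| ≤ K * z ^ (-(1 / 2) : ℝ) := by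
    intro z x hz hx
    have hz0 : 0 < z := by linarith
    rw [Real.rpow_neg hz0.le, ← Real.sqrt_eq_rpow, ← div_eq_mul_inv, hK,
      ← Real.sqrt_div (by positivity)]
    exact Real.abs_le_sqrt hx
  have hK0 : 0 ≤ K := Real.sqrt_nonneg _
  refine ⟨2 * K, by positivity, fun z hz => ?_⟩
  have hz0 : 0 < z := by linarith
  have hr := Real.rpow_nonneg hz0.le (-(1 / 2) : ℝ)
  have hKr := mul_nonneg hK0 hr
  have k1 := hKz z (y z) hz (by nlinarith [key z hz, sq_nonneg (y' z)])
  have k2 := hKz z (y' z) hz (by nlinarith [key z hz, sq_nonneg (y z)])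
  refine ⟨by linarith, by linarith, ?_⟩
  have ho : y'' z = -(y' z / z) - y z := by linear_combination ode z hz0
  have hdiv : |y' z / z| ≤ |y' z| := by
    rw [abs_div, abs_of_pos hz0]
    exact div_le_self (abs_nonneg _) hz
  calc |y'' z| ≤ |y' z / z| + |y z| := by
        rw [ho]; refine (abs_sub _ _).trans ?_; rw [abs_neg]
    _ ≤ 2 * K * z ^ (-(1 / 2) : ℝ) := by linarith

/-! ### Bounds for the remainder of the resolvent kernel -/

/-- The function `z ↦ ∑ a k (z/2)^(2k)`. -/
def evenSum (a : ℕ → ℝ) (z : ℝ) : ℝ := powerSum a ((z / 2) ^ 2)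

/-- The first derivative of `evenSum a`. -/
def evenSum' (a : ℕ → ℝ) (z : ℝ) : ℝ := powerSum (derivCoeff a) ((z / 2) ^ 2) * (z / 2)

/-- The second derivative of `evenSum a`. -/
def evenSum'' (a : ℕ → ℝ) (z : ℝ) : ℝ :=
  powerSum (derivCoeff (derivCoeff a)) ((z / 2) ^ 2) * (z / 2) ^ 2 +
    powerSum (derivCoeff a) ((z / 2) ^ 2) / 2

section evenSum

variable {a : ℕ → ℝ}

theorem hasDerivAt_evenSum (ha : ∀ k, |a k| ≤ 1 / k.factorial)
    (z : ℝ) : HasDerivAt (evenSum a) (evenSum' a z) z := by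
  have h := (hasDerivAt_powerSum ha ((z / 2) ^ 2)).comp z (((hasDerivAt_id z).div_const 2).pow 2)
  refine h.congr_deriv ?_
  simp only [evenSum', id]
  push_cast; ring

theorem hasDerivAt_evenSum' (ha : ∀ k, |a k| ≤ 1 / k.factorial)
    (z : ℝ) : HasDerivAt (evenSum' a) (evenSum'' a z) z := by
  have h := ((hasDerivAt_powerSum (abs_derivCoeff_le ha) ((z / 2) ^ 2)).comp z
    (((hasDerivAt_id z).div_const 2).pow 2)).mul ((hasDerivAt_id z).div_const 2)
  refine h.congr_deriv ?_
  simp only [evenSum'', id, Function.comp, Pi.pow_apply]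
  push_cast; ring

theorem exists_bound_powerSum (ha : ∀ k, |a k| ≤ 1 / k.factorial) :
    ∃ C, 0 ≤ C ∧ ∀ w ∈ Icc (0 : ℝ) 1, |powerSum a w| ≤ C := by
  have hc : ContinuousOn (powerSum a) (Icc 0 1) := fun w _ =>
    (hasDerivAt_powerSum ha w).continuousAt.continuousWithinAt
  obtain ⟨C, hC⟩ := isCompact_Icc.exists_bound_of_continuousOn hc
  exact ⟨C, (norm_nonneg _).trans (hC 0 ⟨le_rfl, zero_le_one⟩), fun w hw => hC w hw⟩

theorem exists_bound_evenSum (ha : ∀ k, |a k| ≤ 1 / k.factorial) :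
    ∃ C, 0 ≤ C ∧ ∀ z ∈ Ioc (0 : ℝ) 1,
    |evenSum a z - a 0| ≤ C * z ^ 2 ∧ |evenSum' a z| ≤ C * z ∧ |evenSum'' a z| ≤ C := by
  obtain ⟨C₁, h₁, hC₁⟩ := exists_bound_powerSum (abs_derivCoeff_le ha)
  obtain ⟨C₂, h₂, hC₂⟩ := exists_bound_powerSum (abs_derivCoeff_le (abs_derivCoeff_le ha))
  refine ⟨C₁ + C₂, by positivity, fun z hz => ?_⟩
  have hw : (z / 2) ^ 2 ∈ Icc (0 : ℝ) 1 := ⟨by positivity, by nlinarith [hz.1, hz.2]⟩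
  have b1 := hC₁ _ hw
  have b2 := hC₂ _ hw
  have hz0 := hz.1
  refine ⟨?_, ?_, ?_⟩
  · have := Convex.norm_image_sub_le_of_norm_hasDerivWithin_le (f := powerSum a) (s := Icc 0 1)
      (fun x _ => (hasDerivAt_powerSum ha x).hasDerivWithinAt) (fun x hx => hC₁ x hx)
      (convex_Icc 0 1) ⟨le_rfl, zero_le_one⟩ hw
    rw [powerSum_zero, sub_zero, Real.norm_eq_abs, Real.norm_eq_abs, abs_of_nonneg hw.1] at this
    refine this.trans ?_
    have : (z / 2) ^ 2 ≤ z ^ 2 := by nlinarith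
    have h3 : 0 ≤ C₂ * z ^ 2 := by positivity
    nlinarith
  · rw [evenSum', abs_mul, abs_of_pos (by positivity : 0 < z / 2)]
    have h3 := mul_le_mul_of_nonneg_right b1 (by positivity : 0 ≤ z / 2)
    nlinarith [mul_nonneg h₁ hz0.le, mul_nonneg h₂ hz0.le]
  · rw [evenSum'']
    refine (abs_add_le _ _).trans ?_
    rw [abs_mul, abs_div, abs_of_nonneg hw.1, abs_two]
    have h3 := mul_le_mul b2 hw.2 hw.1 h₂
    linarith

end evenSum

/-- The log term of `Y₀`. -/
def logTerm (z : ℝ) : ℝ := Real.log (z / 2) + Real.eulerMascheroniConstant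

theorem hasDerivAt_logTerm {z : ℝ} (hz : 0 < z) : HasDerivAt logTerm (1 / z) z := by
  have h := (((hasDerivAt_id z).div_const 2).log (by simpa using hz.ne')).add_const
    Real.eulerMascheroniConstant
  refine h.congr_deriv ?_
  simp only [id]; field_simp

/-- Apply log z ≤ z^s / s to z and to 1/z; the constant is absorbed because z^s + z^(-s) ≥ 1. -/
theorem exists_bound_log (c : ℝ) : ∃ C, 0 ≤ C ∧ ∀ z, 0 < z → ∀ s, 0 < s →
    |Real.log z + c| ≤ C * (1 + 1 / s) * (z ^ s + z ^ (-s)) := by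
  refine ⟨1 + |c|, by positivity, fun z hz s hs => ?_⟩
  have h1 : Real.log z ≤ z ^ s / s := Real.log_le_rpow_div hz.le hs
  have h2 : -Real.log z ≤ z ^ (-s) / s := by
    have := Real.log_le_rpow_div (inv_nonneg.2 hz.le) hs
    rwa [Real.log_inv, Real.inv_rpow hz.le, ← Real.rpow_neg hz.le] at this
  have p1 := Real.rpow_pos_of_pos hz s
  have p2 := Real.rpow_pos_of_pos hz (-s)
  have h3 : |Real.log z| ≤ (1 / s) * (z ^ s + z ^ (-s)) := by
    rw [abs_le]
    have e1 : (1 / s) * (z ^ s + z ^ (-s)) = z ^ s / s + z ^ (-s) / s := by ring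
    have q1 : 0 < z ^ s / s := by positivity
    have q2 : 0 < z ^ (-s) / s := by positivity
    constructor <;> linarith
  have h4 : 1 ≤ z ^ s + z ^ (-s) := by
    rcases le_total 1 z with h | h
    · linarith [Real.one_le_rpow h hs.le]
    · linarith [Real.one_le_rpow_of_pos_of_le_one_of_nonpos hz h (by linarith : -s ≤ 0)]
  have h5 : 0 < 1 / s := by positivity
  calc |Real.log z + c| ≤ |Real.log z| + |c| := abs_add_le _ _
    _ ≤ (1 / s) * (z ^ s + z ^ (-s)) + |c| * (z ^ s + z ^ (-s)) := by
      have := mul_le_mul_of_nonneg_left h4 (abs_nonneg c)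
      linarith
    _ = (1 / s + |c|) * (z ^ s + z ^ (-s)) := by ring
    _ ≤ (1 + |c|) * (1 + 1 / s) * (z ^ s + z ^ (-s)) := by
      have : 0 ≤ |c| * (1 / s) := by positivity
      gcongr
      nlinarith

/-- Bounds of the type satisfied by the remainder of the resolvent kernel as a function of
`z = λ r`. -/
def RemainderBound (δ : ℝ) (f f' f'' : ℝ → ℝ) : Prop :=
  ∃ C, 0 ≤ C ∧ ∀ z, 0 < z → HasDerivAt f (f' z) z ∧ HasDerivAt f' (f'' z) z ∧
    |f z| ≤ C * z ^ (1 / 2 + δ) ∧ |f' z| ≤ C * z ^ (δ - 1 / 2) ∧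
    |f'' z| ≤ C * (z ^ (δ - 3 / 2) * (1 + z))

/-- Near 0 the condition δ ≤ 1/2 lets linear vanishing dominate z^(1/2+δ). At infinity the second
derivative decays no faster than z^(-1/2), which is what the extra factor 1 + z accounts for. -/
theorem remainderBound_of {δ : ℝ} (hδ0 : 0 ≤ δ) (hδ1 : δ ≤ 1 / 2) {f f' f'' : ℝ → ℝ}
    (hd : ∀ z, 0 < z → HasDerivAt f (f' z) z) (hd' : ∀ z, 0 < z → HasDerivAt f' (f'' z) z)
    (hs : ∃ C, 0 ≤ C ∧ ∀ z ∈ Ioc (0 : ℝ) 1, |f z| ≤ C * z ∧ |f' z| ≤ C ∧ |f'' z| ≤ C * z⁻¹)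
    (hl : ∃ C, 0 ≤ C ∧ ∀ z, 1 ≤ z → |f z| ≤ C * z ^ (1 / 2 : ℝ) ∧
      |f' z| ≤ C * z ^ (-(1 / 2) : ℝ) ∧ |f'' z| ≤ C * z ^ (-(1 / 2) : ℝ)) :
    RemainderBound δ f f' f'' := by
  obtain ⟨C₁, h₁, hC₁⟩ := hs
  obtain ⟨C₂, h₂, hC₂⟩ := hl
  refine ⟨C₁ + C₂, by positivity, fun z hz => ⟨hd z hz, hd' z hz, ?_⟩⟩
  have key : ∀ {x b t : ℝ} {C : ℝ}, 0 ≤ C → C ≤ C₁ + C₂ → 0 ≤ t → b ≤ t → x ≤ C * b →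
      x ≤ (C₁ + C₂) * t := fun hC hC' ht hbt hx =>
    hx.trans ((mul_le_mul_of_nonneg_left hbt hC).trans (mul_le_mul_of_nonneg_right hC' ht))
  have p1 := Real.rpow_nonneg hz.le (1 / 2 + δ)
  have p2 := Real.rpow_nonneg hz.le (δ - 1 / 2)
  have p3 := Real.rpow_nonneg hz.le (δ - 3 / 2)
  have p4 : 0 ≤ z ^ (δ - 3 / 2) * (1 + z) := by positivity
  rcases le_total z 1 with hz1 | hz1
  · obtain ⟨b1, b2, b3⟩ := hC₁ z ⟨hz, hz1⟩
    rw [← mul_one C₁] at b2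
    refine ⟨key h₁ (by linarith) p1 ?_ b1, key h₁ (by linarith) p2 ?_ b2,
      key h₁ (by linarith) p4 ?_ b3⟩
    · simpa using Real.rpow_le_rpow_of_exponent_ge hz hz1 (by linarith : 1 / 2 + δ ≤ 1)
    · exact Real.one_le_rpow_of_pos_of_le_one_of_nonpos hz hz1 (by linarith)
    · have := Real.rpow_le_rpow_of_exponent_ge hz hz1 (by linarith : δ - 3 / 2 ≤ -1)
      rw [Real.rpow_neg_one] at this
      nlinarith
  · obtain ⟨b1, b2, b3⟩ := hC₂ z hz1
    refine ⟨key h₂ (by linarith) p1 ?_ b1, key h₂ (by linarith) p2 ?_ b2,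
      key h₂ (by linarith) p4 ?_ b3⟩
    · exact Real.rpow_le_rpow_of_exponent_le hz1 (by linarith)
    · exact Real.rpow_le_rpow_of_exponent_le hz1 (by linarith)
    · have h5 : z ^ (-(1 / 2) : ℝ) ≤ z ^ (δ - 3 / 2 + 1) :=
        Real.rpow_le_rpow_of_exponent_le hz1 (by linarith)
      rw [Real.rpow_add_one hz.ne'] at h5
      nlinarith

/-! ### Bessel functions as even series, and their remainders -/

theorem besselJ0_eq (z : ℝ) : besselJ0 z = evenSum coeffJ z := by
  rw [besselJ0, evenSum, powerSum]
  refine tsum_congr fun k => ?_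
  rw [coeffJ, ← pow_mul]; ring

theorem besselY0_eq (z : ℝ) : besselY0 z =
    2 / Real.pi * (logTerm z * evenSum coeffJ z + evenSum coeffL z) := by
  have : ∑' k : ℕ, (-1) ^ (k + 1) * (harmonic k : ℝ) * (z / 2) ^ (2 * k) / (k.factorial : ℝ) ^ 2
      = evenSum coeffL z := by
    rw [evenSum, powerSum]
    refine tsum_congr fun k => ?_
    rw [coeffL, ← pow_mul]; ring
  rw [besselY0, this, besselJ0_eq, logTerm]; ring

theorem evenSum_J_ode {z : ℝ} (hz : 0 < z) :
    evenSum'' coeffJ z + evenSum' coeffJ z / z + evenSum coeffJ z = 0 := by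
  have h := powerSum_J_ode ((z / 2) ^ 2)
  rw [evenSum, evenSum', evenSum'']
  field_simp
  field_simp at h
  linear_combination h

theorem coeffJ_zero : coeffJ 0 = 1 := by simp [coeffJ]

theorem coeffL_zero : coeffL 0 = 0 := by simp [coeffL]

theorem exists_remainderBound_J {δ : ℝ} (hδ0 : 0 ≤ δ) (hδ1 : δ ≤ 1 / 2) :
    ∃ f' f'', RemainderBound δ (fun z => evenSum coeffJ z - 1) f' f'' := by
  refine ⟨evenSum' coeffJ, evenSum'' coeffJ, remainderBound_of hδ0 hδ1
    (fun z _ => (hasDerivAt_evenSum abs_coeffJ_le z).sub_const 1)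
    (fun z _ => hasDerivAt_evenSum' abs_coeffJ_le z) ?_ ?_⟩
  · obtain ⟨C, h0, hC⟩ := exists_bound_evenSum abs_coeffJ_le
    rw [coeffJ_zero] at hC
    refine ⟨C, h0, fun z hz => ?_⟩
    obtain ⟨b1, b2, b3⟩ := hC z hz
    have hz2 : z ^ 2 ≤ z := by nlinarith [hz.1, hz.2]
    have hz3 : 1 ≤ z⁻¹ := (one_le_inv₀ hz.1).2 hz.2
    exact ⟨b1.trans (by gcongr), b2.trans (by nlinarith [hz.2]), b3.trans (by nlinarith)⟩
  · obtain ⟨C, h0, hC⟩ := bessel_decay (fun z _ => hasDerivAt_evenSum abs_coeffJ_le z)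
      (fun z _ => hasDerivAt_evenSum' abs_coeffJ_le z) fun z hz => evenSum_J_ode hz
    refine ⟨C + 1, by positivity, fun z hz => ?_⟩
    obtain ⟨b1, b2, b3⟩ := hC z hz
    have p0 := Real.rpow_nonneg (by linarith : 0 ≤ z) (-(1 / 2) : ℝ)
    have p1 := Real.one_le_rpow hz (by norm_num : (0 : ℝ) ≤ 1 / 2)
    have p2 := Real.rpow_le_rpow_of_exponent_le hz (by norm_num : (-(1 / 2) : ℝ) ≤ 1 / 2)
    refine ⟨?_, by linarith, by linarith⟩
    calc |evenSum coeffJ z - 1| ≤ |evenSum coeffJ z| + |1| := abs_sub _ _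
      _ ≤ C * z ^ (1 / 2 : ℝ) + z ^ (1 / 2 : ℝ) := by
        rw [abs_one]
        exact add_le_add (b1.trans (mul_le_mul_of_nonneg_left p2 h0)) p1
      _ = _ := by ring

/-- The function is (π/2) Y₀ minus its logarithmic term. For z ≤ 1 the double zero of J₀ - 1
outweighs the logarithm. For z ≥ 1 the full combination solves Bessel's equation and decays, while
the subtracted logarithm is O(z^(1/2)) and its derivatives are negative powers. -/
theorem exists_remainderBound_Y {δ : ℝ} (hδ0 : 0 ≤ δ) (hδ1 : δ ≤ 1 / 2) :
    ∃ f' f'', RemainderBound δ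
      (fun z => logTerm z * (evenSum coeffJ z - 1) + evenSum coeffL z) f' f'' := by
  have dJ := hasDerivAt_evenSum abs_coeffJ_le
  have dJ' := hasDerivAt_evenSum' abs_coeffJ_le
  have dL := hasDerivAt_evenSum abs_coeffL_le
  have dL' := hasDerivAt_evenSum' abs_coeffL_le
  have dinv : ∀ z : ℝ, 0 < z → HasDerivAt (fun z : ℝ => 1 / z) (-(1 / z ^ 2)) z := fun z hz => by
    simpa using hasDerivAt_inv hz.ne'
  obtain ⟨K, hK0, hK⟩ := exists_bound_log (-Real.log 2 + Real.eulerMascheroniConstant)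
  have hlog : ∀ z, 0 < z → |logTerm z| ≤ 3 * K * (z ^ (1 / 2 : ℝ) + z ^ (-(1 / 2) : ℝ)) := by
    intro z hz
    have e : logTerm z = Real.log z + (-Real.log 2 + Real.eulerMascheroniConstant) := by
      rw [logTerm, Real.log_div hz.ne' two_ne_zero]; ring
    rw [e]
    refine (hK z hz (1 / 2) (by norm_num)).trans (le_of_eq ?_)
    ring
  refine ⟨fun z => 1 / z * (evenSum coeffJ z - 1) + logTerm z * evenSum' coeffJ z +
    evenSum' coeffL z, fun z => -(1 / z ^ 2) * (evenSum coeffJ z - 1) +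
      2 * (1 / z * evenSum' coeffJ z) + logTerm z * evenSum'' coeffJ z + evenSum'' coeffL z,
    remainderBound_of hδ0 hδ1 (fun z hz => ?_) (fun z hz => ?_) ?_ ?_⟩
  · exact ((hasDerivAt_logTerm hz).mul ((dJ z).sub_const 1)).add (dL z)
  · refine ((((dinv z hz).mul ((dJ z).sub_const 1)).add
      ((hasDerivAt_logTerm hz).mul (dJ' z))).add (dL' z)).congr_deriv ?_
    ring
  · obtain ⟨C₁, h₁, hC₁⟩ := exists_bound_evenSum abs_coeffJ_le
    obtain ⟨C₂, h₂, hC₂⟩ := exists_bound_evenSum abs_coeffL_le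
    rw [coeffJ_zero] at hC₁
    simp only [coeffL_zero, sub_zero] at hC₂
    refine ⟨3 * C₁ + 6 * K * C₁ + C₂, by positivity, fun z hz => ?_⟩
    have hz0 := hz.1
    obtain ⟨b1, b2, b3⟩ := hC₁ z hz
    obtain ⟨c1, c2, c3⟩ := hC₂ z hz
    have hz3 : 1 ≤ z⁻¹ := (one_le_inv₀ hz.1).2 hz.2
    have hl : |logTerm z| ≤ 6 * K * z⁻¹ := by
      have q1 := Real.rpow_le_rpow_of_exponent_ge hz.1 hz.2 (by norm_num : (-1 : ℝ) ≤ 1 / 2)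
      have q2 := Real.rpow_le_rpow_of_exponent_ge hz.1 hz.2 (by norm_num : (-1 : ℝ) ≤ -(1 / 2))
      rw [Real.rpow_neg_one] at q1 q2
      calc _ ≤ _ := hlog z hz.1
        _ ≤ 3 * K * (z⁻¹ + z⁻¹) := by gcongr
        _ = _ := by ring
    have hCz : C₂ * z ≤ C₂ := by nlinarith [hz.2]
    have hC1z : C₁ * z ≤ C₁ := by nlinarith [hz.2]
    have hzi : 0 ≤ z⁻¹ := by positivity
    refine ⟨?_, ?_, ?_⟩
    · calc _ ≤ |logTerm z| * |evenSum coeffJ z - 1| + |evenSum coeffL z| := by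
            rw [← abs_mul]; exact abs_add_le _ _
        _ ≤ 6 * K * z⁻¹ * (C₁ * z ^ 2) + C₂ * z ^ 2 := by gcongr
        _ = (6 * K * C₁ + C₂ * z) * z := by field_simp
        _ ≤ _ := by gcongr; linarith
    · calc _ ≤ |1 / z| * |evenSum coeffJ z - 1| + |logTerm z| * |evenSum' coeffJ z| +
            |evenSum' coeffL z| := by
            rw [← abs_mul, ← abs_mul]; exact abs_add_three _ _ _
        _ ≤ 1 / z * (C₁ * z ^ 2) + 6 * K * z⁻¹ * (C₁ * z) + C₂ * z := by
            rw [abs_of_pos (by positivity : 0 < 1 / z)]; gcongr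
        _ = C₁ * z + 6 * K * C₁ + C₂ * z := by field_simp
        _ ≤ _ := by linarith
    · calc _ ≤ |-(1 / z ^ 2)| * |evenSum coeffJ z - 1| + 2 * (|1 / z| * |evenSum' coeffJ z|) +
            |logTerm z| * |evenSum'' coeffJ z| + |evenSum'' coeffL z| := by
            rw [← abs_mul, ← abs_mul, ← abs_mul, ← abs_two (α := ℝ), ← abs_mul, abs_two]
            refine (abs_add_le _ _).trans (add_le_add_left (abs_add_three _ _ _) _)
        _ ≤ 1 / z ^ 2 * (C₁ * z ^ 2) + 2 * (1 / z * (C₁ * z)) + 6 * K * z⁻¹ * C₁ + C₂ := by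
            rw [abs_of_pos (by positivity : 0 < 1 / z), abs_neg,
              abs_of_pos (by positivity : 0 < 1 / z ^ 2)]
            gcongr
        _ = 3 * C₁ + 6 * K * C₁ * z⁻¹ + C₂ := by field_simp; ring
        _ ≤ 3 * C₁ * z⁻¹ + 6 * K * C₁ * z⁻¹ + C₂ * z⁻¹ := by
            have q1 : 3 * C₁ ≤ 3 * C₁ * z⁻¹ := le_mul_of_one_le_right (by positivity) hz3
            have q2 : C₂ ≤ C₂ * z⁻¹ := le_mul_of_one_le_right h₂ hz3
            linarith
        _ = _ := by ring
  · obtain ⟨C, h0, hC⟩ := bessel_decay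
      (y := fun z => logTerm z * evenSum coeffJ z + evenSum coeffL z)
      (y' := fun z => 1 / z * evenSum coeffJ z + logTerm z * evenSum' coeffJ z +
        evenSum' coeffL z)
      (y'' := fun z => -(1 / z ^ 2) * evenSum coeffJ z + 2 * (1 / z * evenSum' coeffJ z) +
        logTerm z * evenSum'' coeffJ z + evenSum'' coeffL z)
      (fun z hz => ((hasDerivAt_logTerm hz).mul (dJ z)).add (dL z))
      (fun z hz => by
        refine ((((dinv z hz).mul (dJ z)).add
          ((hasDerivAt_logTerm hz).mul (dJ' z))).add (dL' z)).congr_deriv ?_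
        ring)
      (fun z hz => by
        have h1 := evenSum_J_ode hz
        have h2 := powerSum_L_ode ((z / 2) ^ 2)
        have h3 : 2 * (1 / z * evenSum' coeffJ z) + evenSum'' coeffL z + evenSum' coeffL z / z +
            evenSum coeffL z = 0 := by
          rw [← h2, evenSum, evenSum', evenSum'', evenSum']
          field_simp
          ring
        have e : 1 / z * evenSum coeffJ z / z = 1 / z ^ 2 * evenSum coeffJ z := by
          field_simp
        simp only [add_div]
        linear_combination logTerm z * h1 + h3 + e)
    refine ⟨C + 6 * K + 1, by positivity, fun z hz => ?_⟩
    have hz0 : 0 < z := by linarith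
    obtain ⟨b1, b2, b3⟩ := hC z hz
    have p0 := Real.rpow_nonneg hz0.le (-(1 / 2) : ℝ)
    have p1 := Real.one_le_rpow hz (by norm_num : (0 : ℝ) ≤ 1 / 2)
    have p2 := Real.rpow_le_rpow_of_exponent_le hz (by norm_num : (-(1 / 2) : ℝ) ≤ 1 / 2)
    have p3 := Real.rpow_le_rpow_of_exponent_le hz (by norm_num : (-1 : ℝ) ≤ -(1 / 2))
    have p4 := Real.rpow_le_rpow_of_exponent_le hz (by norm_num : (-2 : ℝ) ≤ -(1 / 2))
    have e3 : z ^ (-1 : ℝ) = 1 / z := by rw [Real.rpow_neg_one, one_div]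
    have e4 : z ^ (-2 : ℝ) = 1 / z ^ 2 := by rw [Real.rpow_neg hz0.le, Real.rpow_two, one_div]
    rw [e3] at p3
    rw [e4] at p4
    have hl : |logTerm z| ≤ 6 * K * z ^ (1 / 2 : ℝ) :=
      (hlog z hz0).trans (by nlinarith)
    have hKp : 0 ≤ 6 * K * z ^ (-(1 / 2) : ℝ) := by positivity
    refine ⟨?_, ?_, ?_⟩
    · calc _ = |(logTerm z * evenSum coeffJ z + evenSum coeffL z) - logTerm z| := by
            congr 1; ring
        _ ≤ |logTerm z * evenSum coeffJ z + evenSum coeffL z| + |logTerm z| := abs_sub _ _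
        _ ≤ C * z ^ (1 / 2 : ℝ) + 6 * K * z ^ (1 / 2 : ℝ) :=
            add_le_add (b1.trans (mul_le_mul_of_nonneg_left p2 h0)) hl
        _ ≤ _ := by linarith
    · calc _ = |(1 / z * evenSum coeffJ z + logTerm z * evenSum' coeffJ z +
            evenSum' coeffL z) - 1 / z| := by congr 1; ring
        _ ≤ _ + |1 / z| := abs_sub _ _
        _ ≤ C * z ^ (-(1 / 2) : ℝ) + z ^ (-(1 / 2) : ℝ) := by
            rw [abs_of_pos (by positivity : 0 < 1 / z)]; exact add_le_add b2 p3
        _ ≤ _ := by linarith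
    · calc _ = |(-(1 / z ^ 2) * evenSum coeffJ z + 2 * (1 / z * evenSum' coeffJ z) +
            logTerm z * evenSum'' coeffJ z + evenSum'' coeffL z) + 1 / z ^ 2| := by
            congr 1; ring
        _ ≤ _ + |1 / z ^ 2| := abs_add_le _ _
        _ ≤ C * z ^ (-(1 / 2) : ℝ) + z ^ (-(1 / 2) : ℝ) := by
            rw [abs_of_pos (by positivity : 0 < 1 / z ^ 2)]; exact add_le_add b3 p4
        _ ≤ _ := by linarith

/-! ### The resolvent kernel as a function of the spectral parameter -/

/-- Interpolation: min(1, t) ≤ t^α for 0 ≤ α ≤ 1. -/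
theorem le_mul_rpow_of_le {X A t α : ℝ} (hα0 : 0 ≤ α) (hα1 : α ≤ 1) (hA : 0 ≤ A) (ht : 0 ≤ t)
    (h1 : X ≤ A) (h2 : X ≤ A * t) : X ≤ A * t ^ α := by
  rcases le_total t 1 with h | h
  · refine h2.trans (mul_le_mul_of_nonneg_left ?_ hA)
    simpa using Real.rpow_le_rpow_of_exponent_ge_of_imp ht h hα1 (fun h => by
      intro h'; simp_all)
  · exact h1.trans (le_mul_of_one_le_right hA (Real.one_le_rpow h hα0))

/-- Scaling by r produces r^(1/2+δ). The Hölder bound interpolates between the bound on f' and the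
mean value bound from f''; the latter is worse by (1 + r)(b - l)/l, so the power α of this factor
adds α to the exponent of the weight. -/
theorem RemainderBound.holderSymbol {δ α : ℝ} (hδ0 : 0 ≤ δ) (hδ1 : δ ≤ 1 / 2) (hα0 : 0 ≤ α)
    (hα1 : α ≤ 1) {f f' f'' : ℝ → ℝ} (hf : RemainderBound δ f f' f'') :
    ∃ C, 0 ≤ C ∧ ∀ r, 0 < r →
      HolderSymbol α (1 / 2 + δ) 1 (fun l => f (l * r)) (C * (1 + r) ^ (1 / 2 + δ + α)) := by
  obtain ⟨C, hC0, hC⟩ := hf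
  refine ⟨2 * C, by positivity, fun r hr => ?_⟩
  have hr1 : 0 < 1 + r := by linarith
  have hω : r ^ (1 / 2 + δ) * (1 + r) ^ α ≤ (1 + r) ^ (1 / 2 + δ + α) := by
    rw [Real.rpow_add hr1]
    gcongr
    linarith
  have h1α : 1 ≤ (1 + r) ^ α := Real.one_le_rpow (by linarith) hα0
  have hrp := Real.rpow_nonneg hr.le (1 / 2 + δ)
  have hω' : r ^ (1 / 2 + δ) ≤ (1 + r) ^ (1 / 2 + δ + α) :=
    (le_mul_of_one_le_right hrp h1α).trans hω
  have hω0 := Real.rpow_nonneg hr1.le (1 / 2 + δ + α)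
  have hA : ∀ l : ℝ, 0 < l → r * (l * r) ^ (δ - 1 / 2) = r ^ (1 / 2 + δ) * l ^ (δ - 1 / 2) := by
    intro l hl
    rw [Real.mul_rpow hl.le hr.le, show 1 / 2 + δ = δ - 1 / 2 + 1 by ring,
      Real.rpow_add_one hr.ne']
    ring
  refine HolderSymbol.of_hasDerivAt (f' := fun l => r * f' (l * r))
    (fun l hl => ?_) (fun l hl => ?_) (fun l hl => ?_) (fun l hl b hb hlb hb2 => ?_)
  · have := (hC _ (mul_pos hl.1 hr)).1.comp l ((hasDerivAt_id l).mul_const r)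
    simpa [Function.comp_def, mul_comm] using this
  · have hl0 := Real.rpow_nonneg hl.1.le (1 / 2 + δ)
    have h := (hC _ (mul_pos hl.1 hr)).2.2.1
    rw [Real.mul_rpow hl.1.le hr.le] at h
    rw [Real.norm_eq_abs]
    calc |f (l * r)| ≤ C * (l ^ (1 / 2 + δ) * r ^ (1 / 2 + δ)) := h
      _ ≤ C * (l ^ (1 / 2 + δ) * (1 + r) ^ (1 / 2 + δ + α)) := by gcongr
      _ = C * (1 + r) ^ (1 / 2 + δ + α) * l ^ (1 / 2 + δ) := by ring
      _ ≤ _ := by gcongr; linarith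
  · have hl0 := Real.rpow_nonneg hl.1.le (δ - 1 / 2)
    have h := (hC _ (mul_pos hl.1 hr)).2.2.2.1
    rw [norm_mul, Real.norm_eq_abs, Real.norm_eq_abs, abs_of_pos hr,
      show 1 / 2 + δ - 1 = δ - 1 / 2 by ring]
    calc r * |f' (l * r)| ≤ r * (C * (l * r) ^ (δ - 1 / 2)) := by gcongr
      _ = C * (r * (l * r) ^ (δ - 1 / 2)) := by ring
      _ = C * (r ^ (1 / 2 + δ) * l ^ (δ - 1 / 2)) := by rw [hA l hl.1]
      _ ≤ C * ((1 + r) ^ (1 / 2 + δ + α) * l ^ (δ - 1 / 2)) := by gcongr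
      _ = C * (1 + r) ^ (1 / 2 + δ + α) * l ^ (δ - 1 / 2) := by ring
      _ ≤ _ := by gcongr; linarith
  · have hl0 := hl.1
    have hb0 := hb.1
    have hlr := mul_pos hl.1 hr
    have hbr := mul_pos hb.1 hr
    have hbl : 0 < b - l := by linarith
    set A := r ^ (1 / 2 + δ) * l ^ (δ - 1 / 2) with hAdef
    have hA0 : 0 ≤ A := by positivity
    have hbd : ∀ s, l ≤ s → |f' (s * r)| ≤ C * (l * r) ^ (δ - 1 / 2) := fun s hs => by
      refine (hC _ (mul_pos (hl0.trans_le hs) hr)).2.2.2.1.trans (mul_le_mul_of_nonneg_left ?_ hC0)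
      exact Real.rpow_le_rpow_of_nonpos hlr (by gcongr) (by linarith)
    have hX1 : r * |f' (b * r) - f' (l * r)| ≤ 2 * C * A := by
      calc r * |f' (b * r) - f' (l * r)| ≤ r * (|f' (b * r)| + |f' (l * r)|) := by
            gcongr; exact abs_sub _ _
        _ ≤ r * (C * (l * r) ^ (δ - 1 / 2) + C * (l * r) ^ (δ - 1 / 2)) := by
            gcongr
            · exact hbd b hlb.le
            · exact hbd l le_rfl
        _ = 2 * C * (r * (l * r) ^ (δ - 1 / 2)) := by ring
        _ = _ := by rw [hA l hl0]
    have hX2 : r * |f' (b * r) - f' (l * r)| ≤ 2 * C * A * ((b - l) / l * (1 + r)) := by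
      have hmv := Convex.norm_image_sub_le_of_norm_hasDerivWithin_le (f := f') (f' := f'')
        (C := C * ((l * r) ^ (δ - 3 / 2) * (2 * (1 + r)))) (s := Icc (l * r) (b * r))
        (fun x hx => (hC x (hlr.trans_le hx.1)).2.1.hasDerivWithinAt)
        (fun x hx => by
          have hx0 := hlr.trans_le hx.1
          refine (hC x hx0).2.2.2.2.trans (mul_le_mul_of_nonneg_left (mul_le_mul
            (Real.rpow_le_rpow_of_nonpos hlr hx.1 (by linarith)) ?_ (by linarith)
            (Real.rpow_nonneg hlr.le _)) hC0)
          have : b * r ≤ 1 * r := mul_le_mul_of_nonneg_right hb.2.le hr.le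
          linarith [hx.2]) (convex_Icc _ _)
        (left_mem_Icc.2 (by gcongr)) (right_mem_Icc.2 (by gcongr))
      rw [Real.norm_eq_abs, Real.norm_eq_abs, ← sub_mul, abs_of_pos (mul_pos hbl hr)] at hmv
      have e : (l * r) ^ (δ - 1 / 2) = (l * r) ^ (δ - 3 / 2) * (l * r) := by
        rw [← Real.rpow_add_one hlr.ne']; congr 1; ring
      calc r * |f' (b * r) - f' (l * r)|
          ≤ r * (C * ((l * r) ^ (δ - 3 / 2) * (2 * (1 + r))) * ((b - l) * r)) := by gcongr
        _ = 2 * C * (r * ((l * r) ^ (δ - 3 / 2) * (l * r))) * ((b - l) / l * (1 + r)) := by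
            field_simp
        _ = _ := by rw [← e, hA l hl0]
    have hX := le_mul_rpow_of_le hα0 hα1 (by positivity : 0 ≤ 2 * C * A) (by positivity) hX1 hX2
    rw [← mul_sub, norm_mul, Real.norm_eq_abs, Real.norm_eq_abs, abs_of_pos hr]
    refine hX.trans ?_
    have e2 : ((b - l) / l * (1 + r)) ^ α = (b - l) ^ α * l ^ (-α) * (1 + r) ^ α := by
      rw [Real.mul_rpow (by positivity) hr1.le, Real.div_rpow hbl.le hl0.le, Real.rpow_neg hl0.le,
        div_eq_mul_inv]
    have e3 : l ^ (1 / 2 + δ - 1 - α) = l ^ (δ - 1 / 2) * l ^ (-α) := by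
      rw [← Real.rpow_add hl0]; congr 1; ring
    rw [e2, e3, hAdef]
    have q1 := Real.rpow_nonneg hbl.le α
    have q2 := Real.rpow_nonneg hl0.le (-α)
    have q3 := Real.rpow_nonneg hl0.le (δ - 1 / 2)
    calc _ = 2 * C * (r ^ (1 / 2 + δ) * (1 + r) ^ α) *
          (l ^ (δ - 1 / 2) * l ^ (-α)) * (b - l) ^ α := by ring
      _ ≤ _ := by gcongr

/-- The remainder of the resolvent kernel. -/
def resolventRem (σ : ℤˣ) (l r : ℝ) : ℂ :=
  sgn σ * (Complex.I / 4) * ((evenSum coeffJ (l * r) - 1 : ℝ) : ℂ) -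
    1 / (2 * Real.pi) * ((logTerm (l * r) * (evenSum coeffJ (l * r) - 1) +
      evenSum coeffL (l * r) : ℝ) : ℂ)

/-- The constant term of the resolvent kernel. -/
def resolventConst (σ : ℤˣ) (l : ℝ) : ℂ :=
  sgn σ * (Complex.I / 4) -
    ((1 / (2 * Real.pi) * Real.log (l / 2) + Real.eulerMascheroniConstant / (2 * Real.pi) : ℝ) : ℂ)

theorem sgn_mul_sgn (σ : ℤˣ) : sgn σ * sgn σ = 1 := by
  rcases Int.units_eq_one_or σ with rfl | rfl <;> simp [sgn]

theorem norm_sgn (σ : ℤˣ) : ‖sgn σ‖ = 1 := by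
  rcases Int.units_eq_one_or σ with rfl | rfl <;> simp [sgn]

/-- Write log(λr/2) = log(λ/2) + log r and J₀ = 1 + (J₀ - 1). The sign occurs twice in front of Y₀,
so the logarithms are the same for both signs. -/
theorem freeResolvent_eq (σ : ℤˣ) {l : ℝ} (hl : 0 < l) {x y : Plane} (hxy : x ≠ y) :
    freeResolvent σ l x y =
      resolventConst σ l + G0 x y + resolventRem σ l ‖x - y‖ := by
  have hr : 0 < ‖x - y‖ := norm_pos_iff.2 (sub_ne_zero.2 hxy)
  have hlog : logTerm (l * ‖x - y‖) = Real.log (l / 2) + Real.log ‖x - y‖ +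
      Real.eulerMascheroniConstant := by
    rw [logTerm, ← Real.log_mul (by positivity) hr.ne']
    congr 2; ring
  have hpi : (Real.pi : ℂ) ≠ 0 := by exact_mod_cast Real.pi_ne_zero
  rw [freeResolvent, hankel0, besselJ0_eq, besselY0_eq, resolventConst, G0, resolventRem, hlog]
  push_cast
  field_simp
  ring_nf
  simp only [Complex.I_sq, pow_two (sgn σ), sgn_mul_sgn]
  ring

/-- The weight of the resolvent kernel as a function of the distance. -/
def resolventWeight (s r : ℝ) : ℝ := (1 + r) ^ s + r ^ (-(1 / 2) : ℝ)

theorem HolderSymbol.ofReal_mul {α p l₀ a : ℝ} {f : ℝ → ℝ} (h : HolderSymbol α p l₀ f a) (c : ℂ) :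
    HolderSymbol α p l₀ (fun l => c * (f l : ℂ)) (‖c‖ * a) :=
  h.map_of (norm_nonneg c) (fun x : ℝ => c * (x : ℂ)) (fun x y => by push_cast; ring)
    (fun x => by simp) fun _ _ hf => (hf.ofReal_comp).const_mul c

theorem exists_resolventRem_symbol {δ α : ℝ} (hδ0 : 0 ≤ δ) (hδ1 : δ ≤ 1 / 2) (hα0 : 0 ≤ α)
    (hα1 : α ≤ 1) : ∃ C, 0 ≤ C ∧ ∀ σ r, 0 < r →
      HolderSymbol α (1 / 2 + δ) 1 (fun l => resolventRem σ l r)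
        (C * resolventWeight (1 / 2 + δ + α) r) := by
  obtain ⟨_, _, h₁⟩ := exists_remainderBound_J hδ0 hδ1
  obtain ⟨_, _, h₂⟩ := exists_remainderBound_Y hδ0 hδ1
  obtain ⟨C₁, hC₁, H₁⟩ := h₁.holderSymbol hδ0 hδ1 hα0 hα1
  obtain ⟨C₂, hC₂, H₂⟩ := h₂.holderSymbol hδ0 hδ1 hα0 hα1
  set K := ‖(-(1 / (2 * Real.pi)) : ℂ)‖
  refine ⟨C₁ + K * C₂, by positivity, fun σ r hr => ?_⟩
  have h := ((H₁ r hr).ofReal_mul (sgn σ * (Complex.I / 4))).add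
    ((H₂ r hr).ofReal_mul (-(1 / (2 * Real.pi))))
  refine (h.congr fun l _ => ?_).mono_const ?_
  · rw [resolventRem]; ring
  · have hw : (1 + r) ^ (1 / 2 + δ + α) ≤ resolventWeight (1 / 2 + δ + α) r := by
      have := Real.rpow_nonneg hr.le (-(1 / 2))
      rw [resolventWeight]; linarith
    have hs : ‖sgn σ * (Complex.I / 4)‖ ≤ 1 := by
      rw [norm_mul, norm_sgn, norm_div, Complex.norm_I]; norm_num
    have hw0 := Real.rpow_nonneg (by linarith : 0 ≤ 1 + r) (1 / 2 + δ + α)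
    calc _ ≤ 1 * (C₁ * (1 + r) ^ (1 / 2 + δ + α)) + K * (C₂ * (1 + r) ^ (1 / 2 + δ + α)) := by
          gcongr
      _ = (C₁ + K * C₂) * (1 + r) ^ (1 / 2 + δ + α) := by ring
      _ ≤ _ := by gcongr

theorem HolderSymbol.const {E : Type*} [NormedAddCommGroup E] [NormedSpace ℝ E] {α p : ℝ}
    (hp : p ≤ 0) (c : E) : HolderSymbol α p 1 (fun _ => c) ‖c‖ := by
  refine of_hasDerivAt (fun l _ => hasDerivAt_const l c) (fun l hl => ?_) (fun l hl => ?_)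
    (fun l hl b hb h1 h2 => ?_)
  · exact le_mul_of_one_le_right (norm_nonneg _)
      (Real.one_le_rpow_of_pos_of_le_one_of_nonpos hl.1 hl.2.le hp)
  · have := Real.rpow_nonneg hl.1.le (p - 1)
    rw [norm_zero]; positivity
  · have := Real.rpow_nonneg hl.1.le (p - 1 - α)
    have := Real.rpow_nonneg (sub_pos.2 h1).le α
    rw [sub_self, norm_zero]; positivity

/-- The logarithm has every negative exponent, with a constant that blows up as p tends to 0. This
is the source of the loss d in the exponents. -/
theorem HolderSymbol.log {α p : ℝ} (hα1 : α ≤ 1) (hp : p < 0) :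
    HolderSymbol α p 1 Real.log (1 + 1 / (-p)) := by
  have hp' : 0 < 1 / (-p) := by have : 0 < -p := by linarith
                                positivity
  refine of_hasDerivAt (fun l hl => Real.hasDerivAt_log hl.1.ne') (fun l hl => ?_) (fun l hl => ?_)
    (fun l hl b hb h1 h2 => ?_)
  · have h0 := Real.rpow_nonneg hl.1.le p
    have := Real.log_le_rpow_div (inv_nonneg.2 hl.1.le) (by linarith : 0 < -p)
    rw [Real.log_inv, Real.inv_rpow hl.1.le, ← Real.rpow_neg hl.1.le, neg_neg] at this
    rw [Real.norm_eq_abs, abs_of_nonpos (Real.log_nonpos hl.1.le hl.2.le)]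
    calc _ ≤ l ^ p / -p := this
      _ = 1 / (-p) * l ^ p := by ring
      _ ≤ _ := by gcongr; linarith
  · have := Real.rpow_le_rpow_of_exponent_ge hl.1 hl.2.le (by linarith : p - 1 ≤ -1)
    rw [Real.rpow_neg_one] at this
    have h0 := Real.rpow_nonneg hl.1.le (p - 1)
    rw [Real.norm_eq_abs, abs_of_pos (inv_pos.2 hl.1)]
    nlinarith
  · have hl0 := hl.1
    have hb0 := hb.1
    have hbl : 0 < b - l := by linarith
    have e : b⁻¹ - l⁻¹ = -((b - l) / (l * b)) := by field_simp; ring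
    rw [e, norm_neg, Real.norm_of_nonneg (by positivity)]
    have q := Real.rpow_nonneg hbl.le α
    have h0 := Real.rpow_nonneg hl0.le (p - 1 - α)
    have h3 := Real.rpow_le_rpow_of_exponent_ge hl.1 hl.2.le (by linarith : p - 1 - α ≤ -1 - α)
    have e2 : l ^ (-1 - α) = l ^ (1 - α) * (l ^ 2)⁻¹ := by
      rw [← Real.rpow_two, ← Real.rpow_neg hl0.le, ← Real.rpow_add hl0]; congr 1; ring
    calc (b - l) / (l * b) ≤ (b - l) / (l * l) := by gcongr
      _ = (b - l) * (l ^ 2)⁻¹ := by rw [pow_two, div_eq_mul_inv]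
      _ ≤ l ^ (1 - α) * (b - l) ^ α * (l ^ 2)⁻¹ := by
          gcongr; exact sub_le_rpow_mul_rpow hα1 h1 h2
      _ = l ^ (-1 - α) * (b - l) ^ α := by rw [e2]; ring
      _ ≤ l ^ (p - 1 - α) * (b - l) ^ α := by gcongr
      _ ≤ _ := by
        have : 0 ≤ 1 / (-p) * (l ^ (p - 1 - α) * (b - l) ^ α) := by positivity
        linarith

/-- The logarithm of r in `G0` is covered by r^(-1/2) near 0, and by (1+r)^s at infinity since s ≥
1/2. -/
theorem exists_resolventConst_symbol {s α p : ℝ} (hs : 1 / 2 ≤ s) (hα1 : α ≤ 1) (hp : p < 0) :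
    ∃ C, 0 ≤ C ∧ ∀ σ (x y : Plane), x ≠ y →
      HolderSymbol α p 1 (fun l => resolventConst σ l + G0 x y)
        (C * resolventWeight s ‖x - y‖) := by
  set c : ℝ := 1 / (2 * Real.pi) with hc
  have hc0 : 0 < c := by positivity
  set K₀ : ℂ := ((-c * (-Real.log 2 + Real.eulerMascheroniConstant) : ℝ) : ℂ) with hK₀
  obtain ⟨K, hK0, hK⟩ := exists_bound_log 0
  refine ⟨1 + ‖K₀‖ + 6 * c * K + ‖(-c : ℂ)‖ * (1 + 1 / (-p)), ?_, fun σ x y hxy => ?_⟩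
  · have hp' : 0 < 1 / (-p) := by have : 0 < -p := by linarith
                                  positivity
    positivity
  have hr : 0 < ‖x - y‖ := norm_pos_iff.2 (sub_ne_zero.2 hxy)
  set r := ‖x - y‖ with hrdef
  have hlog := (HolderSymbol.log hα1 hp).ofReal_mul (-c)
  have hconst := HolderSymbol.const (α := α) hp.le (sgn σ * (Complex.I / 4) + K₀ + G0 x y)
  refine ((hconst.add hlog).congr fun l hl => ?_).mono_const ?_
  · rw [resolventConst, Real.log_div hl.1.ne' two_ne_zero, hK₀, hc]
    push_cast
    ring
  · have hw1 : 1 ≤ (1 + r) ^ s := Real.one_le_rpow (by linarith) (by linarith)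
    have hm := Real.rpow_nonneg hr.le (-(1 / 2))
    have hw : 1 ≤ resolventWeight s r := by rw [resolventWeight]; linarith
    have hG : ‖G0 x y‖ ≤ 6 * c * K * resolventWeight s r := by
      have h1 := hK r hr (1 / 2) (by norm_num)
      rw [add_zero] at h1
      have h2 : r ^ (1 / 2 : ℝ) ≤ (1 + r) ^ s :=
        (Real.rpow_le_rpow hr.le (by linarith) (by norm_num)).trans
          (Real.rpow_le_rpow_of_exponent_le (by linarith) hs)
      rw [G0, Complex.norm_real, norm_mul, Real.norm_eq_abs, Real.norm_eq_abs, abs_neg,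
        abs_of_pos hc0]
      calc c * |Real.log r| ≤ c * (K * (1 + 1 / (1 / 2)) *
            (r ^ (1 / 2 : ℝ) + r ^ (-(1 / 2) : ℝ))) := by gcongr
        _ = 3 * c * K * (r ^ (1 / 2 : ℝ) + r ^ (-(1 / 2) : ℝ)) := by ring
        _ ≤ 6 * c * K * resolventWeight s r := by
          rw [resolventWeight]
          gcongr
          norm_num
    have hs1 : ‖sgn σ * (Complex.I / 4)‖ ≤ 1 := by
      rw [norm_mul, norm_sgn, norm_div, Complex.norm_I]; norm_num
    have hp' : 0 < 1 / (-p) := by have : 0 < -p := by linarith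
                                  positivity
    have h3 : ‖sgn σ * (Complex.I / 4) + K₀ + G0 x y‖ ≤
        1 + ‖K₀‖ + 6 * c * K * resolventWeight s r :=
      (norm_add₃_le).trans (by gcongr)
    have h4 : 0 ≤ 1 + ‖K₀‖ + ‖(-c : ℂ)‖ * (1 + 1 / (-p)) := by positivity
    have h5 := mul_le_mul_of_nonneg_left hw h4
    linarith

section

/-! ### The dominating kernel -/

theorem measurable_v {V : Plane → ℝ} (hV : Measurable V) : Measurable (v V) :=
  Real.continuous_sqrt.measurable.comp hV.abs

theorem v_nonneg (V : Plane → ℝ) (x : Plane) : 0 ≤ v V x := Real.sqrt_nonneg _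

theorem v_sq (V : Plane → ℝ) (x : Plane) : v V x ^ 2 = |V x| := Real.sq_sqrt (abs_nonneg _)

/-- The decay assumption of the theorem. -/
def Decays (V : Plane → ℝ) (α ε : ℝ) : Prop :=
  ∃ C : ℝ, ∀ᵐ x : Plane, v V x ≤ C * Real.sqrt (1 + ‖x‖ ^ 2) ^ (-(3 / 2) - α - ε)

variable {V : Plane → ℝ} {α ε δ : ℝ}

theorem Decays.exists_le (h : Decays V α ε) (hα : 0 ≤ α) (hε : 0 ≤ ε) :
    ∃ C, 0 ≤ C ∧ ∀ᵐ x : Plane, v V x ≤ C * (1 + ‖x‖) ^ (-(3 / 2 + α + ε)) := by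
  obtain ⟨C, hC⟩ := h
  refine ⟨|C| * 2 ^ (3 / 2 + α + ε), by positivity, ?_⟩
  filter_upwards [hC] with x hx
  have h1 : (1 + ‖x‖) / 2 ≤ Real.sqrt (1 + ‖x‖ ^ 2) := by
    refine Real.le_sqrt_of_sq_le ?_
    nlinarith [norm_nonneg x, sq_nonneg (‖x‖ - 1)]
  have h2 : 0 < (1 + ‖x‖) / 2 := by positivity
  have h3 := Real.rpow_le_rpow_of_nonpos h2 h1 (by linarith : -(3 / 2 + α + ε) ≤ 0)
  have h4 : ((1 + ‖x‖) / 2) ^ (-(3 / 2 + α + ε)) =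
      2 ^ (3 / 2 + α + ε) * (1 + ‖x‖) ^ (-(3 / 2 + α + ε)) := by
    rw [Real.div_rpow (by positivity) (by norm_num), Real.rpow_neg (by norm_num : (0 : ℝ) ≤ 2),
      div_inv_eq_mul, mul_comm]
  rw [show -(3 / 2) - α - ε = -(3 / 2 + α + ε) by ring] at hx
  calc v V x ≤ C * Real.sqrt (1 + ‖x‖ ^ 2) ^ (-(3 / 2 + α + ε)) := hx
    _ ≤ |C| * Real.sqrt (1 + ‖x‖ ^ 2) ^ (-(3 / 2 + α + ε)) := by gcongr; exact le_abs_self C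
    _ ≤ |C| * ((1 + ‖x‖) / 2) ^ (-(3 / 2 + α + ε)) := by gcongr
    _ = _ := by rw [h4]; ring

theorem Decays.exists_bound (h : Decays V α ε) (hα : 0 ≤ α) (hε : 0 ≤ ε) :
    ∃ C, 0 ≤ C ∧ ∀ᵐ x : Plane, v V x ^ 2 ≤ C := by
  obtain ⟨C, hC0, hC⟩ := h.exists_le hα hε
  refine ⟨C ^ 2, by positivity, ?_⟩
  filter_upwards [hC] with x hx
  have h1 : (1 + ‖x‖) ^ (-(3 / 2 + α + ε)) ≤ 1 :=
    Real.rpow_le_one_of_one_le_of_nonpos (by linarith [norm_nonneg x]) (by linarith)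
  exact pow_le_pow_left₀ (v_nonneg V x) (hx.trans (by nlinarith)) 2

/-- The exponents add up to -2(3/2+α+ε) + 2(1/2+δ+α) = -2 - 2(ε-δ), below minus the dimension. -/
theorem Decays.integrable (hV : Measurable V) (h : Decays V α ε) (hα : 0 ≤ α) (hε : 0 ≤ ε)
    (hδ : δ < ε) : Integrable fun x => v V x ^ 2 * (1 + ‖x‖) ^ (2 * (1 / 2 + δ + α)) := by
  obtain ⟨C, hC0, hC⟩ := h.exists_le hα hε
  have h2 : (Module.finrank ℝ Plane : ℝ) < 2 + 2 * (ε - δ) := by simp; linarith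
  refine ((integrable_one_add_norm h2).const_mul (C ^ 2)).mono' ?_ ?_
  · exact (((measurable_v hV).pow_const 2).mul
      ((measurable_const.add measurable_norm).pow_const _)).aestronglyMeasurable
  · filter_upwards [hC] with x hx
    have h0 : 0 < 1 + ‖x‖ := by positivity
    rw [Real.norm_of_nonneg (by positivity)]
    calc v V x ^ 2 * (1 + ‖x‖) ^ (2 * (1 / 2 + δ + α))
        ≤ (C * (1 + ‖x‖) ^ (-(3 / 2 + α + ε))) ^ 2 * (1 + ‖x‖) ^ (2 * (1 / 2 + δ + α)) := by
          gcongr; exact v_nonneg V x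
      _ = C ^ 2 * ((1 + ‖x‖) ^ (-(3 / 2 + α + ε)) * (1 + ‖x‖) ^ (-(3 / 2 + α + ε)) *
            (1 + ‖x‖) ^ (2 * (1 / 2 + δ + α))) := by ring
      _ = _ := by rw [← Real.rpow_add h0, ← Real.rpow_add h0]; congr 2; ring

theorem integrable_inv_norm_ball :
    Integrable ((Metric.ball (0 : Plane) 1).indicator fun z => ‖z‖⁻¹) := by
  rw [integrable_indicator_iff measurableSet_ball]
  refine integrableOn_ball_of_norm_le_rpow (C := 1) (α := 1) (by simp) (by simp) ?_
    measurable_norm.inv.aestronglyMeasurable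
  exact Filter.Eventually.of_forall fun x => by
    rw [norm_inv, norm_norm, Real.rpow_neg_one, one_mul]

/-- The kernel that dominates all the resolvent kernels. -/
def weightK (V : Plane → ℝ) (s : ℝ) (x y : Plane) : ℝ :=
  v V x * resolventWeight s ‖x - y‖ * v V y

theorem weightK_nonneg (V : Plane → ℝ) (s : ℝ) (x y : Plane) : 0 ≤ weightK V s x y := by
  have h1 := v_nonneg V x
  have h2 := v_nonneg V y
  rw [weightK, resolventWeight]; positivity

theorem weightK_comm (V : Plane → ℝ) (s : ℝ) (x y : Plane) : weightK V s x y = weightK V s y x := by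
  rw [weightK, weightK, norm_sub_rev]; ring

theorem measurable_weightK (hV : Measurable V) (s : ℝ) :
    Measurable fun p : Plane × Plane => weightK V s p.1 p.2 := by
  have hn : Measurable fun p : Plane × Plane => ‖p.1 - p.2‖ :=
    (measurable_fst.sub measurable_snd).norm
  exact (((measurable_v hV).comp measurable_fst).mul
    (((measurable_const.add hn).pow_const _).add (hn.pow_const _))).mul
    ((measurable_v hV).comp measurable_snd)

/-- In the square of the weight, the growth separates by 1+|x-y| ≤ (1+|x|)(1+|y|), each factor being
absorbed by the decay of v. The singularity 1/|x-y| is at most 1 plus its restriction to the unit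
ball, which is integrable in the plane; with v(x)² bounded, the rest is the integrand of a
convolution of two L¹ functions. -/
theorem Decays.memLp_weightK (hV : Measurable V) (h : Decays V α ε) (hα : 0 ≤ α) (hε : 0 ≤ ε)
    (hδ0 : 0 ≤ δ) (hδ : δ < ε) :
    MemLp (fun p : Plane × Plane => weightK V (1 / 2 + δ + α) p.1 p.2) 2 volume := by
  set s := 1 / 2 + δ + α with hs
  have hs0 : 0 ≤ s := by positivity
  refine (memLp_two_iff_integrable_sq (measurable_weightK hV s).aestronglyMeasurable).2 ?_
  have ha := h.integrable hV hα hε hδ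
  obtain ⟨C, hC0, hC⟩ := h.exists_bound hα hε
  have hm : Measurable fun x => v V x ^ 2 := (measurable_v hV).pow_const 2
  have hale : ∀ x, v V x ^ 2 ≤ v V x ^ 2 * (1 + ‖x‖) ^ (2 * s) := fun x =>
    le_mul_of_one_le_right (by positivity)
      (Real.one_le_rpow (by linarith [norm_nonneg x]) (by positivity))
  have hv : Integrable fun x => v V x ^ 2 :=
    ha.mono' hm.aestronglyMeasurable (Filter.Eventually.of_forall fun x => by
      rw [Real.norm_of_nonneg (by positivity)]; exact hale x)
  have hconv := hv.convolution_integrand (ContinuousLinearMap.mul ℝ ℝ) integrable_inv_norm_ball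
  have haa := ha.mul_prod ha
  refine ((haa.const_mul 4).add (hconv.const_mul (2 * C))).mono'
    ((measurable_weightK hV s).pow_const 2).aestronglyMeasurable ?_
  have hCp : ∀ᵐ p : Plane × Plane, v V p.1 ^ 2 ≤ C :=
    Measure.quasiMeasurePreserving_fst.ae hC
  filter_upwards [hCp] with p hp
  set x := p.1
  set y := p.2
  set r := ‖x - y‖ with hr
  have hr0 : 0 ≤ r := norm_nonneg _
  set H := (Metric.ball (0 : Plane) 1).indicator (fun z => ‖z‖⁻¹) (x - y) with hH
  have hH0 : 0 ≤ H := indicator_nonneg (fun z _ => by positivity) _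
  have hinv : r⁻¹ ≤ 1 + H := by
    by_cases hb : x - y ∈ Metric.ball (0 : Plane) 1
    · rw [hH, indicator_of_mem hb]; linarith
    · have h1 : 1 ≤ r := by simpa using hb
      have := inv_le_one_of_one_le₀ h1
      linarith
  have hsq : (r ^ (-(1 / 2) : ℝ)) ^ 2 = r⁻¹ := by
    rw [← Real.rpow_natCast, ← Real.rpow_mul hr0, ← Real.rpow_neg_one]; congr 1; norm_num
  have hsq2 : ((1 + r) ^ s) ^ 2 ≤ (1 + ‖x‖) ^ (2 * s) * (1 + ‖y‖) ^ (2 * s) := by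
    rw [← Real.rpow_natCast, ← Real.rpow_mul (by positivity),
      ← Real.mul_rpow (by positivity) (by positivity), mul_comm s]
    refine Real.rpow_le_rpow (by positivity) ?_ (by positivity)
    have : r ≤ ‖x‖ + ‖y‖ := norm_sub_le _ _
    nlinarith [norm_nonneg x, norm_nonneg y, mul_nonneg (norm_nonneg x) (norm_nonneg y)]
  set a := v V x ^ 2 * (1 + ‖x‖) ^ (2 * s)
  set b := v V y ^ 2 * (1 + ‖y‖) ^ (2 * s)
  have hva : v V x ^ 2 * v V y ^ 2 ≤ a * b :=
    mul_le_mul (hale x) (hale y) (by positivity) (by positivity)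
  rw [Real.norm_of_nonneg (by positivity)]
  have e1 : weightK V s x y ^ 2 = v V x ^ 2 * v V y ^ 2 * resolventWeight s r ^ 2 := by
    rw [weightK]; ring
  have e2 : resolventWeight s r ^ 2 ≤ 2 * ((1 + r) ^ s) ^ 2 + 2 * (1 + H) := by
    rw [resolventWeight]
    nlinarith [sq_nonneg ((1 + r) ^ s - r ^ (-(1 / 2) : ℝ))]
  calc weightK V s x y ^ 2 ≤ v V x ^ 2 * v V y ^ 2 * (2 * ((1 + r) ^ s) ^ 2 + 2 * (1 + H)) := by
        rw [e1]; gcongr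
    _ = 2 * (v V x ^ 2 * v V y ^ 2 * ((1 + r) ^ s) ^ 2) + 2 * (v V x ^ 2 * v V y ^ 2) +
          2 * (v V x ^ 2 * (v V y ^ 2 * H)) := by ring
    _ ≤ 2 * (v V x ^ 2 * v V y ^ 2 * ((1 + ‖x‖) ^ (2 * s) * (1 + ‖y‖) ^ (2 * s))) +
          2 * (a * b) + 2 * (C * (v V y ^ 2 * H)) := by gcongr
    _ = 4 * (a * b) + 2 * C * (v V y ^ 2 * H) := by ring
    _ = _ := rfl

/-! ### Kernels depending on the spectral parameter -/

/-- The kernels `k λ` satisfy symbol bounds with constants given by the kernel `W`. -/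
structure KernelSymbol (α p : ℝ) (W : Plane → Plane → ℝ) (k : ℝ → Plane → Plane → ℂ) : Prop where
  meas : ∀ l ∈ Ioo (0 : ℝ) 1, Measurable fun q : Plane × Plane => k l q.1 q.2
  symb : ∀ x y, x ≠ y → HolderSymbol α p 1 (fun l => k l x y) (W x y)

theorem ae_ne (x : Plane) : ∀ᵐ y : Plane, x ≠ y := by
  have : ({x} : Set Plane)ᶜ ∈ ae (volume : Measure Plane) := compl_mem_ae_iff.2 (by simp)
  filter_upwards [this] with y hy using fun h => hy h.symm

theorem ae_prod_ne : ∀ᵐ q : Plane × Plane, q.1 ≠ q.2 := by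
  have hm : MeasurableSet {q : Plane × Plane | q.1 = q.2} :=
    (isClosed_eq continuous_fst continuous_snd).measurableSet
  change (volume.prod volume) {q : Plane × Plane | ¬ q.1 ≠ q.2} = 0
  simp only [not_not]
  rw [Measure.measure_prod_null hm]
  filter_upwards with x
  exact (measure_mono_null (fun y hy => (show y ∈ ({x} : Set Plane) from hy.symm)) (by simp))

namespace KernelSymbol

variable {α p p₁ p₂ q : ℝ} {W : Plane → Plane → ℝ} {k k₁ k₂ : ℝ → Plane → Plane → ℂ}

theorem hsKernel (hk : KernelSymbol α p W k)
    (hW : MemLp (fun q : Plane × Plane => W q.1 q.2) 2 volume) {l : ℝ} (hl : l ∈ Ioo (0 : ℝ) 1) :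
    HSKernel (k l) := by
  refine (hW.mul_const (l ^ p)).mono' (hk.meas l hl).aestronglyMeasurable ?_
  filter_upwards [ae_prod_ne] with q hq using (hk.symb _ _ hq).bound l hl

theorem opK (hk : KernelSymbol α p W k) (hα0 : 0 < α) (hp : p ≤ 1)
    (hW : MemLp (fun q : Plane × Plane => W q.1 q.2) 2 volume) :
    HolderSymbol α p 1 (fun l => opK (k l))
      (eLpNorm (fun q : Plane × Plane => W q.1 q.2) 2 volume).toReal := by
  have h := HolderSymbol.toLp hα0 hp hW (fun l hl => (hk.meas l hl).aestronglyMeasurable)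
    (by filter_upwards [ae_prod_ne] with q hq using hk.symb _ _ hq)
  have := h.clm (K := 1) (opHS.restrictScalars ℝ) (by
    rw [ContinuousLinearMap.norm_restrictScalars]; exact norm_opHS_le)
  rwa [one_mul] at this

protected theorem star (hk : KernelSymbol α p W k) :
    KernelSymbol α p W fun l x y => star (k l x y) where
  meas l hl := (continuous_star.measurable).comp (hk.meas l hl)
  symb x y hxy := by
    have := (hk.symb x y hxy).map_of (K := 1) zero_le_one (fun z : ℂ => star z) (fun a b => by simp)
      (fun a => by simp) (fun l f' hf => hf.star)
    rwa [one_mul] at this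

theorem swap (hk : KernelSymbol α p W k) (hsymm : ∀ x y, W x y = W y x) :
    KernelSymbol α p W fun l x y => k l y x where
  meas l hl := (hk.meas l hl).comp measurable_swap
  symb x y hxy := by rw [hsymm]; exact hk.symb y x hxy.symm

theorem sec (hk : KernelSymbol α p W k) (hα0 : 0 < α) (hp : p ≤ 1) {x : Plane}
    (hx : MemLp (W x) 2 volume) :
    HolderSymbol α p 1 (fun l => sec (k l) x) (eLpNorm (W x) 2 volume).toReal :=
  HolderSymbol.toLp hα0 hp hx
    (fun l hl => ((hk.meas l hl).comp measurable_prodMk_left).aestronglyMeasurable)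
    (by filter_upwards [ae_ne x] with y hy using hk.symb _ _ hy)

theorem add (h₁ : KernelSymbol α p W k₁) (h₂ : KernelSymbol α p W k₂) :
    KernelSymbol α p (fun x y => W x y + W x y) fun l x y => k₁ l x y + k₂ l x y where
  meas l hl := (h₁.meas l hl).add (h₂.meas l hl)
  symb x y hxy := (h₁.symb x y hxy).add (h₂.symb x y hxy)

theorem mono_exponent (h : KernelSymbol α p W k) (hqp : q ≤ p) (hW : ∀ x y, 0 ≤ W x y) :
    KernelSymbol α q W k where
  meas := h.meas
  symb x y hxy := (h.symb x y hxy).mono_exponent le_rfl (hW x y) hqp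

theorem mono {W' : Plane → Plane → ℝ} (h : KernelSymbol α p W k) (hW : ∀ x y, W x y ≤ W' x y) :
    KernelSymbol α p W' k where
  meas := h.meas
  symb x y hxy := (h.symb x y hxy).mono_const (hW x y)

/-- The kernels of the products `k₁ B k₂`. -/
theorem compK {l₀ b : ℝ} {B : ℝ → L2 →L[ℂ] L2} (h₁ : KernelSymbol α p₁ W k₁)
    (h₂ : KernelSymbol α p₂ W k₂) (hsymm : ∀ x y, W x y = W y x) (hB : HolderSymbol α q l₀ B b)
    (hα0 : 0 < α) (hα1 : α ≤ 1) (hp₁ : p₁ ≤ 1) (hp₂ : p₂ ≤ 1) (hq : q ≤ 1) (hqp : q + p₂ ≤ 1)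
    (hl₀ : 0 < l₀) (hl₀1 : l₀ ≤ 1) {x y : Plane}
    (hx : MemLp (W x) 2 volume) (hy : MemLp (W y) 2 volume) :
    HolderSymbol α (p₁ + (q + p₂)) l₀ (fun l => compK (k₁ l) (B l) (k₂ l) x y)
      (6 * ((eLpNorm (W x) 2 volume).toReal * (6 * (b * (eLpNorm (W y) 2 volume).toReal)))) := by
  have e1 := (h₁.star.sec hα0 hp₁ hx).mono_right hl₀1
  have e2 := ((h₂.swap hsymm).sec hα0 hp₂ hy).mono_right hl₀1
  have hap : IsBoundedBilinearMap ℝ fun z : (L2 →L[ℂ] L2) × L2 => z.1 z.2 :=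
    { add_left := fun _ _ _ => rfl
      smul_left := fun _ _ _ => rfl
      add_right := fun _ _ _ => map_add _ _ _
      smul_right := fun c A f => A.map_smul_of_tower c f
      bound := ⟨1, one_pos, fun A f => by rw [one_mul]; exact A.le_opNorm f⟩ }
  have e3 := hB.bilin hap (fun A f => A.le_opNorm f) e2 hα1 hq hp₂ hl₀
  exact e1.bilin (isBoundedBilinearMap_inner (𝕜 := ℂ)) (fun f g => norm_inner_le_norm f g) e3
    hα1 hp₁ hqp hl₀

end KernelSymbol

end

section

/-! ### The kernels and operators attached to the potential -/

/-- The kernel of the singular part of `v R₀ v`. -/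
def kerSing (V : Plane → ℝ) (σ : ℤˣ) (l : ℝ) (x y : Plane) : ℂ :=
  v V x * (resolventConst σ l + G0 x y) * v V y

/-- The kernel of the remainder of `v R₀ v`. -/
def kerRem (V : Plane → ℝ) (σ : ℤˣ) (l : ℝ) (x y : Plane) : ℂ :=
  v V x * resolventRem σ l ‖x - y‖ * v V y

variable {V : Plane → ℝ} {α ε δ : ℝ}

theorem measurable_G0 : Measurable fun q : Plane × Plane => G0 q.1 q.2 :=
  Complex.measurable_ofReal.comp
    ((Real.measurable_log.comp (measurable_fst.sub measurable_snd).norm).const_mul _)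

theorem measurable_evenSum {a : ℕ → ℝ} (ha : ∀ k, |a k| ≤ 1 / k.factorial) :
    Measurable (evenSum a) :=
  (continuous_iff_continuousAt.2 fun z => (hasDerivAt_evenSum ha z).continuousAt).measurable

theorem measurable_resolventRem (σ : ℤˣ) (l : ℝ) : Measurable fun r => resolventRem σ l r := by
  have hl : Measurable fun r : ℝ => l * r := measurable_id.const_mul l
  have hJ := (measurable_evenSum abs_coeffJ_le).comp hl
  have hL := (measurable_evenSum abs_coeffL_le).comp hl
  have hlog : Measurable logTerm :=
    (Real.measurable_log.comp (measurable_id.div_const 2)).add_const _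
  exact ((Complex.measurable_ofReal.comp (hJ.sub_const 1)).const_mul _).sub
    ((Complex.measurable_ofReal.comp (((hlog.comp hl).mul (hJ.sub_const 1)).add hL)).const_mul _)

theorem measurable_vc (hV : Measurable V) : Measurable fun x => (v V x : ℂ) :=
  Complex.measurable_ofReal.comp (measurable_v hV)

theorem HolderSymbol.mul_v {p a : ℝ} {f : ℝ → ℂ} (h : HolderSymbol α p 1 f a) (x y : Plane) :
    HolderSymbol α p 1 (fun l => (v V x : ℂ) * f l * (v V y : ℂ)) (v V x * v V y * a) :=
  h.map_of (mul_nonneg (v_nonneg V x) (v_nonneg V y)) (fun z => (v V x : ℂ) * z * (v V y : ℂ))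
    (fun a b => by ring)
    (fun z => by
      rw [norm_mul, norm_mul, Complex.norm_real, Complex.norm_real,
        Real.norm_of_nonneg (v_nonneg V x), Real.norm_of_nonneg (v_nonneg V y)]
      exact le_of_eq (by ring))
    fun _ _ hf => (hf.const_mul _).mul_const _

theorem exists_kernelSymbols (hV : Measurable V) {p : ℝ} (hα0 : 0 ≤ α) (hα1 : α ≤ 1)
    (hδ0 : 0 ≤ δ) (hδ1 : δ ≤ 1 / 2) (hp : p < 0) :
    ∃ C, 0 ≤ C ∧ ∀ σ,
      KernelSymbol α p (fun x y => C * weightK V (1 / 2 + δ + α) x y) (kerSing V σ) ∧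
      KernelSymbol α (1 / 2 + δ) (fun x y => C * weightK V (1 / 2 + δ + α) x y) (kerRem V σ) := by
  obtain ⟨C₁, h₁, H₁⟩ := exists_resolventConst_symbol
    (by linarith : 1 / 2 ≤ 1 / 2 + δ + α) hα1 hp
  obtain ⟨C₂, h₂, H₂⟩ := exists_resolventRem_symbol hδ0 hδ1 hα0 hα1
  have hx : Measurable fun q : Plane × Plane => (v V q.1 : ℂ) :=
    (measurable_vc hV).comp measurable_fst
  have hy : Measurable fun q : Plane × Plane => (v V q.2 : ℂ) :=
    (measurable_vc hV).comp measurable_snd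
  refine ⟨C₁ + C₂, by positivity, fun σ => ⟨⟨fun l _ => ?_, fun x y hxy => ?_⟩,
    ⟨fun l _ => ?_, fun x y hxy => ?_⟩⟩⟩
  · exact (hx.mul (measurable_G0.const_add _)).mul hy
  · refine ((H₁ σ x y hxy).mul_v x y).mono_const ?_
    have := mul_nonneg h₂ (weightK_nonneg V (1 / 2 + δ + α) x y)
    rw [weightK] at this ⊢
    linarith
  · exact (hx.mul ((measurable_resolventRem σ l).comp
      (measurable_fst.sub measurable_snd).norm)).mul hy
  · refine ((H₂ σ _ (norm_pos_iff.2 (sub_ne_zero.2 hxy))).mul_v x y).mono_const ?_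
    have := mul_nonneg h₁ (weightK_nonneg V (1 / 2 + δ + α) x y)
    rw [weightK] at this ⊢
    linarith

/-! ### The multiplier U, the vector v and the decomposition of M -/

theorem measurable_U (hV : Measurable V) : Measurable (U V) :=
  Measurable.ite (hV measurableSet_Ici) measurable_const measurable_const

theorem norm_U (x : Plane) : ‖U V x‖ = 1 := by rw [U]; split_ifs <;> simp

theorem U_mul_U (x : Plane) : U V x * U V x = 1 := by rw [U]; split_ifs <;> simp

theorem star_U (x : Plane) : star (U V x) = U V x := by rw [U]; split_ifs <;> simp

theorem memLp_U (hV : Measurable V) : MemLp (U V) ∞ volume :=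
  memLp_top_of_bound (measurable_U hV).aestronglyMeasurable 1
    (Filter.Eventually.of_forall fun x => (norm_U x).le)

theorem mulOp_U_mul_self (hV : Measurable V) : mulOp (memLp_U hV) * mulOp (memLp_U hV) = 1 := by
  ext1 f
  refine Lp.ext ?_
  filter_upwards [mulOp_apply (memLp_U hV) f, mulOp_apply (memLp_U hV) (mulOp (memLp_U hV) f)]
    with x h1 h2
  have : (mulOp (memLp_U hV) * mulOp (memLp_U hV)) f = mulOp (memLp_U hV) (mulOp (memLp_U hV) f) :=
    rfl
  rw [this, h2, h1, ← mul_assoc, U_mul_U, one_mul]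
  rfl

theorem Decays.integrable_abs (hV : Measurable V) (h : Decays V α ε) (hα : 0 ≤ α) (hε : 0 < ε) :
    Integrable fun x => v V x ^ 2 := by
  refine (h.integrable hV hα hε.le (δ := 0) hε).mono'
    ((measurable_v hV).pow_const 2).aestronglyMeasurable (Filter.Eventually.of_forall fun x => ?_)
  rw [Real.norm_of_nonneg (by positivity)]
  exact le_mul_of_one_le_right (by positivity)
    (Real.one_le_rpow (by linarith [norm_nonneg x]) (by positivity))

theorem Decays.memLp_v (hV : Measurable V) (h : Decays V α ε) (hα : 0 ≤ α) (hε : 0 < ε) :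
    MemLp (fun x => (v V x : ℂ)) 2 volume :=
  ((memLp_two_iff_integrable_sq (measurable_v hV).aestronglyMeasurable).2
    (h.integrable_abs hV hα hε)).ofReal

theorem coeFn_vL2 (hv : MemLp (fun x => (v V x : ℂ)) 2 (volume : Measure Plane)) :
    vL2 V =ᵐ[volume] fun x => (v V x : ℂ) := by
  rw [vL2, dif_pos hv]; exact hv.coeFn_toLp

theorem star_vL2 (hv : MemLp (fun x => (v V x : ℂ)) 2 (volume : Measure Plane)) :
    star (vL2 V) = vL2 V := by
  refine Lp.ext ?_
  filter_upwards [Lp.coeFn_star (vL2 V), coeFn_vL2 hv] with x h1 h2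
  rw [h1, Pi.star_apply, h2]
  simp

theorem normV_eq (hv : MemLp (fun x => (v V x : ℂ)) 2 (volume : Measure Plane)) :
    normV V = ‖vL2 V‖ ^ 2 := by
  have h : ((‖vL2 V‖ ^ 2 : ℝ) : ℂ) = ((normV V : ℝ) : ℂ) := by
    have h1 := inner_self_eq_norm_sq_to_K (𝕜 := ℂ) (vL2 V)
    have h2 : ⟪vL2 V, vL2 V⟫ = pair (vL2 V) (vL2 V) := by rw [pair, star_vL2 hv]
    rw [Complex.ofReal_pow]
    refine h1.symm.trans ?_
    rw [h2, pair_eq, normV, ← integral_complex_ofReal]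
    refine integral_congr_ae ?_
    filter_upwards [coeFn_vL2 hv] with x hx
    rw [hx, ← v_sq, pow_two, Complex.ofReal_mul]
  exact_mod_cast h.symm

theorem normV_pos (hv : MemLp (fun x => (v V x : ℂ)) 2 (volume : Measure Plane))
    (hV0 : ¬ V =ᵐ[volume] 0) : 0 < normV V := by
  rw [normV_eq hv]
  refine pow_pos (norm_pos_iff.2 fun h0 => hV0 ?_) 2
  have h1 := coeFn_vL2 hv
  rw [h0] at h1
  filter_upwards [h1, Lp.coeFn_zero ℂ 2 (volume : Measure Plane)] with x h2 h3
  rw [h3, Pi.zero_apply] at h2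
  have h4 : v V x = 0 := by exact_mod_cast h2.symm
  have h5 := v_sq V x
  rw [h4] at h5
  simpa using h5.symm

/-- P has the kernel v(x) v(y) / ‖V‖₁, which explains the factor ‖V‖₁ in g. -/
theorem hasKernel_smul_P (hv : MemLp (fun x => (v V x : ℂ)) 2 (volume : Measure Plane))
    (hV0 : ¬ V =ᵐ[volume] 0) (z : ℂ) :
    HasKernel ((normV V * z) • P V) fun x y => v V x * z * v V y := by
  have hn : (normV V : ℂ) ≠ 0 := by exact_mod_cast (normV_pos hv hV0).ne'
  refine ⟨((hv.1.comp_fst).mul_const z).mul hv.1.comp_snd, fun f => ?_⟩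
  filter_upwards [coeFn_vL2 hv, Lp.coeFn_smul ((normV V * z) * (⟪vL2 V, f⟫ / (‖vL2 V‖ ^ 2 : ℝ)))
    (vL2 V)] with x h1 h2
  have e : (fun y => (v V x : ℂ) * z * v V y * f y) =ᵐ[volume]
      fun y => (v V x * z) * (vL2 V y * f y) := by
    filter_upwards [coeFn_vL2 hv] with y hy
    rw [hy]; ring
  refine ⟨((L2_integrable_mul _ f).const_mul _).congr e.symm, ?_⟩
  rw [integral_congr_ae e, integral_const_mul, ← pair_eq, pair, star_vL2 hv, smul_apply, P_apply,
    smul_smul, h2, Pi.smul_apply, h1, smul_eq_mul, ← normV_eq hv]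
  field_simp
  ring

theorem hsKernel_v (hv : MemLp (fun x => (v V x : ℂ)) 2 (volume : Measure Plane)) (z : ℂ) :
    HSKernel fun x y => v V x * z * v V y := by
  have hr : MemLp (v V) 2 volume := by simpa using hv.re
  have := ((memLp_mul_prod hr hr).ofReal (K := ℂ)).const_mul z
  refine this.ae_eq (Filter.Eventually.of_forall fun q => ?_)
  simp only [Complex.coe_algebraMap, RCLike.ofReal_mul]
  change z * ((v V q.1 : ℂ) * (v V q.2 : ℂ)) = _
  ring

/-- The kernel of v G₀ v differs from the singular kernel at any one λ by a multiple of v(x) v(y),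
so it needs no estimate of its own. -/
theorem HSKernel.G0 (hv : MemLp (fun x => (v V x : ℂ)) 2 (volume : Measure Plane)) {σ : ℤˣ}
    {l : ℝ} (hk : HSKernel (kerSing V σ l)) : HSKernel fun x y => v V x * G0 x y * v V y := by
  refine (MemLp.sub hk (hsKernel_v hv (resolventConst σ l))).ae_eq
    (Filter.Eventually.of_forall fun q => ?_)
  simp only [Pi.sub_apply, kerSing]
  ring

theorem isMulAddKernel_T (hV : Measurable V) (hk : HSKernel fun x y => v V x * G0 x y * v V y) :
    IsMulAddKernel (U V) (fun x y => v V x * G0 x y * v V y) (T V) := by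
  have := hk.isMulAddKernel (memLp_U hV)
  rw [T, opOf_eq this]; exact this

theorem T_eq (hV : Measurable V) (hk : HSKernel fun x y => v V x * G0 x y * v V y) :
    T V = mulOp (memLp_U hV) + opK fun x y => v V x * G0 x y * v V y :=
  opOf_eq (hk.isMulAddKernel (memLp_U hV))

theorem star_vG0v (x y : Plane) :
    star ((v V x : ℂ) * G0 x y * v V y) = (v V x : ℂ) * G0 x y * v V y := by
  rw [G0]; simp

theorem adjoint_T (hV : Measurable V) (hk : HSKernel fun x y => v V x * G0 x y * v V y) :
    ContinuousLinearMap.adjoint (T V) = T V := by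
  rw [T_eq hV hk, map_add, adjoint_mulOp _ star_U, hk.adjoint_opK]
  congr 2
  funext x y
  rw [star_vG0v, G0, G0, norm_sub_rev]
  ring

/-- The singular part of `M^±(λ)` is `g P + T`. -/
theorem g_smul_P_add_T (hV : Measurable V) (hV0 : ¬ V =ᵐ[volume] 0)
    (hv : MemLp (fun x => (v V x : ℂ)) 2 (volume : Measure Plane)) {σ : ℤˣ} {l : ℝ}
    (hk : HSKernel (kerSing V σ l)) :
    g V σ l • P V + T V = mulOp (memLp_U hV) + opK (kerSing V σ l) := by
  have hG := HSKernel.G0 hv hk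
  have h1 : g V σ l • P V + opK (fun x y => v V x * G0 x y * v V y) = opK (kerSing V σ l) := by
    have h2 := (hasKernel_smul_P hv hV0 (resolventConst σ l)).add hG.hasKernel
    refine IsMulAddKernel.unique h2 ?_
    have h3 := hk.hasKernel
    have e : kerSing V σ l = fun x y => (v V x : ℂ) * resolventConst σ l * v V y +
        v V x * G0 x y * v V y := by
      funext x y; rw [kerSing]; ring
    rwa [e] at h3 ⊢
  rw [T_eq hV hG, ← h1]
  abel

theorem isMulAddKernel_M (hV : Measurable V) {σ : ℤˣ} {l : ℝ} (hl : 0 < l)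
    (hk : HSKernel (kerSing V σ l)) (hr : HSKernel (kerRem V σ l)) :
    IsMulAddKernel (U V) (fun x y => v V x * freeResolvent σ l x y * v V y) (M V σ l) ∧
      M V σ l = mulOp (memLp_U hV) + opK (fun x y => kerSing V σ l x y + kerRem V σ l x y) := by
  have e : (fun q : Plane × Plane => kerSing V σ l q.1 q.2 + kerRem V σ l q.1 q.2) =ᵐ[volume]
      fun q => v V q.1 * freeResolvent σ l q.1 q.2 * v V q.2 := by
    filter_upwards [ae_prod_ne] with q hq
    rw [freeResolvent_eq σ hl hq, kerSing, kerRem]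
    ring
  have hF : HSKernel fun x y => v V x * freeResolvent σ l x y * v V y :=
    MemLp.ae_eq e (MemLp.add hk hr)
  have hM := hF.isMulAddKernel (memLp_U hV)
  have hM' : M V σ l = _ := opOf_eq hM
  refine ⟨by rw [hM']; exact hM, ?_⟩
  rw [hM']
  congr 1
  exact (opK_congr (k₁ := fun x y => kerSing V σ l x y + kerRem V σ l x y)
    (k₂ := fun x y => v V x * freeResolvent σ l x y * v V y) e).symm

/-- Only ±i/4 is not real, so the imaginary part has modulus ‖V‖₁/4 for every λ and every real c. -/
theorem normV_div_le (c : ℝ) (σ : ℤˣ) (l : ℝ) : normV V / 4 ≤ ‖g V σ l + c‖ := by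
  have h1 : |(g V σ l + c).im| = |normV V| / 4 := by
    rw [g]
    generalize 1 / (2 * Real.pi) * Real.log (l / 2) +
      Real.eulerMascheroniConstant / (2 * Real.pi) = R
    rcases Int.units_eq_one_or σ with rfl | rfl
    all_goals simp [sgn, abs_mul, div_eq_mul_inv]
  calc normV V / 4 ≤ |normV V| / 4 := by gcongr; exact le_abs_self _
    _ ≤ _ := by rw [← h1]; exact Complex.abs_im_le_norm _

end

section

/-! ### Inverses -/

section perturbation

variable {R : Type*} [NormedRing R] [HasSummableGeomSeries R]

/-- Small perturbations of an invertible element. -/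
theorem isUnit_add_of_small {A B r : R} {b ρ : ℝ} (h1 : A * B = 1) (h2 : B * A = 1)
    (hB : ‖B‖ ≤ b) (hr : ‖r‖ ≤ ρ) (hbρ : b * ρ ≤ 1 / 2) :
    IsUnit (A + r) ∧ ‖Ring.inverse (A + r)‖ ≤ 2 * b := by
  have hsmall : ‖B * r‖ ≤ 1 / 2 := (norm_mul_le _ _).trans
    ((mul_le_mul hB hr (norm_nonneg _) ((norm_nonneg _).trans hB)).trans hbρ)
  have hu : IsUnit (1 + B * r) := by
    have := isUnit_one_sub_of_norm_lt_one (x := -(B * r)) (by rw [norm_neg]; linarith)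
    rwa [sub_neg_eq_add] at this
  have hA : IsUnit A := ⟨⟨A, B, h1, h2⟩, rfl⟩
  have hAr : A + r = A * (1 + B * r) := by rw [mul_add, ← mul_assoc, h1, mul_one, one_mul]
  have hAu : IsUnit (A + r) := by rw [hAr]; exact hA.mul hu
  refine ⟨hAu, ?_⟩
  set X := Ring.inverse (A + r) with hX
  -- The resolvent identity; with ‖B r‖ ≤ 1/2 the term containing X is absorbed in the left side.
  have e : X = B - B * r * X := by
    have : (A + r) * X = 1 := Ring.mul_inverse_cancel _ hAu
    calc X = B * A * X := by rw [h2, one_mul]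
      _ = B * ((A + r) * X) - B * r * X := by noncomm_ring
      _ = _ := by rw [this, mul_one]
  have h3 : ‖X‖ ≤ b + 1 / 2 * ‖X‖ := by
    calc ‖X‖ = ‖B - B * r * X‖ := congrArg _ e
      _ ≤ ‖B‖ + ‖B * r * X‖ := norm_sub_le _ _
      _ ≤ b + 1 / 2 * ‖X‖ := add_le_add hB ((norm_mul_le _ _).trans (by gcongr))
  linarith

end perturbation

/-- The difference of the inverses of `u + a + r` and `u + a`. -/
theorem inverse_sub_inverse {R : Type*} [Ring R] {u a r m A M : R} (hm : m = a + r)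
    (hu : u * u = 1) (hA1 : (u + a) * A = 1) (hA2 : A * (u + a) = 1) (hM1 : (u + m) * M = 1)
    (hM2 : M * (u + m) = 1) :
    M - A = u * (-r + a * A * r + r * M * m - a * (A * r * M) * m) * u := by
  -- Since u² = 1, the equation for A reads A = u(1 - a A), and likewise M = (1 - M m)u. Inserting
  -- these in -A r M puts a Hilbert–Schmidt factor at each end of every term.
  have e1 : u * (1 - a * A) = A := by
    have : a * A = 1 - u * A := by rw [← hA1]; noncomm_ring
    rw [this, sub_sub_cancel, ← mul_assoc, hu, one_mul]
  have e2 : (1 - M * m) * u = M := by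
    have : M * m = 1 - M * u := by rw [← hM2]; noncomm_ring
    rw [this, sub_sub_cancel, mul_assoc, hu, mul_one]
  calc M - A = (A * (u + a)) * M - A * ((u + m) * M) := by rw [hA2, hM1, one_mul, mul_one]
    _ = -(A * r * M) := by rw [hm]; noncomm_ring
    _ = -((u * (1 - a * A)) * r * ((1 - M * m) * u)) := by rw [e1, e2]
    _ = _ := by noncomm_ring

/-! ### The bounds for the remainder -/

theorem hsNorm_le_eLpNorm {G : Plane → Plane → ℝ≥0∞} {D : Plane × Plane → ℝ}
    (h : ∀ᵐ q : Plane × Plane, G q.1 q.2 ≤ ENNReal.ofReal (D q)) :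
    hsNorm G ≤ eLpNorm D 2 volume := by
  rw [hsNorm, eLpNorm_eq_lintegral_rpow_enorm_toReal (by norm_num) (by norm_num)]
  simp only [ENNReal.toReal_ofNat, ENNReal.rpow_ofNat]
  refine ENNReal.rpow_le_rpow (lintegral_mono_ae ?_) (by norm_num)
  filter_upwards [h] with q hq
  refine pow_le_pow_left' (hq.trans ?_) 2
  exact Real.ofReal_le_enorm _

section suprema

variable {α l₀ l₁ D : ℝ} {k : ℝ → Plane → Plane → ℂ} {x y : Plane}

theorem sup0_le (h : HolderSymbol α (1 / 2) l₀ (fun l => k l x y) D) (hl : l₁ ≤ l₀) :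
    sup0 k l₁ x y ≤ ENNReal.ofReal D := by
  refine iSup₂_le fun l hl' => ENNReal.ofReal_le_ofReal ?_
  have hb := h.bound l ⟨hl'.1, hl'.2.trans_le hl⟩
  have hp := Real.rpow_pos_of_pos hl'.1 (1 / 2)
  rw [Real.rpow_neg hl'.1.le, inv_mul_le_iff₀ hp, mul_comm]
  exact hb

theorem sup1_le (h : HolderSymbol α (1 / 2) l₀ (fun l => k l x y) D) (hl : l₁ ≤ l₀) :
    sup1 k l₁ x y ≤ ENNReal.ofReal D := by
  refine iSup₂_le fun l hl' => ENNReal.ofReal_le_ofReal ?_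
  have hb := h.deriv_bound l ⟨hl'.1, hl'.2.trans_le hl⟩
  have hp := Real.rpow_nonneg hl'.1.le (1 / 2)
  have e : l ^ (1 / 2 : ℝ) * l ^ (1 / 2 - 1 : ℝ) = 1 := by
    rw [← Real.rpow_add hl'.1]; norm_num
  calc _ ≤ l ^ (1 / 2 : ℝ) * (D * l ^ (1 / 2 - 1 : ℝ)) := by gcongr
    _ = D * (l ^ (1 / 2 : ℝ) * l ^ (1 / 2 - 1 : ℝ)) := by ring
    _ = D := by rw [e, mul_one]

theorem supHolder_le (h : HolderSymbol α (1 / 2) l₀ (fun l => k l x y) D) (hα0 : 0 ≤ α)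
    (hl₀ : 0 < l₀) (hl : l₁ ≤ l₀) : supHolder α k l₁ x y ≤ ENNReal.ofReal (2 * D) := by
  refine iSup₂_le fun b hb => iSup₂_le fun l hl' => ENNReal.ofReal_le_ofReal ?_
  have hbl : 0 < b - l := sub_pos.2 hl'.2
  have hb := h.deriv_sub_le hα0 (by norm_num) (h.const_nonneg hl₀)
    ⟨hl'.1, (hl'.2.trans hb.2).trans_le hl⟩ ⟨hb.1, hb.2.trans_le hl⟩ hl'.2
  have hp := Real.rpow_nonneg hl'.1.le (1 / 2 + α)
  have hq := Real.rpow_nonneg hbl.le (-α)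
  have e1 : l ^ (1 / 2 + α) * l ^ (1 / 2 - 1 - α) = 1 := by
    rw [← Real.rpow_add hl'.1]; ring_nf; simp
  have e2 : (b - l) ^ (-α) * (b - l) ^ α = 1 := by
    rw [← Real.rpow_add hbl]; simp
  calc _ ≤ l ^ (1 / 2 + α) * (b - l) ^ (-α) *
        (2 * D * l ^ (1 / 2 - 1 - α) * (b - l) ^ α) := by gcongr
    _ = 2 * D * (l ^ (1 / 2 + α) * l ^ (1 / 2 - 1 - α)) * ((b - l) ^ (-α) * (b - l) ^ α) := by
      ring
    _ = 2 * D := by rw [e1, e2, mul_one, mul_one]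

end suprema

theorem ae_memLp_section {W : Plane → Plane → ℝ}
    (hW : MemLp (fun q : Plane × Plane => W q.1 q.2) 2 volume) :
    (∀ᵐ x, MemLp (W x) 2 volume) ∧
      MemLp (fun x => (eLpNorm (W x) 2 volume).toReal) 2 volume := by
  have hc : HSKernel fun x y => (W x y : ℂ) := hW.ofReal
  have h1 : ∀ᵐ x, MemLp (W x) 2 volume := by
    filter_upwards [hc.sec_memLp] with x hx using by simpa using hx.re
  refine ⟨h1, hc.memLp_norm_sec.ae_eq ?_⟩
  filter_upwards [hc.sec_memLp] with x hx
  rw [sec, lpOf_eq hx, Lp.norm_toLp]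
  congr 1
  exact eLpNorm_congr_norm_ae (Filter.Eventually.of_forall fun y => by simp)

/-! ### The remainder and its kernel -/

variable {V : Plane → ℝ}

/-- The inverse of the singular part of `M^±(λ)`. -/
def invSing (hV : Measurable V) (σ : ℤˣ) (l : ℝ) : L2 →L[ℂ] L2 :=
  Ring.inverse (mulOp (memLp_U hV) + opK (kerSing V σ l))

/-- The kernel of `v R₀ v`. -/
def kerFull (V : Plane → ℝ) (σ : ℤˣ) (l : ℝ) (x y : Plane) : ℂ :=
  kerSing V σ l x y + kerRem V σ l x y

/-- The inverse of `M^±(λ)`. -/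
def invFull (hV : Measurable V) (σ : ℤˣ) (l : ℝ) : L2 →L[ℂ] L2 :=
  Ring.inverse (mulOp (memLp_U hV) + opK (kerFull V σ l))

/-- The kernel of the error term. -/
def kerError (hV : Measurable V) (σ : ℤˣ) (l : ℝ) (x y : Plane) : ℂ :=
  U V x * (-kerRem V σ l x y + compK (kerSing V σ l) (invSing hV σ l) (kerRem V σ l) x y +
    compK (kerRem V σ l) (invFull hV σ l) (kerFull V σ l) x y +
    -compK (kerSing V σ l) (invSing hV σ l * opK (kerRem V σ l) * invFull hV σ l)
      (kerFull V σ l) x y) * U V y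

theorem hasKernel_kerError (hV : Measurable V) {σ : ℤˣ} {l : ℝ} (hk : HSKernel (kerSing V σ l))
    (hr : HSKernel (kerRem V σ l)) (hA : IsUnit (mulOp (memLp_U hV) + opK (kerSing V σ l)))
    (hM : IsUnit (mulOp (memLp_U hV) + opK (kerFull V σ l))) :
    HasKernel (invFull hV σ l - invSing hV σ l) (kerError hV σ l) := by
  have hf : HSKernel (kerFull V σ l) := MemLp.add hk hr
  have em : opK (kerFull V σ l) = opK (kerSing V σ l) + opK (kerRem V σ l) := opK_add hk hr
  have e := inverse_sub_inverse em (mulOp_U_mul_self hV)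
    (Ring.mul_inverse_cancel _ hA) (Ring.inverse_mul_cancel _ hA)
    (Ring.mul_inverse_cancel _ hM) (Ring.inverse_mul_cancel _ hM)
  rw [invFull, invSing, e, sub_eq_add_neg]
  exact (((hr.hasKernel.neg.add (hk.hasKernel_compK _ hr)).add (hr.hasKernel_compK _ hf)).add
    (hk.hasKernel_compK _ hf).neg).mulOp_mul_mulOp (memLp_U hV)

/-- Exponents of the four terms: 1/2+6d for r, 1/2+3d for the two products with one inverse, and 1/2
for the product with both inverses. All are lowered to 1/2, as λ < 1. -/
theorem exists_kerError_symbol (hV : Measurable V) {α d l₀ a : ℝ} {σ : ℤˣ} (hα0 : 0 < α)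
    (hα1 : α ≤ 1) (hd : 0 < d) (hd1 : 1 / 2 + 6 * d ≤ 1) (hl₀ : 0 < l₀) (hl₀1 : l₀ ≤ 1)
    {W : Plane → Plane → ℝ} (hW : MemLp (fun q : Plane × Plane => W q.1 q.2) 2 volume)
    (hsymm : ∀ x y, W x y = W y x)
    (hk : KernelSymbol α (-d) W (kerSing V σ)) (hr : KernelSymbol α (1 / 2 + 6 * d) W (kerRem V σ))
    (hf : KernelSymbol α (-d) W (kerFull V σ))
    (hA : ∀ l ∈ Ioo 0 l₀, IsUnit (mulOp (memLp_U hV) + opK (kerSing V σ l)))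
    (hM : ∀ l ∈ Ioo 0 l₀, IsUnit (mulOp (memLp_U hV) + opK (kerFull V σ l)))
    (hA' : ∀ l ∈ Ioo 0 l₀, ‖invSing hV σ l‖ ≤ a) (hM' : ∀ l ∈ Ioo 0 l₀, ‖invFull hV σ l‖ ≤ a) :
    ∃ C, 0 ≤ C ∧ ∀ x y, x ≠ y → MemLp (W x) 2 volume → MemLp (W y) 2 volume →
      HolderSymbol α (1 / 2) l₀ (fun l => kerError hV σ l x y)
        (W x y + C * ((eLpNorm (W x) 2 volume).toReal * (eLpNorm (W y) 2 volume).toReal)) := by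
  have hu := HolderSymbol.const (α := α) (neg_nonpos.2 hd.le) (mulOp (memLp_U hV))
  have sk := hk.opK hα0 (by linarith) hW
  have sf := hf.opK hα0 (by linarith) hW
  have sr := (hr.opK hα0 hd1 hW).mono_right hl₀1
  have sA := ((hu.add sk).mono_right hl₀1).ring_inverse hα1 (by linarith) hl₀ hl₀1 hA hA'
  have sM := ((hu.add sf).mono_right hl₀1).ring_inverse hα1 (by linarith) hl₀ hl₀1 hM hM'
  have sARM := (sA.mul sr hα1 (by linarith) hd1 hl₀).mul sM hα1 (by linarith) (by linarith) hl₀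
  set K₁ := a + a ^ 2 * (‖mulOp (memLp_U hV)‖ +
    (eLpNorm (fun q : Plane × Plane => W q.1 q.2) 2 volume).toReal) + 2 * a ^ 3 *
    (‖mulOp (memLp_U hV)‖ +
    (eLpNorm (fun q : Plane × Plane => W q.1 q.2) 2 volume).toReal) ^ 2 with hK₁
  have hK₁0 : 0 ≤ K₁ := sA.const_nonneg hl₀
  generalize hK₂ : 6 * (6 * (K₁ * (eLpNorm (fun q : Plane × Plane => W q.1 q.2) 2
    volume).toReal) * K₁) = K₂ at sARM
  have hK₂0 : 0 ≤ K₂ := sARM.const_nonneg hl₀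
  -- Each kernel of a product is two nested bilinear pairings, with constant 6 · 6. Both inverses
  -- have the symbol constant K₁, and the product of the inverses around r has K₂.
  refine ⟨36 * (K₁ + K₁ + K₂), by positivity, fun x y hxy hx hy => ?_⟩
  have s1 := ((hr.symb x y hxy).mono_right hl₀1).neg.mono_exponent hl₀1
    ((hr.symb x y hxy).const_nonneg one_pos) (by linarith : 1 / 2 ≤ 1 / 2 + 6 * d)
  have s2 := hk.compK hr hsymm sA hα0 hα1 (by linarith) hd1 (by linarith) (by linarith) hl₀ hl₀1
    hx hy
  have s3 := hr.compK hf hsymm sM hα0 hα1 hd1 (by linarith) (by linarith) (by linarith) hl₀ hl₀1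
    hx hy
  have s4 := (hk.compK hf hsymm sARM hα0 hα1 (by linarith) (by linarith) (by linarith)
    (by linarith) hl₀ hl₀1 hx hy).neg
  have t2 := s2.mono_exponent hl₀1 (s2.const_nonneg hl₀) (q := 1 / 2) (by linarith)
  have t3 := s3.mono_exponent hl₀1 (s3.const_nonneg hl₀) (q := 1 / 2) (by linarith)
  have t4 := s4.mono_exponent hl₀1 (s4.const_nonneg hl₀) (q := 1 / 2) (by linarith)
  have s := (((s1.add t2).add t3).add t4).map_of (K := 1) zero_le_one
    (fun z : ℂ => U V x * z * U V y) (fun z w => by ring)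
    (fun z => by simp [norm_U])
    (fun _ _ hf => (hf.const_mul _).mul_const _)
  exact s.mono_const (le_of_eq (by ring))

end

end Schr2D

end

/-! ### Proof of the main theorem -/

open Schr2D

theorem mainTheorem6
    (V : Schr2D.Plane → ℝ) (hVm : Measurable V) (hV0 : ¬ V =ᵐ[volume] 0)
    (α : ℝ) (hα0 : 0 < α) (hα1 : α < 1)
    (hdecay : ∃ ε : ℝ, 0 < ε ∧ ∃ C : ℝ, ∀ᵐ x : Schr2D.Plane,
      Schr2D.v V x ≤ C * Real.sqrt (1 + ‖x‖ ^ 2) ^ (-(3 / 2) - α - ε))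
    (hreg : Schr2D.ZeroIsRegular V) :
    -- `T` is given by its multiplier and kernel
    Schr2D.IsMulAddKernel (Schr2D.U V)
      (fun x y => Schr2D.v V x * Schr2D.G0 x y * Schr2D.v V y) (Schr2D.T V) ∧
    -- `S` has rank at most two and a real-valued kernel
    LinearMap.rank (Schr2D.S V : Schr2D.L2 →ₗ[ℂ] Schr2D.L2) ≤ 2 ∧
    (∃ s : Schr2D.Plane → Schr2D.Plane → ℝ,
      Schr2D.HasKernel (Schr2D.S V) (fun x y => (s x y : ℂ))) ∧
    ∃ c : ℝ, ∃ E : ℤˣ → ℝ → Schr2D.L2 →L[ℂ] Schr2D.L2,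
    ∃ k : ℤˣ → ℝ → Schr2D.Plane → Schr2D.Plane → ℂ,
    ∃ l₀ : ℝ, 0 < l₀ ∧ ∃ C : ℝ≥0, ∀ l₁ : ℝ, 0 < l₁ → l₁ ≤ l₀ → ∀ σ : ℤˣ,
      (∀ l ∈ Ioo 0 l₁,
        -- `M^±(λ)` is the bounded operator `U + v R₀^±(λ²) v`, and it is invertible
        Schr2D.IsMulAddKernel (Schr2D.U V)
          (fun x y => Schr2D.v V x * Schr2D.freeResolvent σ l x y * Schr2D.v V y)
          (Schr2D.M V σ l) ∧
        IsUnit (Schr2D.M V σ l) ∧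
        -- `h_±(λ) = g^±(λ) + c` does not vanish, and the inverse has the stated expansion
        Schr2D.g V σ l + c ≠ 0 ∧
        Ring.inverse (Schr2D.M V σ l) =
          (Schr2D.g V σ l + c)⁻¹ • Schr2D.S V + Schr2D.QDQ V + E σ l ∧
        -- `E^±(λ)` has the kernel `k^±(λ)`
        Schr2D.HasKernel (E σ l) (k σ l)) ∧
      (∀ᵐ p : Schr2D.Plane × Schr2D.Plane, ∀ l ∈ Ioo 0 l₁,
        DifferentiableAt ℝ (fun t => k σ t p.1 p.2) l) ∧
      Schr2D.hsNorm (Schr2D.sup0 (k σ) l₁) + Schr2D.hsNorm (Schr2D.sup1 (k σ) l₁) +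
        Schr2D.hsNorm (Schr2D.supHolder α (k σ) l₁) ≤ C := by
  obtain ⟨ε, hε, hdec⟩ := hdecay
  have hdec : Schr2D.Decays V α ε := hdec
  have hv := hdec.memLp_v hVm hα0.le hε
  -- The gain 6d pays for the losses d + 2d + 2d + d of the worst error term. It must stay below ε
  -- for integrability, and at most 1/2 for the remainder bounds.
  obtain ⟨d, hd0, hdε, hd1⟩ : ∃ d : ℝ, 0 < d ∧ 6 * d < ε ∧ 6 * d ≤ 1 / 2 :=
    ⟨min ε (1 / 2) / 12, by positivity, by linarith [min_le_left ε (1 / 2)],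
      by linarith [min_le_right ε (1 / 2), min_le_left ε (1 / 2)]⟩
  obtain ⟨C₀, hC₀, hsymb⟩ := exists_kernelSymbols (V := V) (α := α) (δ := 6 * d) (p := -d) hVm
    hα0.le hα1.le (by linarith) hd1 (by linarith)
  set w := weightK V (1 / 2 + 6 * d + α) with hw
  -- The weight is doubled so that a single W dominates the singular kernel, the remainder and their
  -- sum.
  set W : Plane → Plane → ℝ := fun x y => C₀ * w x y + C₀ * w x y with hWdef
  have hw0 : ∀ x y, 0 ≤ C₀ * w x y := fun x y => mul_nonneg hC₀ (weightK_nonneg V _ x y)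
  have hW0 : ∀ x y, 0 ≤ W x y := fun x y => add_nonneg (hw0 x y) (hw0 x y)
  have hWsymm : ∀ x y, W x y = W y x := fun x y => by
    simp only [hWdef]; rw [hw, weightK_comm V _ x y]
  have hW : MemLp (fun q : Plane × Plane => W q.1 q.2) 2 volume := by
    have := (hdec.memLp_weightK hVm hα0.le hε.le (by linarith) hdε).const_mul C₀
    exact this.add this
  have hsing : ∀ σ, KernelSymbol α (-d) W (kerSing V σ) := fun σ =>
    (hsymb σ).1.mono fun x y => by simp only [hWdef]; linarith [hw0 x y]
  have hrem : ∀ σ, KernelSymbol α (1 / 2 + 6 * d) W (kerRem V σ) := fun σ =>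
    (hsymb σ).2.mono fun x y => by simp only [hWdef]; linarith [hw0 x y]
  have hfull : ∀ σ, KernelSymbol α (-d) W (kerFull V σ) := fun σ =>
    (hsymb σ).1.add ((hsymb σ).2.mono_exponent (by linarith) hw0)
  have hsk : ∀ σ, ∀ l ∈ Ioo (0 : ℝ) 1, HSKernel (kerSing V σ l) := fun σ l hl =>
    (hsing σ).hsKernel hW hl
  have hrk : ∀ σ, ∀ l ∈ Ioo (0 : ℝ) 1, HSKernel (kerRem V σ l) := fun σ l hl =>
    (hrem σ).hsKernel hW hl
  have hG : HSKernel fun x y => Schr2D.v V x * G0 x y * Schr2D.v V y :=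
    -- Any sign and any λ in (0,1) would do here.
    HSKernel.G0 hv (hsk 1 (1 / 2) (by norm_num))
  have hT := adjoint_T hVm hG
  have hTk := isMulAddKernel_T hVm hG
  have hn := normV_pos hv hV0
  refine ⟨hTk, (rank_S_le hreg hT).trans (by norm_num), hasKernel_S hreg hT (star_vL2 hv)
    (hTk.star_comm star_U star_vG0v), ?_⟩
  obtain ⟨c, hc⟩ := exists_inverse hreg hT
  have hgc : ∀ σ l, g V σ l + c ≠ 0 := fun σ l => norm_pos_iff.1
    ((by positivity : 0 < normV V / 4).trans_le (normV_div_le c σ l))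
  set B : ℤˣ → ℝ → L2 →L[ℂ] L2 := fun σ l => (g V σ l + c)⁻¹ • S V + QDQ V with hB
  have hAB : ∀ σ, ∀ l ∈ Ioo (0 : ℝ) 1, (mulOp (memLp_U hVm) + opK (kerSing V σ l)) * B σ l = 1 ∧
      B σ l * (mulOp (memLp_U hVm) + opK (kerSing V σ l)) = 1 := fun σ l hl => by
    rw [← g_smul_P_add_T hVm hV0 hv (hsk σ l hl)]
    exact hc _ (hgc σ l)
  have hAu : ∀ σ, ∀ l ∈ Ioo (0 : ℝ) 1, IsUnit (mulOp (memLp_U hVm) + opK (kerSing V σ l)) :=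
    fun σ l hl => ⟨⟨_, _, (hAB σ l hl).1, (hAB σ l hl).2⟩, rfl⟩
  have hinvB : ∀ σ, ∀ l ∈ Ioo (0 : ℝ) 1, invSing hVm σ l = B σ l := fun σ l hl =>
    Ring.inverse_unit ⟨_, _, (hAB σ l hl).1, (hAB σ l hl).2⟩
  set a := (normV V / 4)⁻¹ * ‖S V‖ + ‖QDQ V‖ with ha
  have ha0 : 0 ≤ a := by positivity
  have hBa : ∀ σ l, ‖B σ l‖ ≤ a := fun σ l => by
    refine (norm_add_le _ _).trans (add_le_add_left ?_ _)
    rw [norm_smul, norm_inv]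
    exact mul_le_mul_of_nonneg_right
      (inv_anti₀ (by positivity) (normV_div_le c σ l)) (norm_nonneg _)
  set ρ := (eLpNorm (fun q : Plane × Plane => W q.1 q.2) 2 volume).toReal with hρ
  have hremρ : ∀ σ, ∀ l ∈ Ioo (0 : ℝ) 1, ‖opK (kerRem V σ l)‖ ≤ ρ * l ^ (1 / 2 + 6 * d) :=
    fun σ l hl => ((hrem σ).opK hα0 (by linarith) hW).bound l hl
  -- Below l₀ the norm bounds for A⁻¹ and r have product at most 1/2, as the Neumann series
  -- requires.
  obtain ⟨l₀, hl₀, hl₀1, hl₀2⟩ : ∃ l₀ : ℝ, 0 < l₀ ∧ l₀ ≤ 1 ∧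
      ∀ l ∈ Ioo 0 l₀, a * (ρ * l ^ (1 / 2 + 6 * d)) ≤ 1 / 2 := by
    have hlim : Filter.Tendsto (fun l : ℝ => a * (ρ * l ^ (1 / 2 + 6 * d))) (nhds 0) (nhds 0) := by
      have := ((Real.continuous_rpow_const (by linarith : 0 ≤ 1 / 2 + 6 * d)).tendsto
        0).const_mul ρ |>.const_mul a
      rwa [Real.zero_rpow (by linarith), mul_zero, mul_zero] at this
    obtain ⟨r, hr, hball⟩ := Metric.eventually_nhds_iff.1
      (hlim.eventually (ge_mem_nhds (by norm_num : (0 : ℝ) < 1 / 2)))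
    refine ⟨min r 1, by positivity, min_le_right _ _, fun l hl => hball ?_⟩
    rw [Real.dist_eq, sub_zero, abs_of_pos hl.1]
    exact hl.2.trans_le (min_le_left _ _)
  have hsub : ∀ l ∈ Ioo 0 l₀, l ∈ Ioo (0 : ℝ) 1 := fun l hl => ⟨hl.1, hl.2.trans_le hl₀1⟩
  have hfulleq : ∀ σ, ∀ l ∈ Ioo 0 l₀, mulOp (memLp_U hVm) + opK (kerFull V σ l) =
      mulOp (memLp_U hVm) + opK (kerSing V σ l) + opK (kerRem V σ l) := fun σ l hl => by
    rw [add_assoc]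
    congr 1
    exact opK_add (hsk σ l (hsub l hl)) (hrk σ l (hsub l hl))
  have hMu : ∀ σ, ∀ l ∈ Ioo 0 l₀, IsUnit (mulOp (memLp_U hVm) + opK (kerFull V σ l)) ∧
      ‖invFull hVm σ l‖ ≤ 2 * a := fun σ l hl => by
    rw [invFull, hfulleq σ l hl]
    exact isUnit_add_of_small (hAB σ l (hsub l hl)).1 (hAB σ l (hsub l hl)).2 (hBa σ l)
      (hremρ σ l (hsub l hl)) (hl₀2 l hl)
  -- The perturbed inverse is bounded by 2a, and this weaker constant is used for both inverses.
  have hker := fun σ => exists_kerError_symbol hVm (a := 2 * a) hα0 hα1.le hd0 (by linarith)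
    hl₀ hl₀1 hW hWsymm (hsing σ) (hrem σ) (hfull σ) (fun l hl => hAu σ l (hsub l hl))
    (fun l hl => (hMu σ l hl).1) (fun l hl => by
      rw [hinvB σ l (hsub l hl)]; linarith [hBa σ l]) (fun l hl => (hMu σ l hl).2)
  choose C hC0 hC using hker
  obtain ⟨hWx, hN⟩ := ae_memLp_section hW
  set N : Plane → ℝ := fun x => (eLpNorm (W x) 2 volume).toReal with hNdef
  -- The sum dominates the constants of both signs.
  set K := C 1 + C (-1) with hK
  set D : Plane × Plane → ℝ := fun q => W q.1 q.2 + K * (N q.1 * N q.2) with hD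
  have hDmem : MemLp D 2 volume := hW.add ((memLp_mul_prod hN hN).const_mul K)
  have hsym : ∀ σ, ∀ᵐ q : Plane × Plane,
      HolderSymbol α (1 / 2) l₀ (fun l => kerError hVm σ l q.1 q.2) (D q) := fun σ => by
    filter_upwards [ae_prod_ne, Measure.quasiMeasurePreserving_fst.ae hWx,
      Measure.quasiMeasurePreserving_snd.ae hWx] with q h1 h2 h3
    refine (hC σ q.1 q.2 h1 h2 h3).mono_const ?_
    have hCK : C σ ≤ K := by
      rcases Int.units_eq_one_or σ with rfl | rfl
      · linarith [hC0 (-1)]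
      · linarith [hC0 1]
    have hNN : 0 ≤ N q.1 * N q.2 := mul_nonneg ENNReal.toReal_nonneg ENNReal.toReal_nonneg
    simp only [hD]
    gcongr
  -- E is the difference of the two inverses, so the expansion holds by definition. The final
  -- constant is built from the L² norms of D and 2D over all of (0, l₀), hence does not depend on
  -- l₁.
  refine ⟨c, fun σ l => invFull hVm σ l - invSing hVm σ l, kerError hVm, l₀, hl₀,
    (eLpNorm D 2 volume + eLpNorm D 2 volume +
      eLpNorm (fun q => 2 * D q) 2 volume).toNNReal, fun l₁ hl₁ hl₁₀ σ => ⟨fun l hl => ?_, ?_, ?_⟩⟩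
  · have hl' : l ∈ Ioo 0 l₀ := ⟨hl.1, hl.2.trans_le hl₁₀⟩
    have hl1 := hsub l hl'
    obtain ⟨hMk, hMe⟩ := isMulAddKernel_M hVm hl.1 (hsk σ l hl1) (hrk σ l hl1)
    have hMe : Schr2D.M V σ l = mulOp (memLp_U hVm) + opK (kerFull V σ l) := hMe
    refine ⟨hMk, by rw [hMe]; exact (hMu σ l hl').1, hgc σ l, ?_, hasKernel_kerError hVm
      (hsk σ l hl1) (hrk σ l hl1) (hAu σ l hl1) (hMu σ l hl').1⟩
    have e1 : (g V σ l + c)⁻¹ • S V + QDQ V = invSing hVm σ l := (hinvB σ l hl1).symm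
    rw [e1, hMe, add_sub_cancel, invFull]
  · filter_upwards [hsym σ] with q hq l hl using hq.diff l ⟨hl.1, hl.2.trans_le hl₁₀⟩
  · rw [ENNReal.coe_toNNReal]
    · refine add_le_add (add_le_add (hsNorm_le_eLpNorm ?_) (hsNorm_le_eLpNorm ?_))
        (hsNorm_le_eLpNorm ?_)
      · filter_upwards [hsym σ] with q hq using sup0_le hq hl₁₀
      · filter_upwards [hsym σ] with q hq using sup1_le hq hl₁₀
      · filter_upwards [hsym σ] with q hq using supHolder_le hq hα0.le hl₀ hl₁₀
    · exact ENNReal.add_ne_top.2 ⟨ENNReal.add_ne_top.2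
        ⟨hDmem.eLpNorm_ne_top, hDmem.eLpNorm_ne_top⟩, (hDmem.const_mul 2).eLpNorm_ne_top⟩
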